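/- Fix an integer $N\ge 1$. The $3N$-gasket $K$ is the quotient $\pi:\Sigma\to K$ of the space $\Sigma=\{1,\dots,3N\}^{\mathbb N}$ of infinite words obtained by identifying $w\,i\,(2N)\,\overline N$ with $w\,j\,(3N)\,\overline N$ for all finite words $w$ and all letters $i\equiv j+1 \pmod{3N}$, where $\overline N=NNN\cdots$. Let $F_i:K\to K$ be the map induced by prefixing the letter $i$, let $v_1=\pi(\overline N)$, $v_k=F_{kN}(v_1)$ for $k=1,2,3$, $V_0=\{v_1,v_2,v_3\}$ and $V_{n+1}=\bigcup_{i=1}^{3N}F_i(V_n)$. Join two distinct points $x,y\in V_n$ by an edge, $x\sim y$, if $x,y\in F_{i_1}\circ\cdots\circ F_{i_n}(V_0)$ for some letters $i_1,\dots,i_n$, and for $f:V_n\to\mathbb R$ put $\Delta_nf(x)=f(x)-\frac1{d_x}\sum_{y\sim x}f(y)$, where $d_x$ is the degree of $x$. Let $\operatorname{mult}_n(z)$ be the multiplicity of $z$ as an eigenvalue of $\Delta_n$ and let $\kappa_n$ be the measure $$\kappa_n=\sum_{z\in\sigma(\Delta_n)}\frac{\operatorname{mult}_n(z)\,(3N-1)}{3N+(6N-3)(3N)^n}\,\delta_z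 .$$ With $T_k,U_k$ the Chebyshev polynomials of the first and second kind, let $C(z)=2T_N(1-2z)+2U_{N-1}(1-2z)+1$, $\mathcal A=\{z\in\mathbb C: C(z)=0\}$, and let $R$ be the rational function $$R(z)=\frac{(z-1)\sqrt z\,U_{N-1}(\sqrt z)\,C(z)}{T_N(\sqrt z)}\ (N\text{ even}),\qquad R(z)=\frac{\sqrt z\,T_N(\sqrt z)\,C(z)}{U_{N-1}(\sqrt z)}\ (N\text{ odd}),$$ with $m$-th iterate $R^m$ and iterated preimages $R^{-m}$ in $\mathbb C$. Let $J=\{j\in\{1,\dots,3N-1\}: j\ne 3N/2\}$ (the condition $j\neq 3N/2$, equivalently $\sin^2(j\pi/(3N))\ne1$, matters only for even $N$). Then every $\kappa_n$ is a probability measure, and there is a pure point probability measure $\kappa$ on $\mathbb R$ (the integrated density of states) such that $\kappa_n\to\kappa$ weakly and $\kappa_n(\{z\})\to\kappa(\{z\})$ for every $z\in\mathbb R$. The set of atoms of $\kappa$ is $$\Big\{\tfrac32\Big\}\cup\bigcup_{k=0}^{\infty}R^{-k}\Big(\mathcal A\cup\{\sin^2(j\pi/(3N)):j\in J\}\Big)$$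 (in particular this set is real), and the masses are: (i) $\kappa(\{3/2\})=\dfrac{3N-2}{6N-3}$; (ii) if $m\ge0$, $j\in J$ and $R^m(z)=\sin^2(j\pi/(3N))$, then $\kappa(\{z\})=\dfrac{3N-2}{6N-3}(3N)^{-m-1}$ if $3\nmid j$, and $\kappa(\{z\})=\dfrac{3N-1}{6N-3}(3N)^{-m-1}$ if $3\mid j$; (iii) if $m\ge0$ and $R^m(z)\in\mathcal A$, then $\kappa(\{z\})=(3N)^{-m-1}(6N-3)^{-1}$. -/

import Mathlib

namespace Gasket

/-- The alphabet `{1, …, 3N}`, read modulo `3N` (so that the letter `3N` is the class of `0`). -/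
abbrev Letter (N : ℕ) : Type := ZMod (3 * N)

/-- The identifications which define the `3N`-gasket as a quotient of the shift space: for every
finite word `w` and all letters `i`, `j` with `i ≡ j + 1` modulo `3N`, the infinite words
`w i (2N) N N N …` and `w j (3N) N N N …` are identified. -/
inductive Glue (N : ℕ) : Stream' (Letter N) → Stream' (Letter N) → Prop
  | mk (w : List (Letter N)) (i j : Letter N) (h : i = j + 1) :
      Glue N
        (Stream'.appendStream' w
          (Stream'.cons i (Stream'.cons ((2 * N : ℕ) : Letter N)
            (Stream'.const ((N : ℕ) : Letter N)))))
        (Stream'.appendStream' w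
          (Stream'.cons j (Stream'.cons ((3 * N : ℕ) : Letter N)
            (Stream'.const ((N : ℕ) : Letter N)))))

/-- The `3N`-gasket `K`: the quotient of the space of infinite words by the equivalence relation
generated by `Glue N`. -/
def K (N : ℕ) : Type := Quot (Glue N)

/-- The contraction `F_i : K → K`, induced by prefixing the letter `i`. -/
def F {N : ℕ} (i : Letter N) : K N → K N :=
  Quot.map (Stream'.cons i) (by
    rintro _ _ ⟨w, a, b, h⟩
    exact Glue.mk (i :: w) a b h)

/-- `F_w = F_{i_1} ∘ ⋯ ∘ F_{i_n}` for a finite word `w = i_1 … i_n`. -/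
def Fword {N : ℕ} : List (Letter N) → K N → K N
  | [] => id
  | i :: w => F i ∘ Fword w

/-- The boundary point `v_1`, the class of `N N N …`. -/
def v₁ (N : ℕ) : K N := Quot.mk _ (Stream'.const ((N : ℕ) : Letter N))

/-- The boundary points `v_k = F_{kN}(v_1)`, for `k = 1, 2, 3`. -/
def v (N k : ℕ) : K N := F ((k * N : ℕ) : Letter N) (v₁ N)

/-- `V_0 = {v_1, v_2, v_3}` and `V_{n+1} = ⋃_i F_i(V_n)`. -/
def V (N : ℕ) : ℕ → Set (K N)
  | 0 => {v N 1, v N 2, v N 3}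
  | n + 1 => ⋃ i : Letter N, F i '' V N n

theorem V_finite (N : ℕ) [NeZero N] (n : ℕ) : (V N n).Finite := by
  induction n with
  | zero => simp [V]
  | succ n ih => exact Set.finite_iUnion fun i => ih.image _

noncomputable instance (N : ℕ) [NeZero N] (n : ℕ) : Fintype (V N n) :=
  (V_finite N n).fintype

/-- The `n`-th approximating graph: two distinct points of `V_n` are adjacent if they belong to
a common cell boundary `F_w(V_0)` with `w` a word of length `n`. -/
def graph (N n : ℕ) : SimpleGraph (V N n) where
  Adj x y := x ≠ y ∧ ∃ w : List (Letter N), w.length = n ∧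
    (x : K N) ∈ Fword w '' V N 0 ∧ (y : K N) ∈ Fword w '' V N 0
  symm := ⟨fun _ _ ⟨hne, w, hw, hx, hy⟩ => ⟨hne.symm, w, hw, hy, hx⟩⟩
  loopless := ⟨fun _ h => h.1 rfl⟩

open Classical in
/-- The graph Laplacian `Δ_n f(x) = f(x) - (1 / d_x) ∑_{y ∼ x} f(y)` on `ℓ(V_n)`. -/
noncomputable def laplacian (N : ℕ) [NeZero N] (n : ℕ) :
    Module.End ℝ (V N n → ℝ) where
  toFun f x := f x - 1 / ((graph N n).degree x : ℝ) * ∑ y ∈ (graph N n).neighborFinset x, f y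
  map_add' f g := by
    funext x
    simp only [Pi.add_apply, Finset.sum_add_distrib]
    ring
  map_smul' c f := by
    funext x
    simp only [Pi.smul_apply, smul_eq_mul, RingHom.id_apply, ← Finset.mul_sum]
    ring

/-- The multiplicity of `z` as an eigenvalue of `Δ_n`. As `Δ_n` is self-adjoint for the inner
product weighted by the degrees, geometric and algebraic multiplicities agree. -/
noncomputable def mult (N : ℕ) [NeZero N] (n : ℕ) (z : ℝ) : ℕ :=
  Module.finrank ℝ ((laplacian N n).eigenspace z)

/-- The normalized eigenvalue counting measure: the sum, over the eigenvalues `z` of `Δ_n`, of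
point masses at `z` of size `mult_n(z) (3N - 1) / (3N + (6N - 3) (3N)^n)`. -/
noncomputable def kappaN (N : ℕ) [NeZero N] (n : ℕ) : MeasureTheory.FiniteMeasure ℝ :=
  ∑ z ∈ (laplacian N n).finite_hasEigenvalue.toFinset,
    Real.toNNReal ((mult N n z : ℝ) * (3 * N - 1) / (3 * N + (6 * N - 3) * (3 * N) ^ n)) •
      (MeasureTheory.diracProba z).toFiniteMeasure

/-- The Chebyshev expression `2 T_N(1 - 2z) + 2 U_{N-1}(1 - 2z) + 1`. -/
noncomputable def chebFactor (N : ℕ) (z : ℂ) : ℂ :=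
  2 * (Polynomial.Chebyshev.T ℂ N).eval (1 - 2 * z) +
    2 * (Polynomial.Chebyshev.U ℂ ((N : ℤ) - 1)).eval (1 - 2 * z) + 1

/-- The spectral decimation function `R`. The value does not depend on the choice of the square
root. At a pole of `R` the convention `x / 0 = 0` gives the value `0`, a fixed point of `R`; so
an orbit through a pole never reaches a nonzero point afterwards, exactly as an orbit through the
fixed point `∞` of the Riemann sphere never reaches a finite point. -/
noncomputable def R (N : ℕ) (z : ℂ) : ℂ :=
  if Even N then
    (z - 1) * Complex.sqrt z *
      (Polynomial.Chebyshev.U ℂ ((N : ℤ) - 1)).eval (Complex.sqrt z) * chebFactor N z /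
        (Polynomial.Chebyshev.T ℂ N).eval (Complex.sqrt z)
  else
    Complex.sqrt z * (Polynomial.Chebyshev.T ℂ N).eval (Complex.sqrt z) * chebFactor N z /
      (Polynomial.Chebyshev.U ℂ ((N : ℤ) - 1)).eval (Complex.sqrt z)

/-- The set `𝒜` of zeros of `2 T_N(1 - 2z) + 2 U_{N-1}(1 - 2z) + 1`. -/
def setA (N : ℕ) : Set ℂ := {z | chebFactor N z = 0}

/-- The point `sin²(jπ / (3N))`, as a complex number. -/
noncomputable def sinSq (N j : ℕ) : ℂ := ((Real.sin (j * Real.pi / (3 * N)) ^ 2 : ℝ) : ℂ)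

/-- The indices `j = 1, …, 3N - 1` with `sin²(jπ / (3N)) ≠ 1`, that is with `j ≠ 3N / 2`
(a restriction only for even `N`). -/
def indexSet (N : ℕ) : Set ℕ := {j | 1 ≤ j ∧ j + 1 ≤ 3 * N ∧ 2 * j ≠ 3 * N}

/-- The set `{3/2} ∪ ⋃_k R^{-k}(𝒜 ∪ {sin²(jπ / (3N))})`, where all complex preimages count. -/
def atomSet (N : ℕ) : Set ℂ :=
  {3 / 2} ∪ ⋃ k : ℕ, (R N)^[k] ⁻¹' (setA N ∪ sinSq N '' indexSet N)

end Gasket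

/-! Only lower bounds for multiplicities are proved; counting supplies the rest. The mass of
`kappaN` at `z` is the multiplicity divided by the number of vertices (`card_V`), and `Δ_n` is
symmetric for the degree-weighted inner product, so the masses sum to one (`sum_mult`,
`hasSum_massN`). If, at each point, the masses are bounded below by a sequence converging to `c(z)`,
where the `c(z)` also sum to one, then they converge to `c` in `ℓ¹` (`tendsto_tsum_abs_sub`, a
Scheffé argument). This gives weak convergence and convergence at points together.

For the lower bounds, subdivide one cell. Its `3N` subcells form a ring; each has two vertices on
the ring and one outer vertex, and the outer vertices of the letters `N`, `2N`, `3N` are the old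
corners. With `x = 1 - 2z`, a solution `γ` of `γ(m+1) + γ(m-1) = 2xγ(m)` yields a solution of the
eigenvalue equation along the ring, apart from the place where the ring is cut. Chebyshev sequences
therefore give explicit solutions on a cell (`ofSeq_mem_cellSol`). A global eigenfunction arises
from cell solutions that agree at the old vertices and have fluxes summing to zero there
(`finrank_le_mult`).

The solution `green` has flux at one corner only, and its rotations make the map from sources to
corner values a combination of the identity and the all-ones matrix. Hence eigenfunctions of level
`n` for `R(z)` extend to level `n + 1` for `z` (`mult_le_mult_succ`), for `R(z)` in `(0, 3/2)`. New
eigenfunctions come from functions with zero sum on every cell (`z = 3/2`, and `3 ∤ j`), from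
functions supported in one cell (`3 ∣ j`), and, at zeros of `C`, from sources in the kernel of the
degenerate response matrix.

For the count, put `d = ⌊3N/2⌋ + 1`. Each `y` in `(0, 3/2)` has exactly `d` preimages under `R`, all
real and again in that interval (`exists_fiber_R`), by sign changes of a polynomial of degree at
most `d` at explicit points. Points of the initial set leave the interval after one step, so the
preimage sets are disjoint (`iterate_unique`). The initial weight is `(3N-1)(3N-d)` (`tsum_weight`),
and a geometric series of ratio `d/(3N)` sums it to `(3N-1)/(6N-3)`. This is exactly the complement
of the mass `(3N-2)/(6N-3)` at `3/2`. -/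

namespace Gasket

/-! ### Infinite words and equality of points of the gasket -/

section Streams

variable {α : Type*}

/-- The last letter different from `c` marks its own position, so both the prefix and that letter
can be read off the infinite word. -/
theorem append_cons_const_inj {c a a' : α} {l l' : List α} (ha : a ≠ c) (ha' : a' ≠ c)
    (h : l ++ₛ Stream'.cons a (Stream'.const c) = l' ++ₛ Stream'.cons a' (Stream'.const c)) :
    l = l' ∧ a = a' := by
  have key : ∀ {a a' : α} {l l' : List α}, a' ≠ c →
      l ++ₛ Stream'.cons a (Stream'.const c) = l' ++ₛ Stream'.cons a' (Stream'.const c) →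
      l'.length ≤ l.length := by
    intro a a' l l' ha' h
    by_contra! hlt
    obtain ⟨d, hd⟩ := Nat.exists_eq_add_of_lt hlt
    have h1 : (l' ++ₛ Stream'.cons a' (Stream'.const c)).get l'.length = a' := by
      rw [Stream'.get_append_length]; rfl
    rw [← h, hd, Nat.add_assoc, Stream'.get_append_right] at h1
    exact ha' h1.symm
  have hl := le_antisymm (key ha h.symm) (key ha' h)
  obtain rfl := Stream'.append_left_injective _ _ _ _ h hl
  rw [Stream'.append_right_inj] at h
  exact ⟨rfl, congrArg Stream'.head h⟩

theorem const_append_cons_length_lt {c a' : α} {l l' : List α} (ha' : a' ≠ c)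
    (h : l ++ₛ Stream'.const c = l' ++ₛ Stream'.cons a' (Stream'.const c)) :
    l'.length < l.length := by
  by_contra! hlt
  obtain ⟨d, hd⟩ := Nat.exists_eq_add_of_le hlt
  have h1 : (l' ++ₛ Stream'.cons a' (Stream'.const c)).get l'.length = a' := by
    rw [Stream'.get_append_length]; rfl
  rw [← h, hd, Stream'.get_append_right] at h1
  exact ha' h1.symm

theorem cons_const_self (c : α) : Stream'.cons c (Stream'.const c) = Stream'.const c :=
  (Stream'.const_eq c).symm

end Streams

variable {N : ℕ}

/-- The letters `N`, `2N`, `3N` of the three cells which carry the boundary. -/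
def bdry (N : ℕ) (k : Fin 3) : Letter N := (((k : ℕ) + 1) * N : ℕ)

theorem bdry_injective [NeZero N] : Function.Injective (bdry N) := by
  intro k k' h
  have h1 := (ZMod.natCast_eq_natCast_iff _ _ _).1 h
  have h2 := Nat.ModEq.mul_right_cancel' (NeZero.ne N) h1
  have h3 : (k : ℕ) ≡ k' [MOD 3] := Nat.ModEq.add_right_cancel' 1 h2
  exact Fin.ext (Nat.ModEq.eq_of_lt_of_lt h3 k.2 k'.2)

theorem bdry_zero : bdry N 0 = (N : Letter N) := by simp [bdry]
theorem bdry_one : bdry N 1 = ((2 * N : ℕ) : Letter N) := by simp [bdry]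
theorem bdry_two : bdry N 2 = ((3 * N : ℕ) : Letter N) := by simp [bdry]

/-- The infinite word `l (kN) N N N …`. -/
def addr (l : List (Letter N)) (k : Fin 3) : Stream' (Letter N) :=
  l ++ₛ Stream'.cons (bdry N k) (Stream'.const (bdry N 0))

theorem glue_iff {s t : Stream' (Letter N)} :
    Glue N s t ↔ ∃ (u : List (Letter N)) (j : Letter N),
      s = addr (u ++ [j + 1]) 1 ∧ t = addr (u ++ [j]) 2 := by
  constructor
  · rintro ⟨w, i, j, rfl⟩
    refine ⟨w, j, ?_, ?_⟩ <;>
    simp only [addr, Stream'.append_append_stream, bdry_zero, bdry_one, bdry_two] <;> rfl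
  · rintro ⟨u, j, rfl, rfl⟩
    have := Glue.mk u (j + 1) j rfl
    simp only [addr, Stream'.append_append_stream, bdry_zero, bdry_one, bdry_two]
    exact this

theorem bdry_ne_zero [NeZero N] {k : Fin 3} (hk : k ≠ 0) : bdry N k ≠ bdry N 0 :=
  fun h => hk (bdry_injective h)

theorem addr_inj [NeZero N] {l l' : List (Letter N)} {k k' : Fin 3} (hk : k ≠ 0) (hk' : k' ≠ 0)
    (h : addr l k = addr l' k') : l = l' ∧ k = k' := by
  obtain ⟨h1, h2⟩ := append_cons_const_inj (bdry_ne_zero hk) (bdry_ne_zero hk') h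
  exact ⟨h1, bdry_injective h2⟩

/-- Classes of the generated equivalence relation have at most two elements. The last letter
different from `N` is `2N` on the left side of a gluing and `3N` on the right, so no word is on both
sides; and each side determines its partner. Transitivity thus produces nothing new. -/
theorem mk_eq_mk_iff [NeZero N] {s t : Stream' (Letter N)} :
    (Quot.mk (Glue N) s = Quot.mk (Glue N) t) ↔ s = t ∨ Glue N s t ∨ Glue N t s := by
  constructor
  · intro h
    have h' := Quot.eqvGen_exact h
    clear h
    induction h' with
    | rel x y h => exact Or.inr (Or.inl h)
    | refl x => exact Or.inl rfl
    | symm x y _ ih =>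
      rcases ih with h | h | h
      · exact Or.inl h.symm
      · exact Or.inr (Or.inr h)
      · exact Or.inr (Or.inl h)
    | trans x y z _ _ ih1 ih2 =>
      rcases ih1 with rfl | h1 | h1
      · exact ih2
      · rcases ih2 with rfl | h2 | h2
        · exact Or.inr (Or.inl h1)
        · exfalso
          obtain ⟨u, j, -, hy⟩ := glue_iff.1 h1
          obtain ⟨u', j', hy', -⟩ := glue_iff.1 h2
          have := (addr_inj (by decide) (by decide) (hy.symm.trans hy')).2
          revert this; decide
        · left
          obtain ⟨u, j, rfl, hy⟩ := glue_iff.1 h1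
          obtain ⟨u', j', rfl, hy'⟩ := glue_iff.1 h2
          have := (addr_inj (by decide) (by decide) (hy.symm.trans hy')).1
          obtain ⟨rfl, h⟩ := List.append_inj' this rfl
          simp at h
          rw [h]
      · rcases ih2 with rfl | h2 | h2
        · exact Or.inr (Or.inr h1)
        · left
          obtain ⟨u, j, hy, rfl⟩ := glue_iff.1 h1
          obtain ⟨u', j', hy', rfl⟩ := glue_iff.1 h2
          have := (addr_inj (by decide) (by decide) (hy.symm.trans hy')).1
          obtain ⟨rfl, h⟩ := List.append_inj' this rfl
          simp at h
          rw [h]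
        · exfalso
          obtain ⟨u, j, hy, -⟩ := glue_iff.1 h1
          obtain ⟨u', j', -, hy'⟩ := glue_iff.1 h2
          have := (addr_inj (by decide) (by decide) (hy.symm.trans hy')).2
          revert this; decide
  · rintro (rfl | h | h)
    · rfl
    · exact Quot.sound h
    · exact (Quot.sound h).symm

theorem addr_zero (l : List (Letter N)) : addr l 0 = l ++ₛ Stream'.const (bdry N 0) := by
  rw [addr, cons_const_self]

theorem addr_append_bdry (l : List (Letter N)) (k : Fin 3) : addr (l ++ [bdry N k]) 0 = addr l k := by
  rw [addr_zero, Stream'.append_append_stream]; rfl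

/-- If a word of the form `l N N N …` equals an `addr` with nonzero label and larger length is
excluded, then the last letter of `l` is a boundary letter. -/
theorem last_eq_bdry [NeZero N] {l l' : List (Letter N)} {k : Fin 3} (hk : k ≠ 0)
    (h : addr l 0 = addr l' k) : ∃ u k', l = u ++ [bdry N k'] := by
  have hlt := const_append_cons_length_lt (bdry_ne_zero hk) ((addr_zero l).symm.trans h)
  rcases List.eq_nil_or_concat l with rfl | ⟨u, i, rfl⟩
  · simp at hlt
  · rw [List.concat_eq_append] at *
    by_cases hi : i = bdry N 0
    · exact ⟨u, 0, by rw [hi]⟩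
    · rw [addr_zero, Stream'.append_append_stream] at h
      obtain ⟨-, rfl⟩ := append_cons_const_inj hi (bdry_ne_zero hk) h
      exact ⟨u, k, rfl⟩

/-- Either the gluing takes place at the last letter of both words, between ring neighbours, or it
was made at an earlier level; then both points are old vertices, with label `0` and last letters
among `N`, `2N`, `3N`. In the mixed cases the distinguishing letter would sit at different depths,
contradicting equal lengths. -/
theorem glue_addr [NeZero N] {l l' : List (Letter N)} (hl : l.length = l'.length) {a b : Fin 3}
    (h : Glue N (addr l a) (addr l' b)) :
    (a = 1 ∧ b = 2 ∧ ∃ u j, l = u ++ [j + 1] ∧ l' = u ++ [j]) ∨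
    (a = 0 ∧ b = 0 ∧ ∃ u u' k k', l = u ++ [bdry N k] ∧ l' = u' ++ [bdry N k']) := by
  obtain ⟨u, j, h1, h2⟩ := glue_iff.1 h
  by_cases ha : a = 0
  · subst ha
    by_cases hb : b = 0
    · subst hb
      obtain ⟨v, k, hv⟩ := last_eq_bdry (by decide) h1
      obtain ⟨v', k', hv'⟩ := last_eq_bdry (by decide) h2
      exact Or.inr ⟨rfl, rfl, v, v', k, k', hv, hv'⟩
    · exfalso
      have := const_append_cons_length_lt (bdry_ne_zero (by decide)) ((addr_zero l).symm.trans h1)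
      rw [(addr_inj hb (by decide) h2).1] at hl
      simp at this hl
      omega
  · by_cases hb : b = 0
    · exfalso
      subst hb
      have := const_append_cons_length_lt (bdry_ne_zero (by decide)) ((addr_zero l').symm.trans h2)
      rw [(addr_inj ha (by decide) h1).1] at hl
      simp at this hl
      omega
    · obtain ⟨rfl, rfl⟩ := addr_inj ha (by decide) h1
      obtain ⟨rfl, rfl⟩ := addr_inj hb (by decide) h2
      exact Or.inl ⟨rfl, rfl, u, j, rfl, rfl⟩

theorem mk_addr_eq [NeZero N] {l l' : List (Letter N)} (hl : l.length = l'.length) {a b : Fin 3}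
    (h : Quot.mk (Glue N) (addr l a) = Quot.mk (Glue N) (addr l' b)) :
    (l = l' ∧ a = b) ∨
    (a = 1 ∧ b = 2 ∧ ∃ u j, l = u ++ [j + 1] ∧ l' = u ++ [j]) ∨
    (a = 2 ∧ b = 1 ∧ ∃ u j, l = u ++ [j] ∧ l' = u ++ [j + 1]) ∨
    (a = 0 ∧ b = 0 ∧ ∃ u u' k k', l = u ++ [bdry N k] ∧ l' = u' ++ [bdry N k']) := by
  rcases mk_eq_mk_iff.1 h with h | h | h
  · left
    obtain rfl := Stream'.append_left_injective _ _ _ _ h hl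
    rw [addr, addr, Stream'.append_right_inj] at h
    exact ⟨rfl, bdry_injective (congrArg Stream'.head h)⟩
  · rcases glue_addr hl h with h | h
    · exact Or.inr (Or.inl h)
    · exact Or.inr (Or.inr (Or.inr h))
  · rcases glue_addr hl.symm h with ⟨hb, ha, u, j, h1, h2⟩ | ⟨hb, ha, u, u', k, k', h1, h2⟩
    · exact Or.inr (Or.inr (Or.inl ⟨ha, hb, u, j, h2, h1⟩))
    · exact Or.inr (Or.inr (Or.inr ⟨ha, hb, u', u, k', k, h2, h1⟩))

/-! ### Finite words, and the vertices of one level in terms of the previous level -/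

/-- Words of length `n`, written from left to right. -/
def Word (N : ℕ) : ℕ → Type
  | 0 => Unit
  | n + 1 => Word N n × Letter N

/-- The list of letters of a word. -/
def Word.toList : {n : ℕ} → Word N n → List (Letter N)
  | 0, _ => []
  | _ + 1, (w, i) => Word.toList w ++ [i]

/-- The word `w i`. -/
def Word.snoc {n : ℕ} (w : Word N n) (i : Letter N) : Word N (n + 1) := (w, i)

theorem Word.snoc_inj {n : ℕ} {w w' : Word N n} {i i' : Letter N} :
    w.snoc i = w'.snoc i' ↔ w = w' ∧ i = i' := Prod.ext_iff

theorem Word.exists_snoc {n : ℕ} (w : Word N (n + 1)) : ∃ u i, w = Word.snoc u i := ⟨w.1, w.2, rfl⟩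

noncomputable instance Word.fintype [NeZero N] : (n : ℕ) → Fintype (Word N n)
  | 0 => inferInstanceAs (Fintype Unit)
  | n + 1 => letI := Word.fintype n; inferInstanceAs (Fintype (Word N n × Letter N))

theorem Word.sum_succ [NeZero N] {M : Type*} [AddCommMonoid M] {n : ℕ} (f : Word N (n + 1) → M) :
    ∑ W, f W = ∑ w : Word N n, ∑ i, f (w.snoc i) :=
  Fintype.sum_prod_type (α₁ := Word N n) (α₂ := Letter N) f

theorem Word.card [NeZero N] (n : ℕ) : Fintype.card (Word N n) = (3 * N) ^ n := by
  induction n with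
  | zero => rfl
  | succ n ih =>
    have : Fintype.card (Word N (n + 1)) = Fintype.card (Word N n × Letter N) := rfl
    rw [this, Fintype.card_prod, ih, ZMod.card, pow_succ]

theorem Word.toList_snoc {n : ℕ} (w : Word N n) (i : Letter N) :
    (w.snoc i).toList = w.toList ++ [i] := rfl

theorem Word.length_toList {n : ℕ} (w : Word N n) : w.toList.length = n := by
  induction n with
  | zero => rfl
  | succ n ih => obtain ⟨u, i, rfl⟩ := w.exists_snoc; simp [Word.toList_snoc, ih]

theorem Word.exists_toList (l : List (Letter N)) : ∃ w : Word N l.length, w.toList = l := by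
  induction l using List.reverseRecOn with
  | nil => exact ⟨(), rfl⟩
  | append_singleton l i ih =>
    obtain ⟨w, hw⟩ := ih
    have key : ∀ m, m = l.length + 1 → ∃ w' : Word N m, w'.toList = l ++ [i] := by
      rintro _ rfl
      exact ⟨w.snoc i, by rw [Word.toList_snoc, hw]⟩
    exact key _ (by simp)

theorem Word.toList_injective {n : ℕ} : Function.Injective (Word.toList (N := N) (n := n)) := by
  induction n with
  | zero => intro _ _ _; rfl
  | succ n ih =>
    intro w w' h
    obtain ⟨u, i, rfl⟩ := w.exists_snoc
    obtain ⟨u', i', rfl⟩ := w'.exists_snoc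
    obtain ⟨h1, h2⟩ := List.append_inj' h rfl
    rw [Word.snoc_inj]
    exact ⟨ih h1, by simpa using h2⟩

/-- The vertex `F_w(v_{k+1})`. -/
def pt {n : ℕ} (w : Word N n) (k : Fin 3) : K N := Quot.mk _ (addr w.toList k)

theorem Fword_mk (l : List (Letter N)) (s : Stream' (Letter N)) :
    Fword l (Quot.mk _ s) = Quot.mk _ (l ++ₛ s) := by
  induction l with
  | nil => rfl
  | cons i l ih => simp only [Fword, Function.comp, ih]; rfl

theorem pt_eq_Fword {n : ℕ} (w : Word N n) (k : Fin 3) : pt w k = Fword w.toList (v N (k + 1)) := by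
  rw [v, v₁, F, Quot.map, Fword_mk, ← bdry_zero]; rfl

theorem V_zero_eq : V N 0 = Set.range fun k : Fin 3 => v N (k + 1) := by
  ext x
  simp only [V, Set.mem_insert_iff, Set.mem_singleton_iff, Set.mem_range, Fin.exists_fin_succ]
  simp [eq_comm]

theorem mem_V_iff_Fword {n : ℕ} {x : K N} :
    x ∈ V N n ↔ ∃ (l : List (Letter N)) (k : Fin 3), l.length = n ∧ Fword l (v N (k + 1)) = x := by
  induction n generalizing x with
  | zero =>
    rw [V_zero_eq]
    constructor
    · rintro ⟨k, rfl⟩; exact ⟨[], k, rfl, rfl⟩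
    · rintro ⟨l, k, hl, rfl⟩; rw [List.length_eq_zero_iff] at hl; subst hl; exact ⟨k, rfl⟩
  | succ n ih =>
    simp only [V, Set.mem_iUnion, Set.mem_image]
    constructor
    · rintro ⟨i, y, hy, rfl⟩
      obtain ⟨l, k, rfl, rfl⟩ := ih.1 hy
      exact ⟨i :: l, k, rfl, rfl⟩
    · rintro ⟨l, k, hl, rfl⟩
      obtain ⟨i, l, rfl⟩ := List.exists_cons_of_length_eq_add_one hl
      exact ⟨i, _, ih.2 ⟨l, k, by simpa using hl, rfl⟩, rfl⟩

theorem mem_V_iff {n : ℕ} {x : K N} : x ∈ V N n ↔ ∃ (w : Word N n) (k : Fin 3), pt w k = x := by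
  rw [mem_V_iff_Fword]
  constructor
  · rintro ⟨l, k, rfl, rfl⟩
    obtain ⟨w, hw⟩ := Word.exists_toList l
    exact ⟨w, k, by rw [pt_eq_Fword, hw]⟩
  · rintro ⟨w, k, rfl⟩
    exact ⟨w.toList, k, w.length_toList, (pt_eq_Fword w k).symm⟩

theorem pt_mem {n : ℕ} (w : Word N n) (k : Fin 3) : pt w k ∈ V N n := mem_V_iff.2 ⟨w, k, rfl⟩

theorem pt_snoc_bdry {n : ℕ} (w : Word N n) (k : Fin 3) : pt (w.snoc (bdry N k)) 0 = pt w k := by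
  rw [pt, Word.toList_snoc, addr_append_bdry, pt]

theorem pt_snoc_two {n : ℕ} (w : Word N n) (i : Letter N) :
    pt (w.snoc i) 2 = pt (w.snoc (i + 1)) 1 :=
  (Quot.sound (glue_iff.2 ⟨w.toList, i, rfl, rfl⟩)).symm

/-- This is the local picture of all coincidences: same corner, adjacent subcells on one ring, or
two outer vertices at boundary letters, which are vertices of the previous level. -/
theorem pt_snoc_eq [NeZero N] {n : ℕ} {w w' : Word N n} {i i' : Letter N} {a b : Fin 3}
    (h : pt (w.snoc i) a = pt (w'.snoc i') b) :
    (w = w' ∧ i = i' ∧ a = b) ∨ (w = w' ∧ i = i' + 1 ∧ a = 1 ∧ b = 2) ∨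
      (w = w' ∧ i' = i + 1 ∧ a = 2 ∧ b = 1) ∨
      (a = 0 ∧ b = 0 ∧ ∃ k k', i = bdry N k ∧ i' = bdry N k') := by
  rcases mk_addr_eq (by simp only [Word.length_toList]) h with
    ⟨h, hab⟩ | ⟨ha, hb, u, j, h1, h2⟩ | ⟨ha, hb, u, j, h1, h2⟩ | ⟨ha, hb, u, u', k, k', h1, h2⟩
  · exact Or.inl ⟨(Word.snoc_inj.1 (Word.toList_injective h)).1,
      (Word.snoc_inj.1 (Word.toList_injective h)).2, hab⟩
  all_goals
    rw [Word.toList_snoc] at h1 h2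
    obtain ⟨h1, h3⟩ := List.append_inj' h1 rfl
    obtain ⟨h2, h4⟩ := List.append_inj' h2 rfl
    simp only [List.cons.injEq, and_true] at h3 h4
  · refine Or.inr (Or.inl ⟨Word.toList_injective (h1.trans h2.symm), by rw [h3, h4], ha, hb⟩)
  · refine Or.inr (Or.inr (Or.inl ⟨Word.toList_injective (h1.trans h2.symm), by rw [h3, h4], ha, hb⟩))
  · exact Or.inr (Or.inr (Or.inr ⟨ha, hb, k, k', h3, h4⟩))

section Incidence

variable [NeZero N] {n : ℕ}

theorem pt_one_eq_one {w w' : Word N n} {i i' : Letter N} :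
    pt (w.snoc i) 1 = pt (w'.snoc i') 1 ↔ w = w' ∧ i = i' := by
  constructor
  · intro h
    rcases pt_snoc_eq h with ⟨h1, h2, -⟩ | ⟨-, -, -, h⟩ | ⟨-, -, h, -⟩ | ⟨h, -⟩
    · exact ⟨h1, h2⟩
    all_goals exact absurd h (by decide)
  · rintro ⟨rfl, rfl⟩; rfl

theorem pt_two_eq_one {w w' : Word N n} {i i' : Letter N} :
    pt (w.snoc i) 2 = pt (w'.snoc i') 1 ↔ w = w' ∧ i = i' - 1 := by
  rw [pt_snoc_two, pt_one_eq_one, eq_sub_iff_add_eq]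

theorem pt_zero_ne_one {w w' : Word N n} {i i' : Letter N} :
    pt (w.snoc i) 0 ≠ pt (w'.snoc i') 1 := by
  intro h
  rcases pt_snoc_eq h with ⟨-, -, h⟩ | ⟨-, -, h, -⟩ | ⟨-, -, h, -⟩ | ⟨-, h, -⟩ <;>
  exact absurd h (by decide)

theorem pt_zero_eq_zero {w w' : Word N n} {i i' : Letter N} (hi : i ∉ Set.range (bdry N)) :
    pt (w'.snoc i') 0 = pt (w.snoc i) 0 ↔ w' = w ∧ i' = i := by
  constructor
  · intro h
    rcases pt_snoc_eq h with ⟨h1, h2, -⟩ | ⟨-, -, h, -⟩ | ⟨-, -, h, -⟩ | ⟨-, -, k, k', -, h⟩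
    · exact ⟨h1, h2⟩
    · exact absurd h (by decide)
    · exact absurd h (by decide)
    · exact absurd ⟨k', h.symm⟩ hi
  · rintro ⟨rfl, rfl⟩; rfl

theorem pt_zero_eq_pt {w w' : Word N n} {i : Letter N} {k : Fin 3} :
    pt (w'.snoc i) 0 = pt w k ↔ ∃ k', i = bdry N k' ∧ pt w' k' = pt w k := by
  constructor
  · intro h
    rw [← pt_snoc_bdry w k] at h
    rcases pt_snoc_eq h with ⟨h1, h2, -⟩ | ⟨-, -, h, -⟩ | ⟨-, -, h, -⟩ | ⟨-, -, k', k'', h1, -⟩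
    · exact ⟨k, h2, by rw [h1]⟩
    · exact absurd h (by decide)
    · exact absurd h (by decide)
    · refine ⟨k', h1, ?_⟩
      rw [← pt_snoc_bdry, ← h1, h, pt_snoc_bdry]
  · rintro ⟨k', rfl, h⟩
    rw [pt_snoc_bdry, h]

theorem pt_injective (w : Word N n) : Function.Injective (pt w) := by
  intro a b h
  rcases mk_addr_eq rfl h with ⟨-, h⟩ | ⟨-, -, u, j, h1, h2⟩ | ⟨-, -, u, j, h1, h2⟩ | ⟨ha, hb, -⟩
  · exact h
  · exfalso
    have := (List.append_inj' (h1.symm.trans h2) rfl).2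
    simp only [List.cons.injEq, and_true, add_eq_left] at this
    have h3 : Nontrivial (Letter N) := ⟨bdry N 0, bdry N 1, fun h => by
      have := bdry_injective h; revert this; decide⟩
    exact one_ne_zero this
  · exfalso
    have := (List.append_inj' (h1.symm.trans h2) rfl).2
    simp only [List.cons.injEq, and_true, left_eq_add] at this
    have h3 : Nontrivial (Letter N) := ⟨bdry N 0, bdry N 1, fun h => by
      have := bdry_injective h; revert this; decide⟩
    exact one_ne_zero this
  · rw [ha, hb]

theorem two_ne_zero_letter : (2 : Letter N) ≠ 0 := by
  intro h
  have h' : ((2 : ℕ) : ZMod (3 * N)) = 0 := by exact_mod_cast h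
  rw [ZMod.natCast_eq_zero_iff] at h'
  have := Nat.le_of_dvd (by norm_num) h'
  have := NeZero.pos N
  omega

/-- Two distinct cells of the same level share at most one vertex. -/
theorem cell_eq_of_two_common {w w' : Word N n} {k k' l l' : Fin 3} (hk : k ≠ k')
    (h1 : pt w k = pt w' l) (h2 : pt w k' = pt w' l') : w = w' := by
  have hl : l ≠ l' := by
    rintro rfl
    exact hk (pt_injective w (h1.trans h2.symm))
  cases n with
  | zero => rfl
  | succ n =>
    obtain ⟨u, i, rfl⟩ := w.exists_snoc
    obtain ⟨u', i', rfl⟩ := w'.exists_snoc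
    -- Two subcells would share two ring vertices only if each followed the other on the ring, which
    -- needs `2 = 0` modulo `3N`.
    have aux : ∀ {j j' : Letter N}, j = j' + 1 → j' = j + 1 → False := by
      intro j j' h1 h2
      apply two_ne_zero_letter (N := N)
      have h3 : j' = j' + 1 + 1 := by rw [← h1]; exact h2
      have : j' + 2 = j' + 0 := by rw [add_zero]; nth_rw 2 [h3]; ring
      exact add_left_cancel this
    rcases pt_snoc_eq h1 with ⟨h3, h4, -⟩ | ⟨h3, h4, h5, h6⟩ | ⟨h3, h4, h5, h6⟩ | ⟨h3, h4, a, b, h5, h6⟩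
    · rw [h3, h4]
    · rcases pt_snoc_eq h2 with ⟨g3, g4, -⟩ | ⟨g3, g4, g5, g6⟩ | ⟨g3, g4, g5, g6⟩ | ⟨g3, g4, a, b, g5, g6⟩
      · rw [g3, g4]
      · exact absurd (h5.trans g5.symm) hk
      · exact (aux h4 g4).elim
      · subst h3
        rw [g3, g4, g5, g6, pt_snoc_bdry, pt_snoc_bdry] at h2
        rw [g5, g6, pt_injective _ h2]
    · rcases pt_snoc_eq h2 with ⟨g3, g4, -⟩ | ⟨g3, g4, g5, g6⟩ | ⟨g3, g4, g5, g6⟩ | ⟨g3, g4, a, b, g5, g6⟩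
      · rw [g3, g4]
      · exact (aux g4 h4).elim
      · exact absurd (h5.trans g5.symm) hk
      · subst h3
        rw [g3, g4, g5, g6, pt_snoc_bdry, pt_snoc_bdry] at h2
        rw [g5, g6, pt_injective _ h2]
    · rcases pt_snoc_eq h2 with ⟨g3, g4, -⟩ | ⟨g3, g4, g5, g6⟩ | ⟨g3, g4, g5, g6⟩ | ⟨g3, g4, a, b, g5, g6⟩
      · rw [g3, g4]
      · subst g3
        rw [h3, h4, h5, h6, pt_snoc_bdry, pt_snoc_bdry] at h1
        rw [h5, h6, pt_injective _ h1]
      · subst g3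
        rw [h3, h4, h5, h6, pt_snoc_bdry, pt_snoc_bdry] at h1
        rw [h5, h6, pt_injective _ h1]
      · exact absurd (h3.trans g3.symm) hk

/-- The letters of the cells which do not carry the boundary. -/
abbrev InnerLetter (N : ℕ) : Type := {i : Letter N // i ∉ Set.range (bdry N)}

noncomputable instance : Fintype (InnerLetter N) := Fintype.ofFinite _

theorem card_innerLetter : Fintype.card (InnerLetter N) = 3 * N - 3 := by
  classical
  have h1 := Fintype.card_subtype_compl (fun i : Letter N => i ∈ Set.range (bdry N))
  have h2 : Fintype.card {i : Letter N // i ∈ Set.range (bdry N)} = 3 := by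
    rw [Fintype.card_congr (Equiv.ofInjective _ (bdry_injective (N := N))).symm, Fintype.card_fin]
  rw [h2, ZMod.card] at h1
  rw [← h1]

/-- The vertices of level `n + 1`: those of level `n` together with, in each cell, the vertices on
the ring and the free vertices of the inner letters. -/
def vertexMap (N n : ℕ) : V N n ⊕ (Word N n × Letter N) ⊕ (Word N n × InnerLetter N) → V N (n + 1)
  | Sum.inl x => ⟨x, by
      obtain ⟨w, k, h⟩ := mem_V_iff.1 x.2
      rw [← h, ← pt_snoc_bdry]; exact pt_mem _ _⟩
  | Sum.inr (Sum.inl (w, i)) => ⟨pt (w.snoc i) 1, pt_mem _ _⟩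
  | Sum.inr (Sum.inr (w, i)) => ⟨pt (w.snoc i) 0, pt_mem _ _⟩

theorem vertexMap_bijective : Function.Bijective (vertexMap N n) := by
  constructor
  · rintro (⟨x, hx⟩ | ⟨w, i⟩ | ⟨w, i, hi⟩) (⟨y, hy⟩ | ⟨w', i'⟩ | ⟨w', i', hi'⟩) h <;>
    replace h := congrArg Subtype.val h <;> simp only [vertexMap] at h
    · simp [h]
    · obtain ⟨u, k, rfl⟩ := mem_V_iff.1 hx
      rw [← pt_snoc_bdry u k] at h
      exact absurd h pt_zero_ne_one
    · obtain ⟨u, k, rfl⟩ := mem_V_iff.1 hx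
      obtain ⟨k', h', -⟩ := pt_zero_eq_pt.1 h.symm
      exact absurd ⟨k', h'.symm⟩ hi'
    · obtain ⟨u, k, rfl⟩ := mem_V_iff.1 hy
      rw [← pt_snoc_bdry u k] at h
      exact absurd h.symm pt_zero_ne_one
    · obtain ⟨rfl, rfl⟩ := pt_one_eq_one.1 h; rfl
    · exact absurd h.symm pt_zero_ne_one
    · obtain ⟨u, k, rfl⟩ := mem_V_iff.1 hy
      obtain ⟨k', h', -⟩ := pt_zero_eq_pt.1 h
      exact absurd ⟨k', h'.symm⟩ hi
    · exact absurd h pt_zero_ne_one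
    · obtain ⟨rfl, rfl⟩ := (pt_zero_eq_zero hi').1 h; rfl
  · rintro ⟨x, hx⟩
    obtain ⟨w, k, rfl⟩ := mem_V_iff.1 hx
    obtain ⟨u, i, rfl⟩ := w.exists_snoc
    have hk : k = 0 ∨ k = 1 ∨ k = 2 := by clear hx; revert k; decide
    rcases hk with rfl | rfl | rfl
    · by_cases hi : i ∈ Set.range (bdry N)
      · obtain ⟨k, rfl⟩ := hi
        exact ⟨Sum.inl ⟨pt u k, pt_mem _ _⟩, Subtype.ext (pt_snoc_bdry u k).symm⟩
      · exact ⟨Sum.inr (Sum.inr (u, ⟨i, hi⟩)), rfl⟩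
    · exact ⟨Sum.inr (Sum.inl (u, i)), rfl⟩
    · exact ⟨Sum.inr (Sum.inl (u, i + 1)), Subtype.ext (pt_snoc_two u i).symm⟩

/-- The decomposition of the vertices of level `n + 1`. -/
noncomputable def vertexEquiv (N n : ℕ) [NeZero N] :
    V N n ⊕ (Word N n × Letter N) ⊕ (Word N n × InnerLetter N) ≃ V N (n + 1) :=
  Equiv.ofBijective _ vertexMap_bijective

theorem card_V_zero : Fintype.card (V N 0) = 3 := by
  have h : Function.Bijective (fun k : Fin 3 => (⟨pt (N := N) (n := 0) () k, pt_mem _ _⟩ : V N 0)) := by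
    constructor
    · intro a b h
      exact pt_injective _ (congrArg Subtype.val h)
    · rintro ⟨x, hx⟩
      obtain ⟨w, k, rfl⟩ := mem_V_iff.1 hx
      exact ⟨k, rfl⟩
  rw [← Fintype.card_of_bijective h, Fintype.card_fin]

/-- Each cell contributes `3N` ring vertices and the `3N - 3` outer vertices that are not old
corners. -/
theorem card_V_succ : Fintype.card (V N (n + 1)) =
    Fintype.card (V N n) + (3 * N) ^ n * (6 * N - 3) := by
  rw [← Fintype.card_congr (vertexEquiv N n), Fintype.card_sum, Fintype.card_sum,
    Fintype.card_prod, Fintype.card_prod, card_innerLetter, Word.card, ZMod.card, ← mul_add]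
  have := NeZero.pos N
  congr 2
  omega

/-- This identifies the normalizing constant of `kappaN`: a point mass is its multiplicity divided
by the number of vertices. -/
theorem card_V (n : ℕ) : (3 * N - 1 : ℝ) * Fintype.card (V N n) =
    3 * N + (6 * N - 3) * (3 * N) ^ n := by
  induction n with
  | zero => rw [card_V_zero]; push_cast; ring
  | succ n ih =>
    have := NeZero.pos N
    rw [card_V_succ]
    push_cast [Nat.cast_sub (show 3 ≤ 6 * N by omega)]
    rw [mul_add, ih]
    ring

end Incidence

end Gasket

/-! ### The eigenvalue equation cell by cell, and extension to the next level -/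

namespace Gasket

variable {N : ℕ} [NeZero N] {n : ℕ}

/-- The vertex `F_w(v_{k+1})` as an element of `V_n`. -/
def vtx (w : Word N n) (k : Fin 3) : V N n := ⟨pt w k, pt_mem w k⟩

omit [NeZero N] in
theorem vtx_eq_iff {w w' : Word N n} {k k' : Fin 3} :
    vtx w k = vtx w' k' ↔ pt w k = pt w' k' := Subtype.ext_iff

omit [NeZero N] in
theorem exists_vtx (x : V N n) : ∃ w k, vtx w k = x := by
  obtain ⟨w, k, h⟩ := mem_V_iff.1 x.2
  exact ⟨w, k, Subtype.ext h⟩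

theorem graph_adj_iff {x y : V N n} : (graph N n).Adj x y ↔
    ∃ (w : Word N n) (k l : Fin 3), k ≠ l ∧ vtx w k = x ∧ vtx w l = y := by
  have hcell : ∀ (w : Word N n) (x : V N n),
      (x : K N) ∈ Fword w.toList '' V N 0 ↔ ∃ k, vtx w k = x := by
    intro w x
    rw [V_zero_eq, ← Set.range_comp]
    simp only [Set.mem_range, Function.comp, ← pt_eq_Fword, vtx, Subtype.ext_iff]
  constructor
  · rintro ⟨hne, l, rfl, hx, hy⟩
    obtain ⟨w, hw⟩ := Word.exists_toList l
    obtain ⟨k, rfl⟩ := (hcell w x).1 (by simpa only [hw] using hx)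
    obtain ⟨k', rfl⟩ := (hcell w y).1 (by simpa only [hw] using hy)
    exact ⟨w, k, k', fun h => hne (by rw [h]), rfl, rfl⟩
  · rintro ⟨w, k, l, hkl, rfl, rfl⟩
    exact ⟨fun h => hkl (pt_injective w (vtx_eq_iff.1 h)), w.toList, w.length_toList,
      (hcell w _).2 ⟨k, rfl⟩, (hcell w _).2 ⟨l, rfl⟩⟩

open Classical in
/-- The sum of `φ` over all pairs of a cell and a corner of it situated at `x`. -/
noncomputable def incSum (φ : Word N n → Fin 3 → ℝ) (x : V N n) : ℝ :=
  ∑ w, ∑ k, if vtx w k = x then φ w k else 0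

theorem incSum_congr {φ ψ : Word N n → Fin 3 → ℝ} {x : V N n}
    (h : ∀ w k, vtx w k = x → φ w k = ψ w k) : incSum φ x = incSum ψ x := by
  refine Finset.sum_congr rfl fun w _ => Finset.sum_congr rfl fun k _ => ?_
  split_ifs with hx
  · exact h w k hx
  · rfl

theorem incSum_add (φ ψ : Word N n → Fin 3 → ℝ) (x : V N n) :
    incSum (fun w k => φ w k + ψ w k) x = incSum φ x + incSum ψ x := by
  simp only [incSum, ← Finset.sum_add_distrib]
  refine Finset.sum_congr rfl fun w _ => Finset.sum_congr rfl fun k _ => ?_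
  split_ifs <;> simp

theorem incSum_smul (c : ℝ) (φ : Word N n → Fin 3 → ℝ) (x : V N n) :
    incSum (fun w k => c * φ w k) x = c * incSum φ x := by
  simp only [incSum, Finset.mul_sum]
  refine Finset.sum_congr rfl fun w _ => Finset.sum_congr rfl fun k _ => ?_
  split_ifs <;> simp

open Classical in
-- Every edge lies in exactly one cell by `cell_eq_of_two_common`, so no neighbour is counted twice
-- when summing over the cells at `x`.
theorem sum_neighborFinset (f : V N n → ℝ) (x : V N n) :
    ∑ y ∈ (graph N n).neighborFinset x, f y =
      incSum (fun w k => ∑ l, f (vtx w l) - f (vtx w k)) x := by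
  have h1 : ∑ y ∈ (graph N n).neighborFinset x, f y =
      ∑ y, if (graph N n).Adj x y then f y else 0 := by
    rw [← Finset.sum_filter]
    refine Finset.sum_congr ?_ fun _ _ => rfl
    ext y; simp
  have h2 : ∀ y, (if (graph N n).Adj x y then f y else 0) =
      ∑ w, ∑ k, ∑ l, if k ≠ l ∧ vtx w k = x ∧ vtx w l = y then f y else 0 := by
    intro y
    split_ifs with h
    · obtain ⟨w, k, l, hkl, hk, hl⟩ := graph_adj_iff.1 h
      have huniq : ∀ w' k' l', (k' ≠ l' ∧ vtx w' k' = x ∧ vtx w' l' = y) ↔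
          (w' = w ∧ k' = k ∧ l' = l) := by
        intro w' k' l'
        constructor
        · rintro ⟨h1, h2, h3⟩
          have h2' := vtx_eq_iff.1 (h2.trans hk.symm)
          have h3' := vtx_eq_iff.1 (h3.trans hl.symm)
          obtain rfl := cell_eq_of_two_common h1 h2' h3'
          exact ⟨rfl, pt_injective _ h2', pt_injective _ h3'⟩
        · rintro ⟨rfl, rfl, rfl⟩; exact ⟨hkl, hk, hl⟩
      simp only [huniq, ite_and, Finset.sum_ite_eq', Finset.mem_univ, if_true,
        Finset.sum_const_zero, Finset.sum_ite_irrel]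
    · symm
      refine Finset.sum_eq_zero fun w _ => Finset.sum_eq_zero fun k _ => Finset.sum_eq_zero fun l _ => ?_
      rw [if_neg fun h' => h (graph_adj_iff.2 ⟨w, k, l, h'⟩)]
  rw [h1, Finset.sum_congr rfl fun y _ => h2 y, Finset.sum_comm, incSum]
  refine Finset.sum_congr rfl fun w _ => ?_
  rw [Finset.sum_comm]
  refine Finset.sum_congr rfl fun k _ => ?_
  rw [Finset.sum_comm]
  split_ifs with hx
  · have : ∑ l, f (vtx w l) - f (vtx w k) = ∑ l, if k ≠ l then f (vtx w l) else 0 := by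
      rw [sub_eq_iff_eq_add, ← Finset.sum_erase_add _ _ (Finset.mem_univ k), add_left_inj,
        ← Finset.sum_filter]
      refine Finset.sum_congr ?_ fun _ _ => rfl
      ext l; simp [eq_comm]
    rw [this]
    refine Finset.sum_congr rfl fun l _ => ?_
    simp only [hx, true_and, ite_and, Finset.sum_ite_irrel, Finset.sum_const_zero]
    simp
  · simp [hx]

open Classical in
theorem degree_eq (x : V N n) : ((graph N n).degree x : ℝ) = 2 * incSum (fun _ _ => 1) x := by
  have h := sum_neighborFinset (fun _ => 1) x
  rw [Finset.sum_const, nsmul_eq_mul, mul_one, SimpleGraph.card_neighborFinset_eq_degree] at h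
  rw [h, ← incSum_smul]
  norm_num

theorem incSum_one_pos (x : V N n) : 0 < incSum (fun _ _ => 1) x := by
  obtain ⟨w, k, h⟩ := exists_vtx x
  refine Finset.sum_pos' (fun w _ => Finset.sum_nonneg fun k _ => ?_) ⟨w, Finset.mem_univ _,
    Finset.sum_pos' (fun k _ => ?_) ⟨k, Finset.mem_univ _, ?_⟩⟩
  · split_ifs <;> norm_num
  · split_ifs <;> norm_num
  · rw [if_pos h]; norm_num

/-- The eigenvalue equation, as a sum over the cells containing a vertex. -/
theorem mem_eigenspace_iff {f : V N n → ℝ} {z : ℝ} :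
    f ∈ (laplacian N n).eigenspace z ↔ ∀ x,
      incSum (fun w k => ∑ l, f (vtx w l) - (3 - 2 * z) * f (vtx w k)) x = 0 := by
  classical
  rw [Module.End.mem_eigenspace_iff, funext_iff]
  refine forall_congr' fun x => ?_
  have hc := incSum_one_pos x
  have h1 : incSum (fun w k => ∑ l, f (vtx w l) - (3 - 2 * z) * f (vtx w k)) x =
      ∑ y ∈ (graph N n).neighborFinset x, f y - 2 * (1 - z) * f x * incSum (fun _ _ => 1) x := by
    rw [sum_neighborFinset, eq_sub_iff_add_eq, ← incSum_smul, ← incSum_add]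
    refine incSum_congr fun w k h => ?_
    rw [h]; ring
  have h2 : laplacian N n f x = f x - 1 / (2 * incSum (fun _ _ => 1) x) *
      ∑ y ∈ (graph N n).neighborFinset x, f y := by
    rw [← degree_eq]; simp only [laplacian]; rfl
  rw [h1, h2, Pi.smul_apply, smul_eq_mul]
  field_simp
  constructor <;> intro h <;> linarith


/-- The space is abstract so that the norm built from the core does not clash with the supremum norm
of a function space. -/
theorem iSup_eigenspace_eq_top_of_core {E : Type*} [AddCommGroup E] [Module ℝ E]
    [FiniteDimensional ℝ E] (A : Module.End ℝ E) (c : InnerProductSpace.Core ℝ E)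
    (hA : ∀ f g, c.inner (A f) g = c.inner f (A g)) : ⨆ z, A.eigenspace z = ⊤ := by
  let _ : NormedAddCommGroup E := c.toNormedAddCommGroup
  let _ : InnerProductSpace ℝ E := InnerProductSpace.ofCore c.toCore
  have hs : LinearMap.IsSymmetric A := fun f g => hA f g
  exact Submodule.orthogonal_eq_bot_iff.1 hs.orthogonalComplement_iSup_eigenspaces_eq_bot

/-- An endomorphism which is symmetric for a weighted inner product is diagonalizable. -/
theorem iSup_eigenspace_eq_top_of_weighted {ι : Type*} [Fintype ι] (A : Module.End ℝ (ι → ℝ))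
    (d : ι → ℝ) (hd : ∀ i, 0 < d i)
    (hA : ∀ f g, ∑ i, d i * (A f i * g i) = ∑ i, d i * (f i * A g i)) :
    ⨆ z, A.eigenspace z = ⊤ := by
  let c : InnerProductSpace.Core ℝ (ι → ℝ) :=
    { inner := fun f g => ∑ i, d i * (f i * g i)
      conj_inner_symm := fun f g => by simp [mul_comm]
      re_inner_nonneg := fun f => by
        simp only [RCLike.re_to_real]
        exact Finset.sum_nonneg fun i _ => mul_nonneg (hd i).le (mul_self_nonneg _)
      add_left := fun f g h => by
        simp only [Pi.add_apply, add_mul, mul_add, Finset.sum_add_distrib]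
      smul_left := fun f g r => by
        simp only [Pi.smul_apply, smul_eq_mul, Finset.mul_sum, conj_trivial]
        exact Finset.sum_congr rfl fun i _ => by ring
      definite := fun f h => by
        funext i
        have := (Finset.sum_eq_zero_iff_of_nonneg fun i _ =>
          mul_nonneg (hd i).le (mul_self_nonneg (f i))).1 h i (Finset.mem_univ i)
        simpa [(hd i).ne'] using this }
  exact iSup_eigenspace_eq_top_of_core A c hA

theorem sum_finrank_eigenspace {E : Type*} [AddCommGroup E] [Module ℝ E] [FiniteDimensional ℝ E]
    (A : Module.End ℝ E) (hA : ⨆ z, A.eigenspace z = ⊤) :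
    ∑ z ∈ A.finite_hasEigenvalue.toFinset, Module.finrank ℝ (A.eigenspace z) =
      Module.finrank ℝ E := by
  classical
  set s := A.finite_hasEigenvalue.toFinset with hs
  have hind : iSupIndep fun z : s => A.eigenspace (z : ℝ) :=
    A.eigenspaces_iSupIndep.comp Subtype.val_injective
  have htop : ⨆ z : s, A.eigenspace (z : ℝ) = ⊤ := by
    rw [eq_top_iff, ← hA]
    refine iSup_le fun z => ?_
    by_cases hz : A.HasEigenvalue z
    · exact le_iSup (fun z : s => A.eigenspace (z : ℝ)) ⟨z, by simpa [hs] using hz⟩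
    · have : A.eigenspace z = ⊥ := by
        by_contra h
        exact hz h
      rw [this]; exact bot_le
  have hint := DirectSum.isInternal_submodule_of_iSupIndep_of_iSup_eq_top hind htop
  rw [← (LinearEquiv.ofBijective (DirectSum.coeLinearMap _) hint).finrank_eq, Module.finrank_directSum,
    ← Finset.sum_coe_sort s]

/-- Weighting by degrees removes the factors `1 / d_x`, and what remains is the symmetric adjacency
form. Diagonalizability then makes the geometric multiplicities exhaust the dimension. -/
theorem sum_mult : ∑ z ∈ (laplacian N n).finite_hasEigenvalue.toFinset, mult N n z =
    Fintype.card (V N n) := by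
  classical
  rw [← Module.finrank_fintype_fun_eq_card ℝ (η := V N n)]
  refine sum_finrank_eigenspace _ (iSup_eigenspace_eq_top_of_weighted _
    (fun x => ((graph N n).degree x : ℝ)) (fun x => ?_) fun f g => ?_)
  · rw [degree_eq]
    exact mul_pos two_pos (incSum_one_pos x)
  · have key : ∀ f g : V N n → ℝ, ∑ x, ((graph N n).degree x : ℝ) * (laplacian N n f x * g x) =
        ∑ x, ((graph N n).degree x : ℝ) * (f x * g x) -
          ∑ x, ∑ y, if (graph N n).Adj x y then f y * g x else 0 := by
      intro f g
      rw [← Finset.sum_sub_distrib]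
      refine Finset.sum_congr rfl fun x _ => ?_
      have hd : ((graph N n).degree x : ℝ) ≠ 0 := by
        rw [degree_eq]; exact (mul_pos two_pos (incSum_one_pos x)).ne'
      have h1 : ∑ y, (if (graph N n).Adj x y then f y * g x else 0) =
          (∑ y ∈ (graph N n).neighborFinset x, f y) * g x := by
        rw [← Finset.sum_filter, Finset.sum_mul]
        refine Finset.sum_congr ?_ fun _ _ => rfl
        ext y; simp
      have h2 : laplacian N n f x = f x - 1 / ((graph N n).degree x : ℝ) *
          ∑ y ∈ (graph N n).neighborFinset x, f y := by
        simp only [laplacian]; rfl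
      rw [h1, h2]
      field_simp
    have hcomm : ∀ f g : V N n → ℝ,
        ∑ x, ((graph N n).degree x : ℝ) * (f x * laplacian N n g x) =
          ∑ x, ((graph N n).degree x : ℝ) * (laplacian N n g x * f x) := fun f g =>
      Finset.sum_congr rfl fun x _ => by ring
    rw [hcomm, key, key]
    congr 1
    · exact Finset.sum_congr rfl fun x _ => by ring
    · rw [Finset.sum_comm]
      refine Finset.sum_congr rfl fun x _ => Finset.sum_congr rfl fun y _ => ?_
      simp only [SimpleGraph.adj_comm, mul_comm]

/-- The function on `V_{n+1}` with prescribed values on `V_n`, on the rings and at the free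
vertices. -/
noncomputable def extend (f : V N n → ℝ) (r o : Word N n → Letter N → ℝ) : V N (n + 1) → ℝ :=
  fun x => Sum.elim f (Sum.elim (fun p => r p.1 p.2) (fun p => o p.1 p.2)) ((vertexEquiv N n).symm x)

theorem extend_add (f f' : V N n → ℝ) (r r' o o' : Word N n → Letter N → ℝ) :
    extend (f + f') (r + r') (o + o') = extend f r o + extend f' r' o' := by
  funext x
  simp only [extend, Pi.add_apply]
  rcases (vertexEquiv N n).symm x with _ | _ | _ <;> rfl

theorem extend_smul (c : ℝ) (f : V N n → ℝ) (r o : Word N n → Letter N → ℝ) :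
    extend (c • f) (c • r) (c • o) = c • extend f r o := by
  funext x
  simp only [extend, Pi.smul_apply]
  rcases (vertexEquiv N n).symm x with _ | _ | _ <;> rfl

variable {f : V N n → ℝ} {r o : Word N n → Letter N → ℝ}

theorem extend_vertexMap (f : V N n → ℝ) (r o : Word N n → Letter N → ℝ) (p) :
    extend f r o (vertexMap N n p) =
      Sum.elim f (Sum.elim (fun p => r p.1 p.2) (fun p => o p.1 p.2)) p := by
  rw [extend]
  congr 1
  exact (vertexEquiv N n).symm_apply_apply p

theorem extend_one (f : V N n → ℝ) (r o : Word N n → Letter N → ℝ) (w : Word N n) (i : Letter N) :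
    extend f r o (vtx (w.snoc i) 1) = r w i :=
  extend_vertexMap f r o (Sum.inr (Sum.inl (w, i)))

omit [NeZero N] in
theorem vtx_two (w : Word N n) (i : Letter N) : vtx (w.snoc i) 2 = vtx (w.snoc (i + 1)) 1 :=
  Subtype.ext (pt_snoc_two w i)

theorem extend_two (f : V N n → ℝ) (r o : Word N n → Letter N → ℝ) (w : Word N n) (i : Letter N) :
    extend f r o (vtx (w.snoc i) 2) = r w (i + 1) := by
  rw [vtx_two, extend_one]

theorem extend_bdry (f : V N n → ℝ) (r o : Word N n → Letter N → ℝ) (w : Word N n) (k : Fin 3) :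
    extend f r o (vtx (w.snoc (bdry N k)) 0) = f (vtx w k) := by
  rw [← show vertexMap N n (Sum.inl (vtx w k)) = vtx (w.snoc (bdry N k)) 0 from
    Subtype.ext (pt_snoc_bdry w k).symm, extend_vertexMap]
  rfl

theorem extend_zero (hb : ∀ w k, o w (bdry N k) = f (vtx w k)) (w : Word N n) (i : Letter N) :
    extend f r o (vtx (w.snoc i) 0) = o w i := by
  by_cases hi : i ∈ Set.range (bdry N)
  · obtain ⟨k, rfl⟩ := hi
    rw [extend_bdry, hb]
  · exact extend_vertexMap f r o (Sum.inr (Sum.inr (w, ⟨i, hi⟩)))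

/-- A ring vertex lies in exactly two subcells, `i` and its predecessor, both inside the same cell.
-/
theorem incSum_succ_ring (φ : Word N (n + 1) → Fin 3 → ℝ) (w : Word N n) (i : Letter N) :
    incSum φ (vtx (w.snoc i) 1) = φ (w.snoc i) 1 + φ (w.snoc (i - 1)) 2 := by
  classical
  simp only [incSum, Word.sum_succ, Fin.sum_univ_three, vtx_eq_iff, pt_one_eq_one, pt_two_eq_one,
    pt_zero_ne_one, if_false, zero_add, Finset.sum_add_distrib, ite_and, Finset.sum_ite_irrel,
    Finset.sum_const_zero, Finset.sum_ite_eq', Finset.mem_univ, if_true]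

theorem incSum_succ_inner (φ : Word N (n + 1) → Fin 3 → ℝ) (w : Word N n) {i : Letter N}
    (hi : i ∉ Set.range (bdry N)) : incSum φ (vtx (w.snoc i) 0) = φ (w.snoc i) 0 := by
  classical
  have h2 : ∀ (w' : Word N n) (i' : Letter N), pt (w'.snoc i') 2 ≠ pt (w.snoc i) 0 := by
    intro w' i'
    rw [pt_snoc_two]
    exact pt_zero_ne_one.symm
  simp only [incSum, Word.sum_succ, Fin.sum_univ_three, vtx_eq_iff, pt_zero_eq_zero hi,
    pt_zero_ne_one.symm, h2, if_false, add_zero, ite_and, Finset.sum_ite_irrel,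
    Finset.sum_const_zero, Finset.sum_ite_eq', Finset.mem_univ, if_true]

/-- At an old vertex, each incident cell is replaced by its subcell at the corresponding boundary
letter. The new equation there is thus a balance over the old incidences. -/
theorem incSum_succ_bdry (φ : Word N (n + 1) → Fin 3 → ℝ) (w : Word N n) (k : Fin 3) :
    incSum φ (vtx (w.snoc (bdry N k)) 0) =
      incSum (fun w k => φ (w.snoc (bdry N k)) 0) (vtx w k) := by
  classical
  have h1 : ∀ (w' : Word N n) (i' : Letter N), pt (w'.snoc i') 1 ≠ pt w k := by
    intro w' i' h
    rw [← pt_snoc_bdry w k] at h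
    exact pt_zero_ne_one h.symm
  have h2 : ∀ (w' : Word N n) (i' : Letter N), pt (w'.snoc i') 2 ≠ pt w k := by
    intro w' i'
    rw [pt_snoc_two]
    exact h1 _ _
  have hsum : ∀ (w' : Word N n) (i : Letter N),
      ∑ a, (if pt (w'.snoc i) a = pt w k then φ (w'.snoc i) a else 0) =
        if pt (w'.snoc i) 0 = pt w k then φ (w'.snoc i) 0 else 0 := by
    intro w' i
    simp only [Fin.sum_univ_three, h1, h2, if_false, add_zero]
  simp only [incSum, Word.sum_succ, vtx_eq_iff, pt_snoc_bdry w k, hsum]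
  refine Finset.sum_congr rfl fun w' _ => ?_
  rw [← Finset.sum_subset (Finset.subset_univ (Finset.univ.image (bdry N))),
    Finset.sum_image fun a _ b _ h => bdry_injective h]
  · simp only [pt_snoc_bdry]
  · intro i _ hi
    rw [if_neg]
    intro h
    obtain ⟨k', rfl, -⟩ := pt_zero_eq_pt.1 h
    exact hi (Finset.mem_image_of_mem _ (Finset.mem_univ _))

/-- Sufficient conditions for an extension to be an eigenfunction of level `n + 1`. -/
theorem extend_mem_eigenspace {z : ℝ} (hb : ∀ w k, o w (bdry N k) = f (vtx w k))
    (hring : ∀ w i, o w i + o w (i - 1) + r w (i - 1) + r w (i + 1) = 4 * (1 - z) * r w i)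
    (hout : ∀ w i, i ∉ Set.range (bdry N) → r w i + r w (i + 1) = 2 * (1 - z) * o w i)
    (hflux : ∀ x, incSum (fun w k => r w (bdry N k) + r w (bdry N k + 1) -
      2 * (1 - z) * o w (bdry N k)) x = 0) :
    extend f r o ∈ (laplacian N (n + 1)).eigenspace z := by
  rw [mem_eigenspace_iff]
  intro x
  obtain ⟨W, a, rfl⟩ := exists_vtx x
  obtain ⟨w, i, rfl⟩ := W.exists_snoc
  have ha : a = 0 ∨ a = 1 ∨ a = 2 := by revert a; decide
  have hone : ∀ i : Letter N, incSum (fun w k => ∑ l, extend f r o (vtx w l) -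
      (3 - 2 * z) * extend f r o (vtx w k)) (vtx (w.snoc i) 1) = 0 := by
    intro i
    rw [incSum_succ_ring]
    simp only [Fin.sum_univ_three, extend_zero hb, extend_one, extend_two, sub_add_cancel]
    linarith [hring w i]
  rcases ha with rfl | rfl | rfl
  · by_cases hi : i ∈ Set.range (bdry N)
    · obtain ⟨k, rfl⟩ := hi
      rw [incSum_succ_bdry, ← hflux (vtx w k)]
      refine incSum_congr fun w k _ => ?_
      simp only [Fin.sum_univ_three, extend_zero hb, extend_one, extend_two]
      ring
    · rw [incSum_succ_inner _ _ hi]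
      simp only [Fin.sum_univ_three, extend_zero hb, extend_one, extend_two]
      linarith [hout w i hi]
  · exact hone i
  · rw [vtx_two]; exact hone _

end Gasket

/-! ### Chebyshev values and their addition formulas -/

namespace Gasket

section Chebyshev

open Polynomial Polynomial.Chebyshev

variable {A : Type*} [CommRing A]

/-- The value `T_m(x)`. -/
noncomputable def chebT (x : A) (m : ℤ) : A := (T A m).eval x

/-- The value `U_{m-1}(x)`, that is `sin (m θ) / sin θ` for `x = cos θ`. -/
noncomputable def chebU (x : A) (m : ℤ) : A := (U A (m - 1)).eval x

theorem chebT_zero (x : A) : chebT x 0 = 1 := by simp [chebT]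
theorem chebT_one (x : A) : chebT x 1 = x := by simp [chebT]
theorem chebU_zero (x : A) : chebU x 0 = 0 := by simp [chebU]
theorem chebU_one (x : A) : chebU x 1 = 1 := by simp [chebU]

theorem chebU_neg (x : A) (m : ℤ) : chebU x (-m) = -chebU x m := by
  rw [chebU, chebU, U_neg_sub_one, eval_neg]

theorem chebU_add_one (x : A) (m : ℤ) : chebU x (m + 1) + chebU x (m - 1) = 2 * x * chebU x m := by
  have := congrArg (eval x) (U_add_one A (m - 1))
  simp only [eval_sub, eval_mul, eval_X, eval_ofNat] at this
  simp only [chebU]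
  rw [show m + 1 - 1 = m - 1 + 1 by ring, this]
  ring

theorem chebT_add_one (x : A) (m : ℤ) : chebT x (m + 1) + chebT x (m - 1) = 2 * x * chebT x m := by
  have := congrArg (eval x) (T_add_one A m)
  simp only [eval_sub, eval_mul, eval_X, eval_ofNat] at this
  simp only [chebT]
  rw [this]
  ring

theorem chebU_succ (x : A) (m : ℤ) : chebU x (m + 1) = x * chebU x m + chebT x m := by
  have := congrArg (eval x) (U_eq_X_mul_U_add_T A (m - 1))
  simp only [eval_add, eval_mul, eval_X, sub_add_cancel] at this
  simpa only [chebU, chebT, add_sub_cancel_right] using this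

theorem chebU_pred (x : A) (m : ℤ) : chebU x (m - 1) = x * chebU x m - chebT x m := by
  linear_combination chebU_add_one x m - chebU_succ x m

theorem chebT_succ (x : A) (m : ℤ) : chebT x (m + 1) = x * chebT x m - (1 - x ^ 2) * chebU x m := by
  have := congrArg (eval x) (T_eq_X_mul_T_sub_pol_U A (m - 1))
  simp only [eval_sub, eval_mul, eval_X, sub_add_cancel, eval_one, eval_pow] at this
  rw [chebT, chebT, chebU, ← this]
  congr 2
  ring

theorem cheb_pell (x : A) (m : ℕ) : chebT x m ^ 2 + (1 - x ^ 2) * chebU x m ^ 2 = 1 := by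
  induction m with
  | zero => simp [chebT_zero, chebU_zero]
  | succ m ih =>
    push_cast
    rw [chebT_succ, chebU_succ]
    linear_combination ih

/-- This is `sin(a + b) + sin(a - b) = 2 sin a cos b` divided by `sin θ`. It follows from the two
recurrences, so it holds in any commutative ring. -/
theorem chebU_add_add_sub (x : A) (m k : ℤ) :
    chebU x (m + k) + chebU x (m - k) = 2 * chebT x k * chebU x m := by
  induction k using Polynomial.Chebyshev.induct generalizing m with
  | zero => simp [chebT_zero]; ring
  | one => rw [chebU_add_one, chebT_one]
  | add_two n h1 h2 =>
    have e1 := h1 m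
    have e2 := h2 m
    have a1 := chebU_add_one x (m + (n + 1))
    have a2 := chebU_add_one x (m - (n + 1))
    have a3 := chebT_add_one x (n + 1)
    rw [show m + ((n : ℤ) + 1) + 1 = m + (n + 2) by ring, show m + ((n : ℤ) + 1) - 1 = m + n by ring] at a1
    rw [show m - ((n : ℤ) + 1) + 1 = m - n by ring, show m - ((n : ℤ) + 1) - 1 = m - (n + 2) by ring] at a2
    rw [show (n : ℤ) + 1 + 1 = n + 2 by ring, show (n : ℤ) + 1 - 1 = n by ring] at a3
    linear_combination a1 + a2 - e2 + 2 * x * e1 - 2 * chebU x m * a3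
  | neg_add_one n h1 h2 =>
    have e1 := h1 m
    have e2 := h2 m
    have a1 := chebU_add_one x (m + (-n))
    have a2 := chebU_add_one x (m - (-n))
    have a3 := chebT_add_one x (-n)
    rw [show m + (-(n : ℤ)) + 1 = m + (-n + 1) by ring, show m + (-(n : ℤ)) - 1 = m + (-n - 1) by ring] at a1
    rw [show m - (-(n : ℤ)) + 1 = m - (-n - 1) by ring, show m - (-(n : ℤ)) - 1 = m - (-n + 1) by ring] at a2
    linear_combination a1 + a2 - e2 + 2 * x * e1 - 2 * chebU x m * a3

theorem chebT_two_mul (x : A) (m : ℤ) : chebT x (2 * m) = 2 * chebT x m ^ 2 - 1 := by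
  have := congrArg (eval x) (T_mul_T A m m)
  simp only [eval_add, eval_mul, eval_ofNat, sub_self, T_zero, eval_one] at this
  rw [chebT, two_mul, chebT]
  linear_combination -this

theorem chebT_three_mul (x : A) (m : ℤ) :
    chebT x (3 * m) = 4 * chebT x m ^ 3 - 3 * chebT x m := by
  have := congrArg (eval x) (T_mul_T A (2 * m) m)
  simp only [eval_add, eval_mul, eval_ofNat] at this
  have h2 := chebT_two_mul x m
  simp only [chebT] at *
  rw [show 2 * m + m = 3 * m by ring, show 2 * m - m = m by ring] at this
  linear_combination -this + 2 * eval x (T A m) * h2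

theorem chebU_two_mul (x : A) (m : ℤ) : chebU x (2 * m) = 2 * chebT x m * chebU x m := by
  have := chebU_add_add_sub x m m
  rwa [sub_self, chebU_zero, add_zero, ← two_mul] at this

theorem chebU_three_mul (x : A) (m : ℤ) :
    chebU x (3 * m) = chebU x m * (4 * chebT x m ^ 2 - 1) := by
  have := chebU_add_add_sub x m (2 * m)
  rw [show m + 2 * m = 3 * m by ring, show m - 2 * m = -m by ring, chebU_neg, chebT_two_mul] at this
  linear_combination this

end Chebyshev

/-! ### Solutions of the eigenvalue equation on one cell, and their fluxes -/

section CellSolutions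

variable {N : ℕ} [NeZero N] {z : ℝ}

/-- The solutions of the eigenvalue equation for `z` on one cell, except at its three boundary
vertices: pairs of a function on the ring and a function on the outer vertices. -/
def cellSol (N : ℕ) [NeZero N] (z : ℝ) : Submodule ℝ ((Letter N → ℝ) × (Letter N → ℝ)) where
  carrier := {p | (∀ i, p.2 i + p.2 (i - 1) + p.1 (i - 1) + p.1 (i + 1) = 4 * (1 - z) * p.1 i) ∧
    ∀ i, i ∉ Set.range (bdry N) → p.1 i + p.1 (i + 1) = 2 * (1 - z) * p.2 i}
  add_mem' := by
    rintro p q ⟨h1, h2⟩ ⟨h3, h4⟩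
    refine ⟨fun i => ?_, fun i hi => ?_⟩
    · simp only [Prod.fst_add, Prod.snd_add, Pi.add_apply]; linarith [h1 i, h3 i]
    · simp only [Prod.fst_add, Prod.snd_add, Pi.add_apply]; linarith [h2 i hi, h4 i hi]
  zero_mem' := by simp
  smul_mem' := by
    rintro c p ⟨h1, h2⟩
    refine ⟨fun i => ?_, fun i hi => ?_⟩
    · simp only [Prod.smul_fst, Prod.smul_snd, Pi.smul_apply, smul_eq_mul]
      linear_combination c * h1 i
    · simp only [Prod.smul_fst, Prod.smul_snd, Pi.smul_apply, smul_eq_mul]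
      linear_combination c * h2 i hi

/-- The outward flux of a cell solution. -/
def flux (N : ℕ) (z : ℝ) (i : Letter N) : (Letter N → ℝ) × (Letter N → ℝ) →ₗ[ℝ] ℝ where
  toFun p := p.1 i + p.1 (i + 1) - 2 * (1 - z) * p.2 i
  map_add' p q := by simp only [Prod.fst_add, Prod.snd_add, Pi.add_apply]; ring
  map_smul' c p := by
    simp only [Prod.smul_fst, Prod.smul_snd, Pi.smul_apply, smul_eq_mul, RingHom.id_apply]; ring

theorem flux_apply (N : ℕ) (z : ℝ) (i : Letter N) (p : (Letter N → ℝ) × (Letter N → ℝ)) :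
    flux N z i p = p.1 i + p.1 (i + 1) - 2 * (1 - z) * p.2 i := rfl

/-- The rotated pair. -/
def rot {N : ℕ} (j : Letter N) (p : (Letter N → ℝ) × (Letter N → ℝ)) :
    (Letter N → ℝ) × (Letter N → ℝ) := (fun i => p.1 (i - j), fun i => p.2 (i - j))

omit [NeZero N] in
-- The boundary letters form a subgroup of order three, but index `k` stands for `(k + 1)N`; the `+
-- 2`, that is `- 1` modulo `3`, corrects this shift.
theorem bdry_sub (k l : Fin 3) : bdry N k - bdry N l = bdry N (k - l + 2) := by
  have h : ∀ k l : Fin 3, (k : ℕ) + 1 ≡ ((k - l + 2 : Fin 3) : ℕ) + 1 + (l + 1) [MOD 3] := by decide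
  rw [sub_eq_iff_eq_add, bdry, bdry, bdry, ← Nat.cast_add, ← add_mul, ZMod.natCast_eq_natCast_iff]
  exact (h k l).mul_right' N

omit [NeZero N] in
theorem sub_bdry_mem_range_iff {i : Letter N} (l : Fin 3) :
    i - bdry N l ∈ Set.range (bdry N) ↔ i ∈ Set.range (bdry N) := by
  constructor
  · rintro ⟨k, hk⟩
    have h : k = k + l + 1 - l + 2 := by clear hk; revert k l; decide
    refine ⟨k + l + 1, ?_⟩
    rw [h, ← bdry_sub, sub_left_inj] at hk
    exact hk
  · rintro ⟨k, rfl⟩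
    exact ⟨_, (bdry_sub k l).symm⟩

theorem rot_mem_cellSol {p : (Letter N → ℝ) × (Letter N → ℝ)} (hp : p ∈ cellSol N z) (l : Fin 3) :
    rot (bdry N l) p ∈ cellSol N z := by
  refine ⟨fun i => ?_, fun i hi => ?_⟩
  · have := hp.1 (i - bdry N l)
    rw [sub_right_comm, sub_add_eq_add_sub] at this
    exact this
  · have := hp.2 (i - bdry N l) (mt (sub_bdry_mem_range_iff l).1 hi)
    rw [sub_add_eq_add_sub] at this
    exact this

/-- The representative of a letter in `{1, …, 3N}`. -/
def rep (i : Letter N) : ℤ := if i = 0 then 3 * N else i.val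

omit [NeZero N] in
theorem rep_zero : rep (0 : Letter N) = 3 * N := by simp [rep]

theorem rep_add_one {i : Letter N} (hi : i ≠ 0) : rep (i + 1) = rep i + 1 := by
  have h1 : ((i.val + 1 : ℕ) : Letter N) = i + 1 := by push_cast; rw [ZMod.natCast_zmod_val]
  have hlt := ZMod.val_lt i
  rw [rep, rep, if_neg hi]
  split_ifs with h
  · rw [h, ZMod.natCast_eq_zero_iff] at h1
    have := Nat.le_of_dvd (by omega) h1
    omega
  · have : i.val + 1 ≠ 3 * N := by
      intro h2
      rw [h2, ZMod.natCast_self] at h1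
      exact h h1.symm
    rw [← h1, ZMod.val_cast_of_lt (by omega)]
    push_cast; ring

theorem one_ne_zero_letter : (1 : Letter N) ≠ 0 := by
  intro h
  apply two_ne_zero_letter (N := N)
  rw [← one_add_one_eq_two, h, add_zero]

theorem rep_one : rep (1 : Letter N) = 1 := by
  have : Fact (1 < 3 * N) := ⟨by have := NeZero.pos N; omega⟩
  rw [rep, if_neg one_ne_zero_letter, ZMod.val_one]; rfl

theorem rep_sub_one {i : Letter N} (hi : i ≠ 1) : rep (i - 1) = rep i - 1 := by
  have := rep_add_one (sub_ne_zero.2 hi)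
  rw [sub_add_cancel] at this
  omega

theorem rep_bdry {k : Fin 3} : rep (bdry N k) = (k + 1) * N := by
  have hN := NeZero.pos N
  by_cases hk : k = 2
  · subst hk
    rw [bdry_two, ZMod.natCast_self, rep_zero]; norm_num
  · have h2 : (k : ℕ) + 1 < 3 := by revert k; decide
    have h3 : ((k : ℕ) + 1) * N < 3 * N := by nlinarith
    have h4 : (bdry N k).val = ((k : ℕ) + 1) * N := by
      rw [bdry, ZMod.val_cast_of_lt h3]
    have h5 : bdry N k ≠ 0 := by
      intro h
      rw [h, ZMod.val_zero] at h4
      have : 0 < ((k : ℕ) + 1) * N := by positivity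
      omega
    rw [rep, if_neg h5, h4]
    push_cast; rfl

/-- The cell function built from a sequence `γ` on the line, cut open at the vertex `3N`, where it
takes the value `b`. -/
def ofSeq (N : ℕ) (γ : ℤ → ℝ) (b : ℝ) : (Letter N → ℝ) × (Letter N → ℝ) :=
  (fun i => γ (rep i) + γ (rep i - 1), fun i => if i = 0 then b else 2 * γ (rep i))

/-- Since `x + 1 = 2(1 - z)`, taking `2γ(m)` at outer vertices and `γ(m) + γ(m-1)` on the ring turns
every equation away from the cut into the recurrence for `γ`. The conditions `h0` and `h1` are the
equations at the two ring vertices of the subcell `3N`, where the ring is cut: letters `1` and `0`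
respectively. -/
theorem ofSeq_mem_cellSol {γ : ℤ → ℝ} {b x : ℝ} (hx : x = 1 - 2 * z)
    (hγ : ∀ m, γ (m + 1) + γ (m - 1) = 2 * x * γ m)
    (h0 : b = 3 * γ 0 + γ (-1) - γ (3 * N) - γ (3 * N - 1))
    (h1 : b = 3 * γ (3 * N) + γ (3 * N + 1) - γ 1 - γ 0) : ofSeq N γ b ∈ cellSol N z := by
  refine ⟨fun i => ?_, fun i hi => ?_⟩
  · simp only [ofSeq, sub_eq_zero]
    have e1 := hγ (rep i)
    have e2 := hγ (rep i - 1)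
    rw [sub_add_cancel, sub_sub] at e2
    by_cases hi0 : i = 0
    · subst hi0
      rw [if_pos rfl, if_neg one_ne_zero_letter.symm, zero_add, rep_one,
        rep_sub_one one_ne_zero_letter.symm, rep_zero, sub_self, sub_sub]
      rw [rep_zero] at e1 e2
      norm_num at e1 e2 ⊢
      subst hx
      linear_combination e1 + e2 + h1
    · by_cases hi1 : i = 1
      · subst hi1
        rw [if_neg hi0, if_pos rfl, sub_self, rep_zero, rep_add_one hi0, rep_one]
        rw [rep_one] at e1 e2
        norm_num at e1 e2 ⊢
        subst hx
        linear_combination e1 + e2 + h0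
      · rw [if_neg hi0, if_neg hi1, rep_add_one hi0, rep_sub_one hi1, sub_sub,
          add_sub_cancel_right]
        subst hx
        norm_num at e2 ⊢
        linear_combination e1 + e2
  · have hi0 : i ≠ 0 := by
      rintro rfl
      exact hi ⟨2, by rw [bdry_two, ZMod.natCast_self]⟩
    have e1 := hγ (rep i)
    simp only [ofSeq, if_neg hi0, rep_add_one hi0, add_sub_cancel_right]
    subst hx
    linear_combination e1

/-- The recurrence gives the outer-vertex equation even at the boundary letters `N` and `2N`, so the
cut is the only possible source. -/
theorem flux_ofSeq_of_ne {γ : ℤ → ℝ} {b x : ℝ} (hx : x = 1 - 2 * z)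
    (hγ : ∀ m, γ (m + 1) + γ (m - 1) = 2 * x * γ m) {i : Letter N} (hi : i ≠ 0) :
    flux N z i (ofSeq N γ b) = 0 := by
  have e1 := hγ (rep i)
  simp only [flux_apply, ofSeq, if_neg hi, rep_add_one hi, add_sub_cancel_right]
  subst hx
  linear_combination e1

theorem flux_ofSeq_zero {γ : ℤ → ℝ} {b : ℝ} : flux N z 0 (ofSeq N γ b) =
    γ (3 * N) + γ (3 * N - 1) + γ 1 + γ 0 - 2 * (1 - z) * b := by
  simp only [flux_apply, ofSeq, zero_add, rep_zero, rep_one, if_true, sub_self]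
  ring

theorem bdry_eq_zero_iff {k : Fin 3} : bdry N k = 0 ↔ k = 2 := by
  have h2 : bdry N 2 = 0 := by rw [bdry_two, ZMod.natCast_self]
  constructor
  · intro h
    exact bdry_injective (h.trans h2.symm)
  · rintro rfl; exact h2

theorem snd_ofSeq_bdry {γ : ℤ → ℝ} {b : ℝ} {k : Fin 3} :
    (ofSeq N γ b).2 (bdry N k) = if k = 2 then b else 2 * γ ((k + 1) * N) := by
  simp only [ofSeq, bdry_eq_zero_iff, rep_bdry]

/-- The superposition of the three rotations of a cell function. -/
def superpose (p : (Letter N → ℝ) × (Letter N → ℝ)) :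
    (Fin 3 → ℝ) →ₗ[ℝ] (Letter N → ℝ) × (Letter N → ℝ) :=
  Fintype.linearCombination ℝ fun l => rot (bdry N l) p

omit [NeZero N] in
theorem superpose_apply (p : (Letter N → ℝ) × (Letter N → ℝ)) (s : Fin 3 → ℝ) :
    superpose p s = ∑ l, s l • rot (bdry N l) p := Fintype.linearCombination_apply _ _ _

theorem superpose_mem_cellSol {p : (Letter N → ℝ) × (Letter N → ℝ)} (hp : p ∈ cellSol N z)
    (s : Fin 3 → ℝ) : superpose p s ∈ cellSol N z := by
  rw [superpose_apply]
  exact Submodule.sum_mem _ fun l _ => Submodule.smul_mem _ _ (rot_mem_cellSol hp l)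

omit [NeZero N] in
-- Corner values depend on the coefficients through a circulant matrix, because the corners are
-- permuted cyclically by the rotations.
theorem snd_superpose (p : (Letter N → ℝ) × (Letter N → ℝ)) (s : Fin 3 → ℝ) (k : Fin 3) :
    (superpose p s).2 (bdry N k) = ∑ l, s l * p.2 (bdry N (k - l + 2)) := by
  rw [superpose_apply, Prod.snd_sum, Finset.sum_apply]
  simp only [Prod.smul_snd, Pi.smul_apply, smul_eq_mul, rot, bdry_sub]

omit [NeZero N] in
theorem flux_superpose (p : (Letter N → ℝ) × (Letter N → ℝ)) (s : Fin 3 → ℝ) (k : Fin 3) :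
    flux N z (bdry N k) (superpose p s) = ∑ l, s l * flux N z (bdry N (k - l + 2)) p := by
  rw [superpose_apply, map_sum]
  refine Finset.sum_congr rfl fun l _ => ?_
  rw [map_smul, smul_eq_mul, ← bdry_sub]
  congr 1
  simp only [flux_apply, rot, sub_add_eq_add_sub]

variable {n : ℕ}

/-- A space of compatible cell solutions, with balanced fluxes at the vertices of `V_n`, bounds the
multiplicity from below. -/
theorem finrank_le_mult {X : Type*} [AddCommGroup X] [Module ℝ X] (Φ : X →ₗ[ℝ] (V N n → ℝ))
    (Ψ : Word N n → X →ₗ[ℝ] (Letter N → ℝ) × (Letter N → ℝ))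
    (hsol : ∀ w a, Ψ w a ∈ cellSol N z)
    (hb : ∀ w a k, (Ψ w a).2 (bdry N k) = Φ a (vtx w k))
    (hflux : ∀ a x, incSum (fun w k => flux N z (bdry N k) (Ψ w a)) x = 0)
    (hinj : ∀ a, Φ a = 0 → (∀ w, (Ψ w a).1 = 0) → a = 0) :
    Module.finrank ℝ X ≤ mult N (n + 1) z := by
  let G : X →ₗ[ℝ] (V N (n + 1) → ℝ) :=
    { toFun := fun a => extend (Φ a) (fun w => (Ψ w a).1) (fun w => (Ψ w a).2)
      map_add' := fun a b => by
        rw [← extend_add]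
        congr 1
        · exact map_add _ _ _
        · funext w; simp
        · funext w; simp
      map_smul' := fun c a => by
        rw [RingHom.id_apply, ← extend_smul]
        congr 1
        · exact map_smul _ _ _
        · funext w; simp
        · funext w; simp }
  have hG : ∀ a, G a ∈ (laplacian N (n + 1)).eigenspace z := fun a =>
    extend_mem_eigenspace (fun w k => hb w a k) (fun w i => (hsol w a).1 i)
      (fun w i hi => (hsol w a).2 i hi) (hflux a)
  refine LinearMap.finrank_le_finrank_of_injective (f := LinearMap.codRestrict _ G hG) ?_
  rw [← LinearMap.ker_eq_bot, LinearMap.ker_codRestrict, LinearMap.ker_eq_bot']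
  intro a ha
  refine hinj a (funext fun x => ?_) fun w => funext fun i => ?_
  · obtain ⟨w, k, rfl⟩ := exists_vtx x
    have := congrFun ha (vtx (w.snoc (bdry N k)) 0)
    simpa only [G, LinearMap.coe_mk, AddHom.coe_mk, extend_bdry, Pi.zero_apply] using this
  · have := congrFun ha (vtx (w.snoc i) 1)
    simpa only [G, LinearMap.coe_mk, AddHom.coe_mk, extend_one, Pi.zero_apply] using this

end CellSolutions

end Gasket

/-! ### Lower bounds for multiplicities: decimation and exceptional eigenfunctions -/

namespace Gasket

variable {N : ℕ} [NeZero N] {n : ℕ} {x z : ℝ}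

/-- The cell solution with a unit source at one boundary vertex (up to normalization). -/
noncomputable def green (N : ℕ) (x : ℝ) : (Letter N → ℝ) × (Letter N → ℝ) :=
  ofSeq N (fun m => chebU x m - chebU x (m - 3 * N))
    (2 * chebU x (3 * N) - 2 * (1 - chebT x (3 * N)))

theorem green_rec (N : ℕ) (x : ℝ) (m : ℤ) :
    (chebU x (m + 1) - chebU x (m + 1 - 3 * N)) + (chebU x (m - 1) - chebU x (m - 1 - 3 * N)) =
      2 * x * (chebU x m - chebU x (m - 3 * N)) := by
  have e1 := chebU_add_one x m
  have e2 := chebU_add_one x (m - 3 * N)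
  rw [sub_add_eq_add_sub, sub_right_comm] at e2
  linear_combination e1 - e2

/-- The sequence `U_m - U_{m-3N}`, with `U_m` standing for `chebU x m`, is even about `3N/2`. This
makes the two closing conditions at the cut give the same value `b`. -/
theorem green_mem_cellSol (hx : x = 1 - 2 * z) : green N x ∈ cellSol N z := by
  have e1 := chebU_succ x (3 * N)
  have e2 := chebU_pred x (3 * N)
  have e3 := chebU_neg x (3 * N)
  have e4 := chebU_neg x (3 * N + 1)
  have e5 := chebU_neg x (3 * N - 1)
  have e6 := chebU_neg x 1
  have e7 := chebU_zero x
  have e8 := chebU_one x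
  refine ofSeq_mem_cellSol hx (green_rec N x) ?_ ?_
  · simp only [sub_self, zero_sub, sub_sub_cancel_left]
    rw [show (-1 - 3 * N : ℤ) = -(3 * N + 1) by ring]
    linear_combination (-1 : ℝ) * e1 + e2 + 3 * e3 + e4 - 2 * e6 - 4 * e7 + 2 * e8
  · simp only [sub_self, zero_sub, add_sub_cancel_left]
    rw [show (1 - 3 * N : ℤ) = -(3 * N - 1) by ring]
    linear_combination -e1 + e2 + 4 * e7 - e3 - e5 + 2 * e8


/-- The boundary value of `green` at its source. -/
noncomputable def greenDiag (N : ℕ) (x : ℝ) : ℝ :=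
  2 * (1 + 2 * chebT x N) *
    (chebU x N * (2 * chebT x N - 1) - (1 - chebT x N) * (1 + 2 * chebT x N))

/-- The boundary value of `green` away from its source. -/
noncomputable def greenOff (N : ℕ) (x : ℝ) : ℝ := 2 * chebU x N * (1 + 2 * chebT x N)

/-- The flux of `green` at its source. -/
noncomputable def greenFlux (N : ℕ) (x z : ℝ) : ℝ :=
  2 * (3 - 2 * z) * (1 - chebT x N) * (1 + 2 * chebT x N) ^ 2

theorem snd_green (k : Fin 3) :
    (green N x).2 (bdry N k) = if k = 2 then greenDiag N x else greenOff N x := by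
  have e1 := chebU_two_mul x N
  have e2 := chebU_neg x N
  have e3 := chebU_neg x (2 * N)
  have hk : k = 0 ∨ k = 1 ∨ k = 2 := by revert k; decide
  rw [green, snd_ofSeq_bdry]
  rcases hk with rfl | rfl | rfl
  · rw [if_neg (by decide), if_neg (by decide), greenOff]
    norm_num
    rw [show (N - 3 * N : ℤ) = -(2 * N) by ring]
    linear_combination 2 * e1 - 2 * e3
  · rw [if_neg (by decide), if_neg (by decide), greenOff]
    norm_num
    rw [show (2 * N - 3 * N : ℤ) = -N by ring]
    linear_combination 2 * e1 - 2 * e2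
  · rw [if_pos rfl, if_pos rfl, chebU_three_mul, chebT_three_mul, greenDiag]
    ring

theorem flux_green (hx : x = 1 - 2 * z) (k : Fin 3) :
    flux N z (bdry N k) (green N x) = if k = 2 then greenFlux N x z else 0 := by
  split_ifs with hk
  · have e1 := chebU_pred x (3 * N)
    have e2 := chebU_neg x (3 * N)
    have e3 := chebU_neg x (3 * N - 1)
    have e6 := chebU_neg x 1
    have e7 := chebU_zero x
    have e8 := chebU_one x
    have e9 := chebU_three_mul x N
    have e10 := chebT_three_mul x N
    rw [bdry_eq_zero_iff.2 hk, green, flux_ofSeq_zero, greenFlux]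
    simp only [sub_self, zero_sub, sub_sub_cancel_left]
    rw [show (1 - 3 * N : ℤ) = -(3 * N - 1) by ring, e2, e3, e6, e7, e8, e1, e10]
    subst hx
    ring
  · exact flux_ofSeq_of_ne hx (green_rec N x) (mt bdry_eq_zero_iff.1 hk)

theorem sum_rotated (s : Fin 3 → ℝ) (k : Fin 3) (a b : ℝ) :
    ∑ l, s l * (if k - l + 2 = 2 then a else b) = (a - b) * s k + b * ∑ l, s l := by
  have : ∀ l, s l * (if k - l + 2 = 2 then a else b) = (if l = k then (a - b) * s k else 0) + b * s l := by
    intro l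
    have h : k - l + 2 = 2 ↔ l = k := by revert k l; decide
    simp only [h]
    split_ifs with h
    · rw [h]; ring
    · ring
  simp only [this, Finset.sum_add_distrib, Finset.sum_ite_eq', Finset.mem_univ, if_true,
    Finset.mul_sum]

/-- The response of the corner values to the sources is a multiple of the identity plus a multiple
of the all-ones matrix. The fluxes are simply proportional to the sources. -/
theorem snd_superpose_green (s : Fin 3 → ℝ) (k : Fin 3) :
    (superpose (green N x) s).2 (bdry N k) =
      (greenDiag N x - greenOff N x) * s k + greenOff N x * ∑ l, s l := by
  simp only [snd_superpose, snd_green, sum_rotated]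

theorem flux_superpose_green (hx : x = 1 - 2 * z) (s : Fin 3 → ℝ) (k : Fin 3) :
    flux N z (bdry N k) (superpose (green N x) s) = greenFlux N x z * s k := by
  simp only [flux_superpose, flux_green hx, sum_rotated]
  ring

/-- Spectral decimation: eigenfunctions of level `n` for `y = R(z)` extend to level `n + 1`. -/
theorem mult_le_mult_succ {y : ℝ} (hx : x = 1 - 2 * z) (hy : y ≠ 0) (hy' : y ≠ 3 / 2)
    (hU : chebU x N ≠ 0) (hT : 1 + 2 * chebT x N ≠ 0)
    (hR : 2 * y * chebU x N = (1 - chebT x N) * (1 + 2 * chebT x N + 2 * chebU x N)) :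
    mult N n y ≤ mult N (n + 1) z := by
  have hoff : greenOff N x ≠ 0 := mul_ne_zero (mul_ne_zero two_ne_zero hU) hT
  have hdiag : greenDiag N x - greenOff N x = -(2 * y * greenOff N x) := by
    rw [greenDiag, greenOff]
    linear_combination 2 * (1 + 2 * chebT x N) * hR
  have hy2 : 3 - 2 * y ≠ 0 := fun h => hy' (by linarith)
  -- The sources are chosen proportional to the terms of the level-`n` eigenvalue equation, so flux
  -- balance is that equation. Their sum is `2yc ∑ f`; combined with `hdiag`, the corner value
  -- becomes `2y(3 - 2y) greenOff · c · f`, which dictates `c`.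
  set c : ℝ := (2 * y * (3 - 2 * y) * greenOff N x)⁻¹ with hc
  have hc' : c * (2 * y * (3 - 2 * y) * greenOff N x) = 1 :=
    inv_mul_cancel₀ (mul_ne_zero (mul_ne_zero (mul_ne_zero two_ne_zero hy) hy2) hoff)
  let S : Word N n → (laplacian N n).eigenspace y →ₗ[ℝ] (Fin 3 → ℝ) := fun w =>
    { toFun := fun f k => c * (∑ l, f.1 (vtx w l) - (3 - 2 * y) * f.1 (vtx w k))
      map_add' := fun f g => by
        funext k
        simp only [Submodule.coe_add, Pi.add_apply, Finset.sum_add_distrib]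
        ring
      map_smul' := fun a f => by
        funext k
        simp only [Submodule.coe_smul, Pi.smul_apply, smul_eq_mul, ← Finset.mul_sum,
          RingHom.id_apply]
        ring }
  refine finrank_le_mult (Submodule.subtype _) (fun w => superpose (green N x) ∘ₗ S w)
    (fun w f => superpose_mem_cellSol (green_mem_cellSol hx) _) (fun w f k => ?_)
    (fun f v => ?_) fun f hf _ => ?_
  · rw [LinearMap.comp_apply, snd_superpose_green, hdiag]
    simp only [S, LinearMap.coe_mk, AddHom.coe_mk, Submodule.subtype_apply, ← Finset.mul_sum,
      Finset.sum_sub_distrib, Finset.sum_const, Finset.card_univ, Fintype.card_fin, nsmul_eq_mul]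
    push_cast
    linear_combination f.1 (vtx w k) * hc'
  · have := (mem_eigenspace_iff.1 f.2) v
    simp only [LinearMap.comp_apply, flux_superpose_green hx, incSum_smul]
    simp only [S, LinearMap.coe_mk, AddHom.coe_mk, incSum_smul, this, mul_zero]
  · exact Subtype.ext hf

/-- The functions whose sum over each cell vanishes. -/
def cellSum (N n : ℕ) [NeZero N] : (V N n → ℝ) →ₗ[ℝ] (Word N n → ℝ) where
  toFun f w := ∑ k, f (vtx w k)
  map_add' f g := by funext w; simp only [Pi.add_apply, Finset.sum_add_distrib]
  map_smul' c f := by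
    funext w; simp only [Pi.smul_apply, smul_eq_mul, RingHom.id_apply, Finset.mul_sum]

/-- Rank-nullity with one linear condition per cell. -/
theorem card_V_le_finrank_ker_cellSum :
    Fintype.card (V N n) ≤ Module.finrank ℝ (LinearMap.ker (cellSum N n)) + (3 * N) ^ n := by
  have h1 := (cellSum N n).finrank_range_add_finrank_ker
  have h2 := (LinearMap.range (cellSum N n)).finrank_le
  rw [Module.finrank_fintype_fun_eq_card] at h1 h2
  rw [Word.card] at h2
  omega

/-- At `z = 3/2` the factor `3 - 2z` vanishes, and only the cell sums remain in the eigenvalue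
equation. -/
theorem card_V_le_mult_three_halves :
    Fintype.card (V N n) ≤ mult N n (3 / 2) + (3 * N) ^ n := by
  refine card_V_le_finrank_ker_cellSum.trans (Nat.add_le_add_right ?_ _)
  refine Submodule.finrank_mono fun f hf => mem_eigenspace_iff.2 fun v => ?_
  have : ∀ w, ∑ k, f (vtx w k) = 0 := fun w => congrFun hf w
  have h0 : (3 - 2 * (3 / 2) : ℝ) = 0 := by norm_num
  simp [this, incSum, h0]

/-- The periodic cell solution. -/
noncomputable def periodic (N : ℕ) (x : ℝ) : (Letter N → ℝ) × (Letter N → ℝ) :=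
  ofSeq N (chebU x) 0

/-- The hypotheses say that the sine sequence closes up with period `3N`, so the cut is invisible;
for the same reason no corner carries flux (`flux_periodic`). -/
theorem periodic_mem_cellSol (hx : x = 1 - 2 * z) (hT : chebT x (3 * N) = 1)
    (hU : chebU x (3 * N) = 0) : periodic N x ∈ cellSol N z := by
  have e1 := chebU_succ x (3 * N)
  have e2 := chebU_pred x (3 * N)
  have e6 := chebU_neg x 1
  have e7 := chebU_zero x
  have e8 := chebU_one x
  refine ofSeq_mem_cellSol hx (chebU_add_one x) ?_ ?_
  · rw [e6, e7, e8, e2, hU, hT]; ring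
  · rw [e7, e8, e1, hU, hT]; ring

theorem flux_periodic (hx : x = 1 - 2 * z) (hT : chebT x (3 * N) = 1)
    (hU : chebU x (3 * N) = 0) (k : Fin 3) : flux N z (bdry N k) (periodic N x) = 0 := by
  by_cases hk : k = 2
  · rw [bdry_eq_zero_iff.2 hk, periodic, flux_ofSeq_zero, chebU_pred, chebU_zero, chebU_one, hU, hT]
    ring
  · exact flux_ofSeq_of_ne hx (chebU_add_one x) (mt bdry_eq_zero_iff.1 hk)

theorem snd_periodic (k : Fin 3) : (periodic N x).2 (bdry N k) =
    if k = 2 then 0 else if k = 0 then 2 * chebU x N else 4 * chebT x N * chebU x N := by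
  have hk : k = 0 ∨ k = 1 ∨ k = 2 := by revert k; decide
  rw [periodic, snd_ofSeq_bdry]
  rcases hk with rfl | rfl | rfl
  · norm_num
  · have e1 := chebU_two_mul x N
    rw [if_neg (by decide), if_neg (by decide), if_neg (by decide)]
    norm_num
    rw [e1]
    ring
  · simp

/-- Here `cos Nθ = -1/2`, so the sine sequence is `3N`-periodic but does not vanish at `N`. Its
rotations realize every triple of corner values of sum zero without flux, hence each function in the
kernel of `cellSum` extends. -/
theorem card_V_le_mult_succ_of_chebT (hx : x = 1 - 2 * z) (hT : 1 + 2 * chebT x N = 0) :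
    Fintype.card (V N n) ≤ mult N (n + 1) z + (3 * N) ^ n := by
  refine card_V_le_finrank_ker_cellSum.trans (Nat.add_le_add_right ?_ _)
  have hT' : chebT x N = -1 / 2 := by linarith
  have hU : chebU x N ≠ 0 := by
    intro h
    have := cheb_pell x N
    rw [h, hT'] at this
    norm_num at this
  have hT3 : chebT x (3 * N) = 1 := by rw [chebT_three_mul, hT']; norm_num
  have hU3 : chebU x (3 * N) = 0 := by rw [chebU_three_mul, hT']; norm_num
  -- With coefficients `s`, the corner value at `k` is `2 chebU x N · (s (k-1) - s (k+1))`. For this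
  -- choice it equals `(2f_k - f_{k+1} - f_{k+2})/3`, which is `f_k` when the sum is zero.
  let S : Word N n → LinearMap.ker (cellSum N n) →ₗ[ℝ] (Fin 3 → ℝ) := fun w =>
    { toFun := fun f k => (6 * chebU x N)⁻¹ * (f.1 (vtx w (k + 1)) - f.1 (vtx w (k + 2)))
      map_add' := fun f g => by
        funext k
        simp only [Submodule.coe_add, Pi.add_apply]
        ring
      map_smul' := fun a f => by
        funext k
        simp only [Submodule.coe_smul, Pi.smul_apply, smul_eq_mul, RingHom.id_apply]
        ring }
  refine finrank_le_mult (Submodule.subtype _) (fun w => superpose (periodic N x) ∘ₗ S w)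
    (fun w f => superpose_mem_cellSol (periodic_mem_cellSol hx hT3 hU3) _) (fun w f k => ?_)
    (fun f v => ?_) fun f hf _ => ?_
  · have hsum : f.1 (vtx w 0) + f.1 (vtx w 1) + f.1 (vtx w 2) = 0 := by
      rw [← Fin.sum_univ_three (fun k => f.1 (vtx w k))]
      exact congrFun f.2 w
    rw [LinearMap.comp_apply, snd_superpose]
    simp only [snd_periodic, S, LinearMap.coe_mk, AddHom.coe_mk, Fin.sum_univ_three, hT',
      Submodule.subtype_apply]
    have hk : k = 0 ∨ k = 1 ∨ k = 2 := by revert k; decide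
    have h01 : (0 - 1 + 2 : Fin 3) = 1 := by decide
    have h12 : (1 - 2 + 2 : Fin 3) = 1 := by decide
    have h20 : (2 - 0 + 2 : Fin 3) = 1 := by decide
    rcases hk with rfl | rfl | rfl <;> simp only [h01, h12, h20] <;> simp <;> field_simp <;>
      linarith
  · simp [LinearMap.comp_apply, flux_superpose, flux_periodic hx hT3 hU3, incSum]
  · exact Subtype.ext hf

/-- The periodic solution vanishes at all three corners and has no flux there, so it can be
supported in a single cell, independently for each word. -/
theorem card_word_le_mult_succ (hx : x = 1 - 2 * z) (hT : chebT x N = 1) (hU : chebU x N = 0) :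
    (3 * N) ^ n ≤ mult N (n + 1) z := by
  have hT3 : chebT x (3 * N) = 1 := by rw [chebT_three_mul, hT]; norm_num
  have hU3 : chebU x (3 * N) = 0 := by rw [chebU_three_mul, hU]; norm_num
  rw [← Word.card, ← Module.finrank_fintype_fun_eq_card ℝ (η := Word N n)]
  refine finrank_le_mult (0 : (Word N n → ℝ) →ₗ[ℝ] (V N n → ℝ))
    (fun w => (LinearMap.proj w : (Word N n → ℝ) →ₗ[ℝ] ℝ).smulRight (periodic N x))
    (fun w f => Submodule.smul_mem _ _ (periodic_mem_cellSol hx hT3 hU3)) (fun w f k => ?_)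
    (fun f v => ?_) fun f _ hf => ?_
  · simp [snd_periodic, hU]
  · simp [flux_periodic hx hT3 hU3, incSum]
  · funext w
    -- The coefficient is read off at the ring vertex of the letter `1`, where the periodic solution
    -- takes the value `1`.
    have h1 := congrFun (hf w) 1
    simpa [periodic, ofSeq, rep_one, chebU_one, chebU_zero] using h1

/-- At a zero of `C` the response matrix is a multiple of the all-ones matrix. Sources of sum zero
in each cell then give zero corner values, and only flux balance at each vertex remains to be
imposed. -/
theorem two_mul_card_word_le_mult_succ (hx : x = 1 - 2 * z) (hz : z ≠ 3 / 2) (hT : chebT x N ≠ 1)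
    (hC : 1 + 2 * chebT x N + 2 * chebU x N = 0) :
    2 * (3 * N) ^ n ≤ mult N (n + 1) z + Fintype.card (V N n) := by
  have hT2 : 1 + 2 * chebT x N ≠ 0 := by
    intro h
    have hU : chebU x N = 0 := by linarith
    have := cheb_pell x N
    have hT' : chebT x N = -1 / 2 := by linarith
    rw [hU, hT'] at this
    norm_num at this
  have hflux : greenFlux N x z ≠ 0 :=
    mul_ne_zero (mul_ne_zero (mul_ne_zero two_ne_zero (fun h => hz (by linarith)))
      (sub_ne_zero.2 hT.symm)) (pow_ne_zero _ hT2)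
  have hdiag : greenDiag N x - greenOff N x = 0 := by
    rw [greenDiag, greenOff]
    linear_combination -2 * (1 + 2 * chebT x N) * (1 - chebT x N) * hC
  -- There are `3(3N)^n` sources, subject to `(3N)^n` sum conditions and one balance condition per
  -- vertex; the kernel has at least the claimed dimension.
  let D : (Word N n → Fin 3 → ℝ) →ₗ[ℝ] (Word N n → ℝ) × (V N n → ℝ) :=
    { toFun := fun s => (fun w => ∑ k, s w k, fun v => incSum s v)
      map_add' := fun s t => by
        ext
        · simp [Finset.sum_add_distrib]
        · exact incSum_add _ _ _
      map_smul' := fun c s => by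
        ext
        · simp [Finset.mul_sum]
        · exact incSum_smul _ _ _ }
  have h1 := D.finrank_range_add_finrank_ker
  have h2 := (LinearMap.range D).finrank_le
  have h3 : Module.finrank ℝ (Word N n → Fin 3 → ℝ) = (3 * N) ^ n * 3 := by
    rw [Module.finrank_pi_fintype]
    simp [Word.card]
  rw [Module.finrank_prod, Module.finrank_fintype_fun_eq_card, Module.finrank_fintype_fun_eq_card,
    Word.card] at h2
  have h4 : Module.finrank ℝ (LinearMap.ker D) ≤ mult N (n + 1) z := by
    refine finrank_le_mult (0 : LinearMap.ker D →ₗ[ℝ] (V N n → ℝ))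
      (fun w => superpose (green N x) ∘ₗ LinearMap.proj w ∘ₗ Submodule.subtype _)
      (fun w s => superpose_mem_cellSol (green_mem_cellSol hx) _) (fun w s k => ?_)
      (fun s v => ?_) fun s _ hs => ?_
    · have : ∑ k, s.1 w k = 0 := congrFun (congrArg Prod.fst s.2) w
      simp [snd_superpose_green, hdiag, this]
    · have : incSum s.1 v = 0 := congrFun (congrArg Prod.snd s.2) v
      simp only [LinearMap.comp_apply, flux_superpose_green hx, incSum_smul, LinearMap.proj_apply,
        Submodule.subtype_apply]
      exact mul_eq_zero_of_right _ this
    · refine Subtype.ext (funext fun w => funext fun k => ?_)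
      have h5 : ∑ k, s.1 w k = 0 := congrFun (congrArg Prod.fst s.2) w
      have h6 := flux_superpose_green (N := N) hx (s.1 w) k
      have h7 := snd_superpose_green (N := N) (x := x) (s.1 w) k
      have h8 : (superpose (green N x) (s.1 w)).1 = 0 := hs w
      rw [flux_apply, h7, h8, hdiag, h5] at h6
      simpa [hflux] using h6
  omega

end Gasket

/-! ### The decimation function in Chebyshev form, and the polynomials for its fibres -/

namespace Gasket

open Polynomial Polynomial.Chebyshev

section Algebra

variable {A : Type*} [CommRing A]

theorem cheb_neg_arg (x : A) (m : ℕ) :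
    chebT (-x) m = (-1) ^ m * chebT x m ∧ chebU (-x) m = -(-1) ^ m * chebU x m := by
  induction m with
  | zero => simp [chebT_zero, chebU_zero]
  | succ m ih =>
    obtain ⟨h1, h2⟩ := ih
    push_cast
    rw [chebT_succ, chebT_succ, chebU_succ, chebU_succ, h1, h2]
    constructor <;> ring

theorem chebU_mul_two (s : A) (m : ℕ) :
    chebU s (2 * m) = 2 * s * chebU (2 * s ^ 2 - 1) m := by
  suffices h : chebU s (2 * m) = 2 * s * chebU (2 * s ^ 2 - 1) m ∧
      chebU s (2 * (m + 1)) = 2 * s * chebU (2 * s ^ 2 - 1) (m + 1) from h.1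
  induction m with
  | zero =>
    have := chebU_two_mul s 1
    simp only [Nat.cast_zero, mul_zero, zero_add, chebU_zero, chebU_one]
    rw [this, chebU_one, chebT_one]
    simp
  | succ m ih =>
    obtain ⟨h1, h2⟩ := ih
    push_cast
    refine ⟨h2, ?_⟩
    have e1 := chebU_add_add_sub s (2 * (m + 1)) 2
    have e2 := chebU_add_one (2 * s ^ 2 - 1) (m + 1)
    have e3 : chebT s 2 = 2 * s ^ 2 - 1 := by
      have := chebT_two_mul s 1
      rwa [mul_one, chebT_one] at this
    rw [show (2 * ((m : ℤ) + 1) + 2) = 2 * (m + 1 + 1) by ring,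
      show (2 * ((m : ℤ) + 1) - 2) = 2 * m by ring, e3, h1, h2] at e1
    rw [add_sub_cancel_right] at e2
    linear_combination e1 - 2 * s * e2

theorem chebT_mul_two (s : A) (m : ℕ) : chebT s (2 * m) = chebT (2 * s ^ 2 - 1) m := by
  rw [chebT, mul_comm, T_mul, eval_comp, T_two]
  simp [chebT]

/-- The two factors are the sum and the difference of consecutive `chebU` values, that is
`sin((k+½)θ)/sin(θ/2)` and `cos((k+½)θ)/cos(θ/2)`. -/
theorem chebU_odd (x : A) (k : ℕ) : chebU x (2 * k + 1) =
    ((1 + x) * chebU x k + chebT x k) * ((x - 1) * chebU x k + chebT x k) := by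
  rw [chebU_succ, chebU_two_mul, chebT_two_mul]
  linear_combination cheb_pell x k

theorem chebT_odd (x : A) (k : ℕ) : chebT x (2 * k + 1) =
    1 - (1 - x) * ((1 + x) * chebU x k + chebT x k) ^ 2 := by
  rw [chebT_succ, chebU_two_mul, chebT_two_mul]
  linear_combination (1 + x) * cheb_pell x k

end Algebra

theorem chebFactor_eq (N : ℕ) (w : ℂ) :
    chebFactor N w = 1 + 2 * chebT (1 - 2 * w) N + 2 * chebU (1 - 2 * w) N := by
  rw [chebFactor, chebT, chebU]; ring

/-- With `√w = sin φ`, the argument `1 - 2w` is `cos 2φ`, and half-angle formulas merge the two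
parities into one expression, the one produced by decimation. The convention `x / 0 = 0` gives `0`
on both sides at the degenerate points. -/
theorem R_eq (N : ℕ) (w : ℂ) : R N w = (1 - chebT (1 - 2 * w) N) *
    (1 + 2 * chebT (1 - 2 * w) N + 2 * chebU (1 - 2 * w) N) / (2 * chebU (1 - 2 * w) N) := by
  set s := Complex.sqrt w with hs
  have hw : w = s ^ 2 := by
    have := Complex.cpow_nat_inv_pow w two_ne_zero
    rw [hs, Complex.sqrt]; exact_mod_cast this.symm
  have hx : 1 - 2 * w = -(2 * s ^ 2 - 1) := by rw [hw]; ring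
  obtain ⟨hT, hU⟩ := cheb_neg_arg (2 * s ^ 2 - 1) N
  rw [← hx] at hU
  rw [← hx, ← chebT_mul_two, chebT_two_mul] at hT
  have hU2 := chebU_mul_two s N
  rw [chebU_two_mul] at hU2
  have hpell := cheb_pell s N
  have hR : R N w = if Even N then (w - 1) * s * chebU s N *
      (1 + 2 * chebT (1 - 2 * w) N + 2 * chebU (1 - 2 * w) N) / chebT s N else
      s * chebT s N * (1 + 2 * chebT (1 - 2 * w) N + 2 * chebU (1 - 2 * w) N) / chebU s N := by
    rw [R, chebFactor_eq]; rfl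
  rw [hR]
  by_cases hs0 : s = 0
  · have h1 : chebT (1 - 2 * w) N = 1 := by rw [hw, hs0]; simp [chebT]
    rw [hs0, h1]
    simp
  generalize 1 + 2 * chebT (1 - 2 * w) N + 2 * chebU (1 - 2 * w) N = C
  generalize chebU (1 - 2 * w) N = U at *
  generalize chebT (1 - 2 * w) N = T at *
  generalize chebU (2 * s ^ 2 - 1) N = U' at *
  generalize chebT s N = t at *
  generalize chebU s N = u at *
  rw [hw]
  have hsU : U' = t * u / s := by
    field_simp
    linear_combination -hU2 / 2
  split_ifs with hN
  · rw [hN.neg_one_pow] at hT hU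
    rw [hU, hsU]
    by_cases ht : t = 0
    · simp [ht]
    by_cases hu : u = 0
    · simp [hu]
    have h1 : 1 - T = 2 * (1 - s ^ 2) * u ^ 2 := by linear_combination -2 * hpell - hT
    rw [h1]
    field_simp
    ring
  · rw [(Nat.not_even_iff_odd.1 hN).neg_one_pow] at hT hU
    rw [hU, hsU, hT]
    by_cases ht : t = 0
    · simp [ht]
    by_cases hu : u = 0
    · simp [hu]
    field_simp
    ring

/-- The equation `R(z) = y` with the common factors of numerator and denominator removed. -/
theorem div_eq_iff_reduced {𝕜 : Type*} [Field 𝕜] [CharZero 𝕜] {T U a b e f y : 𝕜}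
    (hT : 1 - T = e * a ^ 2) (hT' : 1 + T = f * b ^ 2) (hU : U = a * b) (hy : y ≠ 0) :
    (1 - T) * (1 + 2 * T + 2 * U) / (2 * U) = y ↔
      e * a * (1 + 2 * T + 2 * U) - 2 * y * b = 0 := by
  have h2 : (2 : 𝕜) ≠ 0 := two_ne_zero
  constructor
  · intro h
    have hU0 : U ≠ 0 := by
      rintro rfl
      simp at h
      exact hy h.symm
    rw [div_eq_iff (mul_ne_zero h2 hU0)] at h
    have ha : a ≠ 0 := by rintro rfl; simp at hU; exact hU0 hU
    apply mul_left_cancel₀ ha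
    rw [mul_zero, ← sub_eq_zero.2 h, hT]
    nth_rw 3 [hU]
    ring
  · intro h
    have hb : b ≠ 0 := by
      rintro rfl
      have h1 : T = -1 := by linear_combination hT'
      have h3 : U = 0 := by rw [hU, mul_zero]
      rw [h1, h3] at h
      have h4 : e * a = 0 := by linear_combination -h
      have h5 : (2 : 𝕜) = 0 := by linear_combination hT + a * h4 + h1
      exact h2 h5
    have ha : a ≠ 0 := by
      rintro rfl
      simp [hy, hb] at h
    have hU0 : U ≠ 0 := by rw [hU]; exact mul_ne_zero ha hb
    rw [div_eq_iff (mul_ne_zero h2 hU0), hT]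
    linear_combination a * h - 2 * y * hU

/-- A real polynomial of degree at most `d` which alternates in sign at `d + 1` points has `d`
roots, all of them real. -/
theorem exists_roots_of_alternating {p : ℝ[X]} {d : ℕ} (hd : p.natDegree ≤ d) (t : ℕ → ℝ)
    (ht : ∀ j < d, t (j + 1) < t j) (hp : ∀ j ≤ d, 0 < (-1) ^ j * p.eval (t j)) :
    ∃ s : Finset ℝ, s.card = d ∧ (∀ x ∈ s, t d < x ∧ x < t 0) ∧
      ∀ w : ℂ, aeval w p = 0 ↔ ∃ x ∈ s, (x : ℂ) = w := by
  have hroot : ∀ j, ∃ r, j < d → (t (j + 1) < r ∧ r < t j) ∧ p.eval r = 0 := by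
    intro j
    by_cases hj : j < d
    · have h1 := hp j hj.le
      have h2 := hp (j + 1) hj
      have hc : ContinuousOn (fun x => (-1) ^ j * p.eval x) (Set.Icc (t (j + 1)) (t j)) := by
        fun_prop
      have h3 := intermediate_value_Ioo (ht j hj).le hc
      have h4 : (0 : ℝ) ∈ Set.Ioo ((-1) ^ j * p.eval (t (j + 1))) ((-1) ^ j * p.eval (t j)) := by
        refine ⟨?_, h1⟩
        rw [pow_succ] at h2
        linarith
      obtain ⟨r, hr, hr0⟩ := h3 h4
      refine ⟨r, fun _ => ⟨hr, ?_⟩⟩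
      exact (mul_eq_zero.1 hr0).resolve_left (pow_ne_zero _ (by norm_num))
    · exact ⟨0, fun h => absurd h hj⟩
  choose r hr using hroot
  have hmono : ∀ j k, j < k → k ≤ d → t k < t j := by
    intro j k hjk
    induction k, hjk using Nat.le_induction with
    | base => exact fun h => ht j (by omega)
    | succ k hk ih => exact fun h => (ht k (by omega)).trans (ih (by omega))
  have hle : ∀ j k, j ≤ k → k ≤ d → t k ≤ t j := by
    intro j k hjk hk
    rcases hjk.eq_or_lt with rfl | h
    · exact le_rfl
    · exact (hmono j k h hk).le
  have hlt : ∀ j k, j < k → k < d → r k < r j := by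
    intro j k hjk hk
    calc r k < t k := (hr k hk).1.2
      _ ≤ t (j + 1) := hle _ _ hjk hk.le
      _ < r j := (hr j (by omega)).1.1
  have hinj : Set.InjOn r (Finset.range d : Set ℕ) := by
    intro j hj k hk h
    rw [Finset.coe_range, Set.mem_Iio] at hj hk
    rcases lt_trichotomy j k with h1 | h1 | h1
    · exact absurd h (hlt j k h1 hk).ne'
    · exact h1
    · exact absurd h (hlt k j h1 hj).ne
  have hcard : ((Finset.range d).image r).card = d := by
    rw [Finset.card_image_of_injOn hinj, Finset.card_range]
  have hp0 : p ≠ 0 := by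
    rintro rfl
    simpa using hp 0 (Nat.zero_le d)
  have hq0 : p.map (algebraMap ℝ ℂ) ≠ 0 := by
    rwa [Ne, Polynomial.map_eq_zero]
  refine ⟨(Finset.range d).image r, hcard, ?_, ?_⟩
  · intro x hx
    obtain ⟨j, hj, rfl⟩ := Finset.mem_image.1 hx
    rw [Finset.mem_range] at hj
    exact ⟨(hle (j + 1) d hj le_rfl).trans_lt (hr j hj).1.1,
      (hr j hj).1.2.trans_le (hle 0 j (Nat.zero_le j) hj.le)⟩
  -- The degree bound leaves no room for complex roots beyond the `d` real ones already found.
  · have hsub : ((Finset.range d).image r).image ((↑) : ℝ → ℂ) ⊆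
        (p.map (algebraMap ℝ ℂ)).roots.toFinset := by
      intro w hw
      obtain ⟨x, hx, rfl⟩ := Finset.mem_image.1 hw
      obtain ⟨j, hj, rfl⟩ := Finset.mem_image.1 hx
      rw [Multiset.mem_toFinset, mem_roots hq0, IsRoot.def, eval_map_algebraMap]
      have : aeval (algebraMap ℝ ℂ (r j)) p = 0 := by
        rw [aeval_algebraMap_apply_eq_algebraMap_eval, (hr j (Finset.mem_range.1 hj)).2, map_zero]
      exact this
    have heq := Finset.eq_of_subset_of_card_le hsub (by
      rw [Finset.card_image_of_injective _ Complex.ofReal_injective, hcard]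
      calc _ ≤ Multiset.card (p.map (algebraMap ℝ ℂ)).roots := Multiset.toFinset_card_le _
        _ ≤ (p.map (algebraMap ℝ ℂ)).natDegree := card_roots' _
        _ ≤ d := natDegree_map_le.trans hd)
    intro w
    have : aeval w p = 0 ↔ w ∈ (p.map (algebraMap ℝ ℂ)).roots.toFinset := by
      rw [Multiset.mem_toFinset, mem_roots hq0, IsRoot.def, eval_map_algebraMap]
    rw [this, ← heq, Finset.mem_image]


/-! ### Signs at the interlacing points -/

section Nodes

theorem cheb_two_pos (m : ℕ) : 1 ≤ chebT (2 : ℝ) m ∧ 0 ≤ chebU (2 : ℝ) m := by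
  induction m with
  | zero => simp [chebT_zero, chebU_zero]
  | succ m ih =>
    push_cast
    rw [chebT_succ, chebU_succ]
    constructor <;> linarith [ih.1, ih.2]

theorem chebU_two_one_le {m : ℕ} (hm : m ≠ 0) : 1 ≤ chebU (2 : ℝ) m := by
  obtain ⟨k, rfl⟩ := Nat.exists_eq_succ_of_ne_zero hm
  push_cast
  rw [chebU_succ]
  linarith [(cheb_two_pos k).1, (cheb_two_pos k).2]

theorem chebT_cos (θ : ℝ) (m : ℕ) : chebT (Real.cos θ) m = Real.cos (m * θ) := by
  rw [chebT, T_real_cos]; simp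

theorem chebU_cos (θ : ℝ) (m : ℕ) : Real.sin θ * chebU (Real.cos θ) m = Real.sin (m * θ) := by
  rw [chebU, mul_comm, U_real_cos]; simp

/-- The sign of the decimation polynomial at the nodes. -/
theorem node_sign {y : ℝ} (hy : 0 < y) (hy' : y < 3 / 2) (j : ℕ) :
    0 < (-1) ^ (j + 1) * (Real.cos (j * Real.pi / 3) * (2 * Real.sin (j * Real.pi / 3) ^ 2 - y)) := by
  have h1 : Real.cos (3 * (j * Real.pi / 3)) = (-1) ^ j := by
    rw [← Real.cos_nat_mul_pi]; congr 1; ring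
  have h2 : Real.sin (3 * (j * Real.pi / 3)) = 0 := by
    rw [← Real.sin_nat_mul_pi j]; congr 1; ring
  rw [Real.cos_three_mul] at h1
  rw [Real.sin_three_mul] at h2
  have h3 := Real.sin_sq_add_cos_sq (j * Real.pi / 3)
  rw [pow_succ, ← h1]
  set c := Real.cos (j * Real.pi / 3)
  set s := Real.sin (j * Real.pi / 3)
  have h4 : s * (3 - 4 * s ^ 2) = 0 := by linarith
  rcases mul_eq_zero.1 h4 with h | h
  · have hc : c ^ 2 = 1 := by rw [h] at h3; linarith
    have : (4 * c ^ 3 - 3 * c) * -1 * (c * (2 * s ^ 2 - y)) = y * (c ^ 2) * (4 * c ^ 2 - 3) := by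
      rw [h]; ring
    rw [this, hc]
    linarith
  · have hs : s ^ 2 = 3 / 4 := by linarith
    have hc : c ^ 2 = 1 / 4 := by linarith
    have : (4 * c ^ 3 - 3 * c) * -1 * (c * (2 * s ^ 2 - y)) =
        -((c ^ 2) * (4 * c ^ 2 - 3)) * (2 * s ^ 2 - y) := by ring
    rw [this, hc, hs]
    linarith

/-- The `j`-th node. -/
noncomputable def node (N j : ℕ) : ℝ := Real.cos (2 * j * Real.pi / (3 * N))

theorem node_zero (N : ℕ) : node N 0 = 1 := by simp [node]

theorem node_lt {N j k : ℕ} (hN : N ≠ 0) (hjk : j < k) (hk : 2 * k ≤ 3 * N) :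
    node N k < node N j := by
  have hN' : (0 : ℝ) < 3 * N := by positivity
  have h1 : (2 * k : ℝ) ≤ 3 * N := by exact_mod_cast hk
  have h2 : (j : ℝ) < k := by exact_mod_cast hjk
  have h3 := Real.pi_pos
  apply Real.cos_lt_cos_of_nonneg_of_le_pi
  · positivity
  · rw [div_le_iff₀ hN']; nlinarith
  · gcongr

theorem neg_one_le_node (N j : ℕ) : -1 ≤ node N j := Real.neg_one_le_cos _

theorem natDegree_U_pred (m : ℕ) : (U ℝ ((m : ℤ) - 1)).natDegree = m - 1 := by
  rw [natDegree_U]; simp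

theorem natDegree_one_add_le (N : ℕ) :
    (1 + 2 * T ℝ N + 2 * U ℝ ((N : ℤ) - 1) : ℝ[X]).natDegree ≤ N := by
  have h1 : (2 * T ℝ N).natDegree ≤ N := by
    refine natDegree_mul_le.trans ?_
    simp
  have h2 : (2 * U ℝ ((N : ℤ) - 1)).natDegree ≤ N := by
    refine natDegree_mul_le.trans ?_
    rw [natDegree_U_pred]
    simp
  exact natDegree_add_le_of_degree_le (natDegree_add_le_of_degree_le (by simp) h1) h2

/-- The polynomial whose roots are the solutions of `R(z) = y`, for even `N = 2k`. -/
noncomputable def evenPoly (k : ℕ) (y : ℝ) : ℝ[X] :=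
  2 * (1 - X ^ 2) * U ℝ ((k : ℤ) - 1) * (1 + 2 * T ℝ (2 * k : ℕ) + 2 * U ℝ ((2 * k : ℕ) - 1)) -
    Polynomial.C (2 * y) * (2 * T ℝ k)

theorem aeval_evenPoly {𝕜 : Type*} [Field 𝕜] [Algebra ℝ 𝕜] (k : ℕ) (y : ℝ) (x : 𝕜) :
    aeval x (evenPoly k y) = 2 * (1 - x ^ 2) * chebU x k *
      (1 + 2 * chebT x (2 * k : ℕ) + 2 * chebU x (2 * k : ℕ)) -
        2 * algebraMap ℝ 𝕜 y * (2 * chebT x k) := by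
  simp only [evenPoly, map_sub, map_mul, map_add, map_one, map_pow, map_ofNat, aeval_X,
    Polynomial.aeval_C, aeval_T, aeval_U, chebT, chebU]

theorem natDegree_evenPoly_le {k : ℕ} (hk : k ≠ 0) (y : ℝ) :
    (evenPoly k y).natDegree ≤ 3 * k + 1 := by
  have h0 := natDegree_one_add_le (2 * k)
  have h1 : (1 - X ^ 2 : ℝ[X]).natDegree ≤ 2 := by compute_degree
  have h2 : (2 * (1 - X ^ 2) : ℝ[X]).natDegree ≤ 0 + 2 :=
    natDegree_mul_le_of_le (by simp) h1
  have h3 := natDegree_mul_le_of_le (natDegree_mul_le_of_le h2 (natDegree_U_pred k).le) h0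
  have h4 : (Polynomial.C (2 * y) * (2 * T ℝ k)).natDegree ≤ 0 + (0 + k) :=
    natDegree_mul_le_of_le (natDegree_C _).le (natDegree_mul_le_of_le (by simp) (by simp))
  refine (natDegree_sub_le_of_le h3 h4).trans ?_
  omega

/-- At the node, `kθ = α` with `α = jπ/3`; all Chebyshev values become trigonometric functions of
`α`, and `sin 3α = 0` lowers the degree. The result no longer depends on `k`. -/
theorem eval_evenPoly_node {k : ℕ} (hk : k ≠ 0) (y : ℝ) (j : ℕ) :
    (evenPoly k y).eval (node (2 * k) j) =
      4 * (Real.cos (j * Real.pi / 3) * (2 * Real.sin (j * Real.pi / 3) ^ 2 - y)) := by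
  have h := aeval_evenPoly k y (node (2 * k) j)
  rw [Polynomial.coe_aeval_eq_eval] at h
  rw [h, node]
  set θ : ℝ := 2 * j * Real.pi / (3 * (2 * k : ℕ)) with hθ
  set α : ℝ := j * Real.pi / 3 with hα
  have hk' : (k : ℝ) ≠ 0 := by exact_mod_cast hk
  have e1 : k * θ = α := by rw [hθ, hα]; push_cast; field_simp
  have e2 : ((2 * k : ℕ) : ℝ) * θ = 2 * α := by rw [← e1]; push_cast; ring
  have s1 := chebU_cos θ k
  have s2 := chebU_cos θ (2 * k)
  rw [chebT_cos, chebT_cos, e1, e2]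
  rw [e1] at s1
  rw [e2] at s2
  have h3 : Real.sin (3 * α) = 0 := by
    rw [← Real.sin_nat_mul_pi j, hα]; congr 1; ring
  rw [Real.sin_three_mul] at h3
  have h5 := Real.sin_sq θ
  rw [← Real.sin_sq θ, Real.cos_two_mul]
  rw [Real.sin_two_mul] at s2
  have h6 := Real.sin_sq_add_cos_sq α
  simp only [Algebra.algebraMap_self, RingHom.id_apply]
  linear_combination (2 * Real.sin θ * (1 + 2 * (2 * Real.cos α ^ 2 - 1)) +
    4 * Real.sin θ * chebU (Real.cos θ) (2 * k : ℕ)) * s1 + 4 * Real.sin α * s2 +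
    2 * Real.sin θ * h3 + 8 * Real.sin θ * Real.sin α * h6

theorem eval_evenPoly_neg_two {k : ℕ} (hk : k ≠ 0) {y : ℝ} (hy' : y < 3 / 2) :
    0 < (-1) ^ k * (evenPoly k y).eval (-2) := by
  have h := aeval_evenPoly k y (-2 : ℝ)
  rw [Polynomial.coe_aeval_eq_eval] at h
  obtain ⟨a1, a2⟩ := cheb_neg_arg (2 : ℝ) k
  obtain ⟨b1, b2⟩ := cheb_neg_arg (2 : ℝ) (2 * k)
  rw [pow_mul] at b1 b2
  push_cast at b1 b2
  rw [chebT_two_mul 2] at b1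
  rw [chebU_two_mul 2] at b2
  push_cast at h
  rw [h, a1, a2, b1, b2]
  have hp := cheb_pell (2 : ℝ) k
  have hU := chebU_two_one_le hk
  have hT := (cheb_two_pos k).1
  set u := chebU (2 : ℝ) k
  set t := chebT (2 : ℝ) k
  have hsq : ((-1 : ℝ) ^ k) * (-1) ^ k = 1 := by rw [← mul_pow]; norm_num
  simp only [Algebra.algebraMap_self, RingHom.id_apply]
  have key : (-1) ^ k * (2 * (1 - (-2) ^ 2) * (-(-1) ^ k * u) *
      (1 + 2 * (((-1) ^ 2) ^ k * (2 * t ^ 2 - 1)) + 2 * (-((-1) ^ 2) ^ k * (2 * t * u))) -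
      2 * y * (2 * ((-1) ^ k * t))) =
      (-1) ^ k * (-1) ^ k * (6 * u * (4 * t ^ 2 - 1 - 4 * t * u) - 4 * y * t) := by
    norm_num; ring
  rw [key, hsq, one_mul]
  -- From Pell, `t² = 1 + 3u²`, with `1 ≤ u`.
  have ht : t ≤ 2 * u := by nlinarith
  have h4 : 3 + 4 * u ^ 2 ≤ 4 * t ^ 2 - 1 - 4 * t * u := by nlinarith
  nlinarith

/-- The polynomial whose roots are the solutions of `R(z) = y`, for odd `N = 2k + 1`. -/
noncomputable def oddPoly (k : ℕ) (y : ℝ) : ℝ[X] :=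
  (1 - X) * (U ℝ k + U ℝ ((k : ℤ) - 1)) *
    (1 + 2 * T ℝ (2 * k + 1 : ℕ) + 2 * U ℝ ((2 * k + 1 : ℕ) - 1)) -
    Polynomial.C (2 * y) * (U ℝ k - U ℝ ((k : ℤ) - 1))

theorem eval_U_natCast {A : Type*} [CommRing A] (x : A) (k : ℕ) :
    (U A k).eval x = x * chebU x k + chebT x k := by
  rw [← chebU_succ, chebU, add_sub_cancel_right]

theorem aeval_oddPoly {𝕜 : Type*} [Field 𝕜] [Algebra ℝ 𝕜] (k : ℕ) (y : ℝ) (x : 𝕜) :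
    aeval x (oddPoly k y) = (1 - x) * ((1 + x) * chebU x k + chebT x k) *
      (1 + 2 * chebT x (2 * k + 1 : ℕ) + 2 * chebU x (2 * k + 1 : ℕ)) -
        2 * algebraMap ℝ 𝕜 y * ((x - 1) * chebU x k + chebT x k) := by
  simp only [oddPoly, map_sub, map_mul, map_add, map_one, map_ofNat, aeval_X, Polynomial.aeval_C,
    aeval_T, aeval_U, eval_U_natCast]
  simp only [chebT, chebU]
  ring

theorem natDegree_oddPoly_le (k : ℕ) (y : ℝ) : (oddPoly k y).natDegree ≤ 3 * k + 2 := by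
  have h0 := natDegree_one_add_le (2 * k + 1)
  have h1 : (1 - X : ℝ[X]).natDegree ≤ 1 := by compute_degree
  have h2 : (U ℝ k).natDegree ≤ k := (natDegree_U_natCast ℝ k).le
  have h3 : (U ℝ ((k : ℤ) - 1)).natDegree ≤ k := by rw [natDegree_U_pred]; omega
  have h4 := natDegree_mul_le_of_le
    (natDegree_mul_le_of_le h1 (natDegree_add_le_of_degree_le h2 h3)) h0
  have h5 : (Polynomial.C (2 * y) * (U ℝ k - U ℝ ((k : ℤ) - 1))).natDegree ≤ 0 + k :=
    natDegree_mul_le_of_le (natDegree_C _).le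
      ((natDegree_sub_le_of_le h2 h3).trans (max_self k).le)
  refine (natDegree_sub_le_of_le h4 h5).trans ?_
  omega

/-- For odd `N` the polynomial contains the quotient `cos((k+½)·)/cos(½·)`; the half-angle cosine on
the left clears this denominator, and it is positive at the nodes used. -/
theorem eval_oddPoly_node (k : ℕ) (y : ℝ) (j : ℕ) :
    Real.cos (j * Real.pi / (3 * (2 * k + 1 : ℕ))) * (oddPoly k y).eval (node (2 * k + 1) j) =
      2 * (Real.cos (j * Real.pi / 3) * (2 * Real.sin (j * Real.pi / 3) ^ 2 - y)) := by
  have h := aeval_oddPoly k y (node (2 * k + 1) j)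
  rw [Polynomial.coe_aeval_eq_eval] at h
  rw [h, node]
  set θ : ℝ := j * Real.pi / (3 * (2 * k + 1 : ℕ)) with hθ
  set α : ℝ := j * Real.pi / 3 with hα
  have hk' : (2 * k + 1 : ℝ) ≠ 0 := by positivity
  have e0 : 2 * j * Real.pi / (3 * (2 * k + 1 : ℕ)) = 2 * θ := by rw [hθ]; ring
  have e1 : k * (2 * θ) + θ = α := by rw [hθ, hα]; push_cast; field_simp
  have e2 : ((2 * k + 1 : ℕ) : ℝ) * (2 * θ) = 2 * α := by rw [← e1]; push_cast; ring
  rw [e0]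
  have s1 := chebU_cos (2 * θ) k
  have s2 := chebU_cos (2 * θ) (2 * k + 1)
  have c1 := Real.sin_add (k * (2 * θ)) θ
  have c2 := Real.cos_add (k * (2 * θ)) θ
  rw [e1, ← s1, ← chebT_cos, Real.sin_two_mul] at c1
  rw [e1, ← s1, ← chebT_cos, Real.sin_two_mul] at c2
  have h3 : Real.sin (3 * α) = 0 := by
    rw [← Real.sin_nat_mul_pi j, hα]; congr 1; ring
  rw [Real.sin_three_mul] at h3
  have h5 := Real.sin_sq_add_cos_sq θ
  have h6 := Real.sin_sq_add_cos_sq α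
  have h7 := Real.cos_two_mul θ
  rw [e2, Real.sin_two_mul α, Real.sin_two_mul θ] at s2
  have hT : chebT (Real.cos (2 * θ)) (2 * k + 1 : ℕ) = 2 * Real.cos α ^ 2 - 1 := by
    rw [chebT_cos, e2, Real.cos_two_mul]
  have hV : Real.sin θ * ((1 + Real.cos (2 * θ)) * chebU (Real.cos (2 * θ)) k +
      chebT (Real.cos (2 * θ)) k) = Real.sin α := by
    rw [c1]
    linear_combination Real.sin θ * chebU (Real.cos (2 * θ)) k * h7
  have hW : Real.cos θ * ((Real.cos (2 * θ) - 1) * chebU (Real.cos (2 * θ)) k +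
      chebT (Real.cos (2 * θ)) k) = Real.cos α := by
    rw [c2]
    linear_combination Real.cos θ * chebU (Real.cos (2 * θ)) k * h7 +
      2 * Real.cos θ * chebU (Real.cos (2 * θ)) k * h5
  rw [hT]
  generalize (1 + Real.cos (2 * θ)) * chebU (Real.cos (2 * θ)) k +
    chebT (Real.cos (2 * θ)) k = V' at *
  generalize (Real.cos (2 * θ) - 1) * chebU (Real.cos (2 * θ)) k +
    chebT (Real.cos (2 * θ)) k = W' at *
  generalize chebU (Real.cos (2 * θ)) (2 * k + 1 : ℕ) = U' at *
  have h8 : 1 - Real.cos (2 * θ) = 2 * Real.sin θ ^ 2 := by linear_combination -h7 - 2 * h5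
  rw [h8]
  simp only [Algebra.algebraMap_self, RingHom.id_apply]
  linear_combination (2 * Real.sin θ * Real.cos θ * (1 + 2 * (2 * Real.cos α ^ 2 - 1)) +
    4 * Real.sin θ * Real.cos θ * U') * hV - 2 * y * hW + 2 * Real.sin α * s2 +
    2 * Real.sin θ * Real.cos θ * h3 + 8 * Real.sin θ * Real.cos θ * Real.sin α * h6

theorem eval_oddPoly_neg_two {k : ℕ} {y : ℝ} (hy : 0 < y) :
    0 < (-1) ^ (k + 1) * (oddPoly k y).eval (-2) := by
  have h := aeval_oddPoly k y (-2 : ℝ)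
  rw [Polynomial.coe_aeval_eq_eval] at h
  obtain ⟨a1, a2⟩ := cheb_neg_arg (2 : ℝ) k
  obtain ⟨b1, b2⟩ := cheb_neg_arg (2 : ℝ) (2 * k + 1)
  rw [pow_succ, pow_mul] at b1 b2
  have hp := cheb_pell (2 : ℝ) k
  have hT := (cheb_two_pos k).1
  have hU := (cheb_two_pos k).2
  rw [h, a1, a2, b1, b2]
  push_cast
  rw [chebT_odd, chebU_odd]
  set u := chebU (2 : ℝ) k
  set t := chebT (2 : ℝ) k
  have hsq : ((-1 : ℝ) ^ k) * (-1) ^ k = 1 := by rw [← mul_pow]; norm_num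
  simp only [Algebra.algebraMap_self, RingHom.id_apply]
  have key : (-1 : ℝ) ^ (k + 1) * ((1 - -2) * ((1 + -2) * (-(-1) ^ k * u) + (-1) ^ k * t) *
      (1 + 2 * (((-1) ^ 2) ^ k * -1 * (1 - (1 - 2) * ((1 + 2) * u + t) ^ 2)) +
        2 * (-(((-1) ^ 2) ^ k * -1) * (((1 + 2) * u + t) * ((2 - 1) * u + t)))) -
      2 * y * ((-2 - 1) * (-(-1) ^ k * u) + (-1) ^ k * t)) =
      (-1) ^ k * (-1) ^ k * (3 * (u + t) * (1 + 2 * (3 * u + t) * (2 * u)) +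
        2 * y * (3 * u + t)) := by
    rw [pow_succ]; norm_num; ring
  rw [key, hsq, one_mul]
  positivity

end Nodes

end Gasket

/-! ### Fibres of the decimation function and zeros of the Chebyshev factor -/

namespace Gasket

open Polynomial Polynomial.Chebyshev

/-- Every point of `(0, 3/2)` has exactly `⌊3N/2⌋ + 1` preimages under `R`, all real and in
`(0, 3/2)`. -/
theorem exists_fiber_R {N : ℕ} (hN : N ≠ 0) {y : ℝ} (hy : 0 < y) (hy' : y < 3 / 2) :
    ∃ s : Finset ℝ, s.card = 3 * N / 2 + 1 ∧ (∀ z ∈ s, 0 < z ∧ z < 3 / 2) ∧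
      ∀ w : ℂ, R N w = y ↔ ∃ z ∈ s, (z : ℂ) = w := by
  -- In `x = 1 - 2z` the interval `(0, 3/2)` becomes `(-2, 1)`. The nodes `0, …, ⌊3N/2⌋` run from
  -- `1` down to no less than `-1`, and `-2` is appended as the last of the alternation points.
  suffices h : ∃ p : ℝ[X], p.natDegree ≤ 3 * N / 2 + 1 ∧
      (∀ w : ℂ, aeval (1 - 2 * w) p = 0 ↔ R N w = y) ∧
      (∀ j ≤ 3 * N / 2, 0 < (-1) ^ j * p.eval (node N j)) ∧
      0 < (-1) ^ (3 * N / 2 + 1) * p.eval (-2) by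
    obtain ⟨p, hd, hR, h1, h2⟩ := h
    obtain ⟨s, hs1, hs2, hs3⟩ := exists_roots_of_alternating hd
      (fun j => if j ≤ 3 * N / 2 then node N j else -2) (fun j hj => by
        rw [if_pos (show j ≤ 3 * N / 2 by omega)]
        split_ifs with h
        · exact node_lt hN (Nat.lt_succ_self j) (by omega)
        · linarith [neg_one_le_node N j]) (fun j hj => by
        split_ifs with h
        · exact h1 j h
        · obtain rfl : j = 3 * N / 2 + 1 := by omega
          exact h2)
    refine ⟨s.image fun x => (1 - x) / 2, ?_, ?_, ?_⟩
    · rw [Finset.card_image_of_injective _ fun a b h => by simpa using h, hs1]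
    · intro z hz
      obtain ⟨x, hx, rfl⟩ := Finset.mem_image.1 hz
      have := hs2 x hx
      simp only [Nat.zero_le, if_true, node_zero] at this
      rw [if_neg (by omega)] at this
      constructor <;> linarith
    · intro w
      rw [← hR, hs3]
      simp only [Finset.mem_image, exists_exists_and_eq_and]
      refine exists_congr fun x => and_congr_right fun _ => ?_
      push_cast
      constructor <;> intro h
      · rw [h]; ring
      · rw [← h]; ring
  have hyC : (y : ℂ) ≠ 0 := by exact_mod_cast hy.ne'
  rcases Nat.even_or_odd' N with ⟨k, rfl | rfl⟩
  · have hk : k ≠ 0 := by rintro rfl; exact hN rfl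
    have hd : 3 * (2 * k) / 2 = 3 * k := by omega
    rw [hd]
    refine ⟨-evenPoly k y, ?_, fun w => ?_, fun j _ => ?_, ?_⟩
    · rw [natDegree_neg]; exact natDegree_evenPoly_le hk y
    · rw [map_neg, neg_eq_zero, aeval_evenPoly, R_eq]
      refine (div_eq_iff_reduced (e := 2 * (1 - (1 - 2 * w) ^ 2)) (f := 1 / 2) ?_ ?_ ?_ hyC).symm
      · push_cast
        rw [chebT_two_mul]
        linear_combination -2 * cheb_pell (1 - 2 * w) k
      · push_cast
        rw [chebT_two_mul]
        ring
      · push_cast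
        rw [chebU_two_mul]
        ring
    · have := node_sign hy hy' j
      rw [eval_neg, eval_evenPoly_node hk]
      rw [pow_succ] at this
      linarith
    · have := eval_evenPoly_neg_two hk hy'
      rw [eval_neg, pow_succ, pow_mul]
      norm_num
      linarith
  · have hd : 3 * (2 * k + 1) / 2 = 3 * k + 1 := by omega
    rw [hd]
    refine ⟨-oddPoly k y, ?_, fun w => ?_, fun j hj => ?_, ?_⟩
    · rw [natDegree_neg]; exact natDegree_oddPoly_le k y
    · rw [map_neg, neg_eq_zero, aeval_oddPoly, R_eq]
      push_cast
      refine (div_eq_iff_reduced (e := 1 - (1 - 2 * w)) (f := 1 + (1 - 2 * w)) ?_ ?_ ?_ hyC).symm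
      · rw [chebT_odd]; ring
      · rw [chebT_odd]
        linear_combination -2 * cheb_pell (1 - 2 * w) k
      · rw [chebU_odd]
    · have h1 := node_sign hy hy' j
      have h2 := eval_oddPoly_node k y j
      have h3 : 0 < Real.cos (j * Real.pi / (3 * (2 * k + 1 : ℕ))) := by
        apply Real.cos_pos_of_mem_Ioo
        have hpi := Real.pi_pos
        have hj' : (2 * j : ℝ) < 3 * (2 * k + 1) := by
          have : 2 * j < 3 * (2 * k + 1) := by omega
          exact_mod_cast this
        constructor
        · have : (0 : ℝ) ≤ j * Real.pi / (3 * (2 * k + 1 : ℕ)) := by positivity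
          linarith
        · push_cast
          rw [div_lt_iff₀ (by positivity)]
          nlinarith
      rw [eval_neg]
      rw [pow_succ] at h1
      have h4 : 0 < Real.cos (j * Real.pi / (3 * (2 * k + 1 : ℕ))) *
          ((-1) ^ j * -(oddPoly k y).eval (node (2 * k + 1) j)) := by
        linear_combination 2 * h1 + (-1) ^ j * h2
      exact (mul_pos_iff_of_pos_left h3).1 h4
    · have := eval_oddPoly_neg_two (k := k) hy
      rw [eval_neg, show 3 * k + 1 + 1 = 2 * (k + 1) + k by ring, pow_add, pow_mul]
      rw [pow_succ] at this
      norm_num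
      linarith

/-- The zeros of the Chebyshev factor are `N` real points of `(0, 3/2)`. -/
theorem exists_zeros_chebFactor {N : ℕ} (hN : N ≠ 0) :
    ∃ s : Finset ℝ, s.card = N ∧ (∀ z ∈ s, 0 < z ∧ z < 3 / 2) ∧
      ∀ w : ℂ, chebFactor N w = 0 ↔ ∃ z ∈ s, (z : ℂ) = w := by
  have hev : ∀ x : ℝ, (1 + 2 * T ℝ N + 2 * U ℝ ((N : ℤ) - 1) : ℝ[X]).eval x =
      1 + 2 * chebT x N + 2 * chebU x N := by
    intro x
    simp [chebT, chebU]
  obtain ⟨s, hs1, hs2, hs3⟩ := exists_roots_of_alternating (natDegree_one_add_le N)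
    -- These nodes make `Nθ` equal to `0` (even `i`) or `4π/3` (odd `i`) modulo `2π`. In the first
    -- case `C ≥ 3`; in the second `1 + 2T_N = 0` and the sine term is negative.
    (fun i => if i < N then node N ((3 * i + 1) / 2) else -2) (fun i hi => by
      rw [if_pos hi]
      split_ifs with h
      · exact node_lt hN (by omega) (by omega)
      · linarith [neg_one_le_node N ((3 * i + 1) / 2)]) (fun i hi => by
      rw [hev]
      have hN' : (0 : ℝ) < N := by positivity
      have hpi := Real.pi_pos
      split_ifs with h
      · obtain ⟨θ, hθ⟩ : ∃ θ : ℝ, θ = 2 * ((3 * i + 1) / 2 : ℕ) * Real.pi / (3 * N) := ⟨_, rfl⟩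
        have hnode : node N ((3 * i + 1) / 2) = Real.cos θ := by rw [hθ, node]
        have hNθ : N * θ = 2 * ((3 * i + 1) / 2 : ℕ) * Real.pi / 3 := by rw [hθ]; field_simp
        have hsin : i ≠ 0 → 0 < Real.sin θ := by
          intro hi0
          apply Real.sin_pos_of_pos_of_lt_pi
          · have : 0 < (3 * i + 1) / 2 := by omega
            rw [hθ]; positivity
          · have h1 : 2 * ((3 * i + 1) / 2) < 3 * N := by omega
            have h2 : (2 * ((3 * i + 1) / 2 : ℕ) : ℝ) < 3 * N := by exact_mod_cast h1
            rw [hθ, div_lt_iff₀ (by positivity)]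
            nlinarith
        have hT := chebT_cos θ N
        have hU := chebU_cos θ N
        rw [hnode, hT]
        rcases Nat.even_or_odd' i with ⟨l, rfl | rfl⟩
        · rw [show (3 * (2 * l) + 1) / 2 = 3 * l by omega] at hNθ
          have e : N * θ = l * (2 * Real.pi) := by rw [hNθ]; push_cast; ring
          rw [e, Real.cos_nat_mul_two_pi]
          rw [e] at hU
          have hs0 : Real.sin (l * (2 * Real.pi)) = 0 := by
            rw [show (l * (2 * Real.pi) : ℝ) = (2 * l : ℕ) * Real.pi by push_cast; ring]
            exact Real.sin_nat_mul_pi _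
          rw [hs0] at hU
          have hU0 : 0 ≤ chebU (Real.cos θ) N := by
            by_cases hl : 2 * l = 0
            · have : Real.cos θ = 1 := by
                rw [hθ, show (3 * (2 * l) + 1) / 2 = 0 by omega]; simp
              rw [this, chebU, U_eval_one]
              push_cast; linarith
            · exact ((mul_eq_zero.1 hU).resolve_left (hsin hl).ne').ge
          rw [pow_mul]; norm_num
          linarith
        · rw [show (3 * (2 * l + 1) + 1) / 2 = 3 * l + 2 by omega] at hNθ
          have e : N * θ = Real.pi / 3 + Real.pi + l * (2 * Real.pi) := by
            rw [hNθ]; push_cast; ring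
          rw [e, Real.cos_add_nat_mul_two_pi, Real.cos_add_pi, Real.cos_pi_div_three]
          rw [e, Real.sin_add_nat_mul_two_pi, Real.sin_add_pi, Real.sin_pi_div_three] at hU
          have h3 : 0 < √3 := by positivity
          have h4 := hsin (by omega)
          have hU0 : chebU (Real.cos θ) N < 0 := by
            by_contra hc
            have := mul_nonneg h4.le (not_lt.1 hc)
            rw [hU] at this
            linarith
          rw [pow_succ, pow_mul]; norm_num
          linarith
      · obtain rfl : i = N := by omega
        obtain ⟨a1, a2⟩ := cheb_neg_arg (2 : ℝ) i
        rw [a1, a2]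
        have hp := cheb_pell (2 : ℝ) i
        have h1 := chebU_two_one_le hN
        have h2 := (cheb_two_pos i).1
        -- Pell gives `t² = 1 + 3u² ≥ (u + 1)²` for `u ≥ 1`; this gap of one outweighs the constant
        -- term of `C` in absolute value.
        have h3 : chebU (2 : ℝ) i + 1 ≤ chebT (2 : ℝ) i := by nlinarith
        have hsq : ((-1 : ℝ) ^ i) * (-1) ^ i = 1 := by rw [← mul_pow]; norm_num
        have h4 : -1 ≤ ((-1 : ℝ) ^ i) := by
          rcases neg_one_pow_eq_or ℝ i with h | h <;> simp [h]
        have : (-1 : ℝ) ^ i * (1 + 2 * ((-1) ^ i * chebT 2 i) + 2 * (-(-1) ^ i * chebU 2 i)) =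
            (-1) ^ i + (-1) ^ i * (-1) ^ i * (2 * chebT 2 i - 2 * chebU 2 i) := by ring
        rw [this, hsq]
        linarith)
  refine ⟨s.image fun x => (1 - x) / 2, ?_, ?_, ?_⟩
  · rw [Finset.card_image_of_injective _ fun a b h => by simpa using h, hs1]
  · intro z hz
    obtain ⟨x, hx, rfl⟩ := Finset.mem_image.1 hz
    have := hs2 x hx
    simp only [lt_irrefl, if_false, Nat.pos_of_ne_zero hN, if_true] at this
    norm_num [node_zero] at this
    constructor <;> linarith
  · intro w
    have h1 : chebFactor N w = aeval (1 - 2 * w) (1 + 2 * T ℝ N + 2 * U ℝ ((N : ℤ) - 1) : ℝ[X]) := by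
      simp only [chebFactor_eq, map_add, map_mul, map_one, map_ofNat, aeval_T, aeval_U, chebT, chebU]
    rw [h1, hs3]
    simp only [Finset.mem_image, exists_exists_and_eq_and]
    refine exists_congr fun x => and_congr_right fun _ => ?_
    push_cast
    constructor <;> intro h
    · rw [h]; ring
    · rw [← h]; ring

end Gasket

/-! ### Dynamics on the real line, weights of the initial set, and counting of preimages -/

namespace Gasket

open Polynomial.Chebyshev

/-- The restriction of `R` to the real line. -/
noncomputable def realR (N : ℕ) (z : ℝ) : ℝ :=
  (1 - chebT (1 - 2 * z) N) * (1 + 2 * chebT (1 - 2 * z) N + 2 * chebU (1 - 2 * z) N) /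
    (2 * chebU (1 - 2 * z) N)

theorem ofReal_chebT (x : ℝ) (m : ℤ) : ((chebT x m : ℝ) : ℂ) = chebT (x : ℂ) m :=
  complex_ofReal_eval_T x m

theorem ofReal_chebU (x : ℝ) (m : ℤ) : ((chebU x m : ℝ) : ℂ) = chebU (x : ℂ) m :=
  complex_ofReal_eval_U x _

theorem R_ofReal (N : ℕ) (z : ℝ) : R N z = (realR N z : ℂ) := by
  rw [R_eq, realR]
  push_cast
  rw [ofReal_chebT, ofReal_chebU]
  push_cast
  rfl

theorem chebFactor_ofReal (N : ℕ) (z : ℝ) : chebFactor N z =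
    ((1 + 2 * chebT (1 - 2 * z) N + 2 * chebU (1 - 2 * z) N : ℝ) : ℂ) := by
  rw [chebFactor_eq]
  push_cast
  rw [ofReal_chebT, ofReal_chebU]
  push_cast
  rfl

theorem iterate_R_ofReal (N m : ℕ) (z : ℝ) : (R N)^[m] z = ((realR N)^[m] z : ℝ) :=
  (Function.Semiconj.iterate_right (f := ((↑) : ℝ → ℂ)) (fun z => (R_ofReal N z).symm) m z).symm

theorem exists_fiber_realR {N : ℕ} (hN : N ≠ 0) {y : ℝ} (hy : 0 < y) (hy' : y < 3 / 2) :
    ∃ s : Finset ℝ, s.card = 3 * N / 2 + 1 ∧ (∀ z ∈ s, 0 < z ∧ z < 3 / 2) ∧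
      ∀ z : ℝ, realR N z = y ↔ z ∈ s := by
  obtain ⟨s, h1, h2, h3⟩ := exists_fiber_R hN hy hy'
  refine ⟨s, h1, h2, fun z => ?_⟩
  have := h3 z
  rw [R_ofReal] at this
  simpa using this

theorem exists_real_of_R_eq {N : ℕ} (hN : N ≠ 0) {y : ℝ} (hy : 0 < y) (hy' : y < 3 / 2) {w : ℂ}
    (hw : R N w = y) : ∃ z : ℝ, (z : ℂ) = w := by
  obtain ⟨s, -, -, h3⟩ := exists_fiber_R hN hy hy'
  obtain ⟨z, -, h⟩ := (h3 w).1 hw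
  exact ⟨z, h⟩

theorem mem_Ioo_of_realR_mem {N : ℕ} (hN : N ≠ 0) {z : ℝ} (h : realR N z ∈ Set.Ioo (0 : ℝ) (3 / 2)) :
    z ∈ Set.Ioo (0 : ℝ) (3 / 2) := by
  obtain ⟨s, -, h2, h3⟩ := exists_fiber_realR hN h.1 h.2
  exact h2 z ((h3 z).1 rfl)

/-- `sin²(jπ / (3N))`. -/
noncomputable def realSinSq (N j : ℕ) : ℝ := Real.sin (j * Real.pi / (3 * N)) ^ 2

theorem sinSq_eq (N j : ℕ) : sinSq N j = (realSinSq N j : ℂ) := rfl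

theorem one_sub_realSinSq (N j : ℕ) :
    1 - 2 * realSinSq N j = Real.cos (2 * j * Real.pi / (3 * N)) := by
  rw [realSinSq, Real.sin_sq, show 2 * (j : ℝ) * Real.pi / (3 * N) = 2 * (j * Real.pi / (3 * N)) by ring,
    Real.cos_two_mul]
  ring

section

variable {N : ℕ} [NeZero N]

theorem three_mul_pos : (0 : ℝ) < 3 * N := by
  have : (0 : ℝ) < N := by exact_mod_cast NeZero.pos N
  positivity

theorem realSinSq_mem_Ioo {j : ℕ} (hj : j ∈ indexSet N) : realSinSq N j ∈ Set.Ioo (0 : ℝ) (3 / 2) := by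
  obtain ⟨h1, h2, -⟩ := hj
  have h3 : (j : ℝ) < 3 * N := by
    have : j < 3 * N := by omega
    exact_mod_cast this
  have hN := three_mul_pos (N := N)
  have hpi := Real.pi_pos
  have hj0 : (0 : ℝ) < j := by exact_mod_cast h1
  have hs : 0 < Real.sin (j * Real.pi / (3 * N)) := by
    apply Real.sin_pos_of_pos_of_lt_pi
    · positivity
    · rw [div_lt_iff₀ hN]; nlinarith
  refine ⟨pow_pos hs 2, ?_⟩
  have := Real.sin_sq_le_one (j * Real.pi / (3 * N))
  rw [realSinSq]
  linarith

theorem sin_two_mul_ne_zero {j : ℕ} (hj : j ∈ indexSet N) :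
    Real.sin (2 * j * Real.pi / (3 * N)) ≠ 0 := by
  obtain ⟨h1, h2, h3⟩ := hj
  intro h
  obtain ⟨m, hm⟩ := Real.sin_eq_zero_iff.1 h
  have hN := three_mul_pos (N := N)
  have hm' : (m : ℝ) * (3 * N) = 2 * j := by
    have hpi := Real.pi_ne_zero
    have hN0 : (N : ℝ) ≠ 0 := by exact_mod_cast NeZero.ne N
    field_simp at hm
    linarith
  have h4 : m * (3 * N) = 2 * j := by exact_mod_cast hm'
  have h5 : (0 : ℤ) < m := by
    by_contra hc
    have : m * (3 * N) ≤ 0 := mul_nonpos_of_nonpos_of_nonneg (not_lt.1 hc) (by positivity)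
    omega
  have h6 : m < 2 := by
    by_contra hc
    have : 2 * (3 * N : ℤ) ≤ m * (3 * N) := mul_le_mul_of_nonneg_right (not_lt.1 hc) (by positivity)
    omega
  obtain rfl : m = 1 := by omega
  omega

theorem cheb_at_realSinSq_of_dvd {j : ℕ} (hj : j ∈ indexSet N) (h3 : 3 ∣ j) :
    chebT (1 - 2 * realSinSq N j) N = 1 ∧ chebU (1 - 2 * realSinSq N j) N = 0 := by
  obtain ⟨l, rfl⟩ := h3
  have hN := three_mul_pos (N := N)
  have hs := sin_two_mul_ne_zero hj
  rw [one_sub_realSinSq]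
  set θ : ℝ := 2 * (3 * l : ℕ) * Real.pi / (3 * N) with hθ
  have hT := chebT_cos θ N
  have hU := chebU_cos θ N
  have e : N * θ = (2 * l : ℕ) * Real.pi := by
    have : (N : ℝ) ≠ 0 := by exact_mod_cast NeZero.ne N
    rw [hθ]; push_cast; field_simp
  rw [e] at hT hU
  rw [Real.sin_nat_mul_pi] at hU
  refine ⟨?_, (mul_eq_zero.1 hU).resolve_left hs⟩
  rw [hT, Real.cos_nat_mul_pi, pow_mul]; norm_num

/-- The value of `T_N` is `cos(2jπ/3)`, which is `-1/2` when `3 ∤ j`. -/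
theorem cheb_at_realSinSq_of_not_dvd {j : ℕ} (h3 : ¬ 3 ∣ j) :
    1 + 2 * chebT (1 - 2 * realSinSq N j) N = 0 := by
  have hN : (N : ℝ) ≠ 0 := by exact_mod_cast NeZero.ne N
  rw [one_sub_realSinSq, chebT_cos]
  have e : N * (2 * j * Real.pi / (3 * N)) = 2 * (j * Real.pi / 3) := by field_simp
  rw [e, Real.cos_two_mul]
  have h1 : Real.sin (3 * (j * Real.pi / 3)) = 0 := by
    rw [← Real.sin_nat_mul_pi j]; congr 1; ring
  rw [Real.sin_three_mul] at h1
  have h2 := Real.sin_sq_add_cos_sq (j * Real.pi / 3)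
  have h4 : Real.sin (j * Real.pi / 3) ≠ 0 := by
    intro h
    obtain ⟨m, hm⟩ := Real.sin_eq_zero_iff.1 h
    have hpi := Real.pi_ne_zero
    field_simp at hm
    have : (3 : ℤ) ∣ j := ⟨m, by
      have : (j : ℝ) = 3 * m := by linarith
      exact_mod_cast this⟩
    exact h3 (by exact_mod_cast this)
  have h5 : Real.sin (j * Real.pi / 3) * (3 - 4 * Real.sin (j * Real.pi / 3) ^ 2) = 0 := by linarith
  have h6 := (mul_eq_zero.1 h5).resolve_left h4
  linarith

omit [NeZero N] in
theorem chebU_ne_zero_of_chebT {x : ℝ} (h : 1 + 2 * chebT x N = 0) : chebU x N ≠ 0 := by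
  intro hU
  have := cheb_pell x N
  rw [hU, show chebT x N = -1 / 2 by linarith] at this
  norm_num at this

/-- The zeros of the Chebyshev factor. -/
noncomputable def zeroFinset (N : ℕ) [NeZero N] : Finset ℝ :=
  (exists_zeros_chebFactor (NeZero.ne N)).choose

theorem card_zeroFinset : (zeroFinset N).card = N :=
  (exists_zeros_chebFactor (NeZero.ne N)).choose_spec.1

theorem mem_Ioo_of_mem_zeroFinset {z : ℝ} (hz : z ∈ zeroFinset N) : z ∈ Set.Ioo (0 : ℝ) (3 / 2) :=
  (exists_zeros_chebFactor (NeZero.ne N)).choose_spec.2.1 z hz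

theorem chebFactor_eq_zero_iff {w : ℂ} : chebFactor N w = 0 ↔ ∃ z ∈ zeroFinset N, (z : ℂ) = w :=
  (exists_zeros_chebFactor (NeZero.ne N)).choose_spec.2.2 w

theorem mem_zeroFinset_iff {z : ℝ} : z ∈ zeroFinset N ↔
    1 + 2 * chebT (1 - 2 * z) N + 2 * chebU (1 - 2 * z) N = 0 := by
  have h := chebFactor_eq_zero_iff (N := N) (w := z)
  rw [chebFactor_ofReal, Complex.ofReal_eq_zero] at h
  rw [h]
  simp

/-- The indices `1 ≤ j < 3N/2`. -/
def halfIndex (N : ℕ) : Finset ℕ := Finset.Ioc 0 ((3 * N - 1) / 2)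

/-- The points `sin²(jπ/(3N))` with `3 ∣ j`. -/
noncomputable def sinFinsetDvd (N : ℕ) : Finset ℝ :=
  ((halfIndex N).filter (3 ∣ ·)).image (realSinSq N)

/-- The points `sin²(jπ/(3N))` with `3 ∤ j`. -/
noncomputable def sinFinsetNotDvd (N : ℕ) : Finset ℝ :=
  ((halfIndex N).filter (¬ 3 ∣ ·)).image (realSinSq N)

omit [NeZero N] in
theorem mem_indexSet_of_mem_halfIndex {j : ℕ} (hj : j ∈ halfIndex N) : j ∈ indexSet N := by
  rw [halfIndex, Finset.mem_Ioc] at hj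
  refine ⟨by omega, by omega, by omega⟩

/-- The reflection `j ↦ 3N - j` fixes the squared sine and divisibility by three, so each point has
a representative below `3N/2`. -/
theorem exists_halfIndex {j : ℕ} (hj : j ∈ indexSet N) :
    ∃ i ∈ halfIndex N, realSinSq N i = realSinSq N j ∧ (3 ∣ i ↔ 3 ∣ j) := by
  obtain ⟨h1, h2, h3⟩ := hj
  simp only [halfIndex, Finset.mem_Ioc]
  by_cases h : 2 * j < 3 * N
  · exact ⟨j, by omega, rfl, Iff.rfl⟩
  · refine ⟨3 * N - j, by omega, ?_, by omega⟩
    have hN : (N : ℝ) ≠ 0 := by exact_mod_cast NeZero.ne N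
    rw [realSinSq, realSinSq, Nat.cast_sub (by omega), ← Real.sin_pi_sub]
    congr 2
    push_cast
    field_simp
    ring

theorem mem_sinFinsetDvd_iff {z : ℝ} :
    z ∈ sinFinsetDvd N ↔ ∃ j ∈ indexSet N, 3 ∣ j ∧ realSinSq N j = z := by
  simp only [sinFinsetDvd, Finset.mem_image, Finset.mem_filter]
  constructor
  · rintro ⟨j, ⟨h1, h2⟩, h3⟩
    exact ⟨j, mem_indexSet_of_mem_halfIndex h1, h2, h3⟩
  · rintro ⟨j, h1, h2, h3⟩
    obtain ⟨i, hi1, hi2, hi3⟩ := exists_halfIndex h1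
    exact ⟨i, ⟨hi1, hi3.2 h2⟩, hi2.trans h3⟩

theorem mem_sinFinsetNotDvd_iff {z : ℝ} :
    z ∈ sinFinsetNotDvd N ↔ ∃ j ∈ indexSet N, ¬ 3 ∣ j ∧ realSinSq N j = z := by
  simp only [sinFinsetNotDvd, Finset.mem_image, Finset.mem_filter]
  constructor
  · rintro ⟨j, ⟨h1, h2⟩, h3⟩
    exact ⟨j, mem_indexSet_of_mem_halfIndex h1, h2, h3⟩
  · rintro ⟨j, h1, h2, h3⟩
    obtain ⟨i, hi1, hi2, hi3⟩ := exists_halfIndex h1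
    exact ⟨i, ⟨hi1, fun h => h2 (hi3.1 h)⟩, hi2.trans h3⟩

theorem realSinSq_injOn : Set.InjOn (realSinSq N) (halfIndex N) := by
  intro i hi j hj h
  have key : ∀ k ∈ halfIndex N, 0 ≤ (k : ℝ) * Real.pi / (3 * N) ∧
      (k : ℝ) * Real.pi / (3 * N) < Real.pi / 2 := by
    intro k hk
    rw [halfIndex, Finset.mem_Ioc] at hk
    have hN := three_mul_pos (N := N)
    have hpi := Real.pi_pos
    refine ⟨by positivity, ?_⟩
    have h1 : 2 * k < 3 * N := by omega
    have h2 : (2 * k : ℝ) < 3 * N := by exact_mod_cast h1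
    rw [div_lt_iff₀ hN]
    nlinarith
  obtain ⟨i1, i2⟩ := key i hi
  obtain ⟨j1, j2⟩ := key j hj
  have hpi := Real.pi_pos
  have h1 := (sq_eq_sq₀ (Real.sin_nonneg_of_nonneg_of_le_pi i1 (by linarith))
    (Real.sin_nonneg_of_nonneg_of_le_pi j1 (by linarith))).1 h
  have h2 := Real.injOn_sin ⟨by linarith, i2.le⟩ ⟨by linarith, j2.le⟩ h1
  have hN0 : (N : ℝ) ≠ 0 := by exact_mod_cast NeZero.ne N
  field_simp at h2
  exact_mod_cast h2

theorem card_sinFinsetDvd : (sinFinsetDvd N).card = (3 * N - 1) / 2 / 3 := by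
  rw [sinFinsetDvd, Finset.card_image_of_injOn (realSinSq_injOn.mono (Finset.filter_subset _ _)),
    halfIndex, Nat.Ioc_filter_dvd_card_eq_div]

theorem card_sinFinsetNotDvd :
    (sinFinsetNotDvd N).card = (3 * N - 1) / 2 - (3 * N - 1) / 2 / 3 := by
  rw [sinFinsetNotDvd, Finset.card_image_of_injOn (realSinSq_injOn.mono (Finset.filter_subset _ _))]
  have h1 := Finset.card_filter_add_card_filter_not (s := halfIndex N) (3 ∣ ·)
  have h2 : ((halfIndex N).filter (3 ∣ ·)).card = (3 * N - 1) / 2 / 3 := by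
    rw [halfIndex, Nat.Ioc_filter_dvd_card_eq_div]
  have h3 : (halfIndex N).card = (3 * N - 1) / 2 := by simp [halfIndex]
  omega

/-- The mass of a point of the initial set, in units of `1 / (3N (6N - 3))`. -/
noncomputable def weight (N : ℕ) [NeZero N] (z : ℝ) : ℕ :=
  (if z ∈ zeroFinset N then 1 else 0) + (if z ∈ sinFinsetNotDvd N then 3 * N - 2 else 0) +
    (if z ∈ sinFinsetDvd N then 3 * N - 1 else 0)

theorem weight_cases {z : ℝ} (h : weight N z ≠ 0) :
    z ∈ zeroFinset N ∨ z ∈ sinFinsetNotDvd N ∨ z ∈ sinFinsetDvd N := by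
  by_contra! hc
  obtain ⟨h1, h2, h3⟩ := hc
  simp [weight, h1, h2, h3] at h

theorem cheb_of_mem_sinFinsetNotDvd {z : ℝ} (hz : z ∈ sinFinsetNotDvd N) :
    1 + 2 * chebT (1 - 2 * z) N = 0 := by
  obtain ⟨j, -, h, rfl⟩ := mem_sinFinsetNotDvd_iff.1 hz
  exact cheb_at_realSinSq_of_not_dvd h

theorem cheb_of_mem_sinFinsetDvd {z : ℝ} (hz : z ∈ sinFinsetDvd N) :
    chebT (1 - 2 * z) N = 1 ∧ chebU (1 - 2 * z) N = 0 := by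
  obtain ⟨j, h1, h, rfl⟩ := mem_sinFinsetDvd_iff.1 hz
  exact cheb_at_realSinSq_of_dvd h1 h

theorem weight_of_mem_zeroFinset {z : ℝ} (hz : z ∈ zeroFinset N) : weight N z = 1 := by
  have h0 := mem_zeroFinset_iff.1 hz
  have h1 : z ∉ sinFinsetNotDvd N := by
    intro h
    have h2 := cheb_of_mem_sinFinsetNotDvd h
    exact chebU_ne_zero_of_chebT h2 (by linarith)
  have h2 : z ∉ sinFinsetDvd N := by
    intro h
    obtain ⟨h3, h4⟩ := cheb_of_mem_sinFinsetDvd h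
    rw [h3, h4] at h0
    norm_num at h0
  simp [weight, hz, h1, h2]

theorem weight_of_mem_sinFinsetNotDvd {z : ℝ} (hz : z ∈ sinFinsetNotDvd N) :
    weight N z = 3 * N - 2 := by
  have h2 := cheb_of_mem_sinFinsetNotDvd hz
  have h1 : z ∉ zeroFinset N := by
    intro h
    have h0 := mem_zeroFinset_iff.1 h
    exact chebU_ne_zero_of_chebT h2 (by linarith)
  have h3 : z ∉ sinFinsetDvd N := by
    intro h
    obtain ⟨h3, -⟩ := cheb_of_mem_sinFinsetDvd h
    rw [h3] at h2
    norm_num at h2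
  simp [weight, hz, h1, h3]

theorem weight_of_mem_sinFinsetDvd {z : ℝ} (hz : z ∈ sinFinsetDvd N) :
    weight N z = 3 * N - 1 := by
  obtain ⟨h3, h4⟩ := cheb_of_mem_sinFinsetDvd hz
  have h1 : z ∉ zeroFinset N := by
    intro h
    have h0 := mem_zeroFinset_iff.1 h
    rw [h3, h4] at h0
    norm_num at h0
  have h2 : z ∉ sinFinsetNotDvd N := by
    intro h
    have h0 := cheb_of_mem_sinFinsetNotDvd h
    rw [h3] at h0
    norm_num at h0
  simp [weight, hz, h1, h2]

theorem mem_Ioo_of_weight_ne_zero {z : ℝ} (h : weight N z ≠ 0) : z ∈ Set.Ioo (0 : ℝ) (3 / 2) := by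
  rcases weight_cases h with h | h | h
  · exact mem_Ioo_of_mem_zeroFinset h
  · obtain ⟨j, h1, -, rfl⟩ := mem_sinFinsetNotDvd_iff.1 h
    exact realSinSq_mem_Ioo h1
  · obtain ⟨j, h1, -, rfl⟩ := mem_sinFinsetDvd_iff.1 h
    exact realSinSq_mem_Ioo h1

omit [NeZero N] in
theorem realR_of_chebT {z : ℝ} (h : 1 + 2 * chebT (1 - 2 * z) N = 0) : realR N z = 3 / 2 := by
  have hU := chebU_ne_zero_of_chebT h
  rw [realR, h, show chebT (1 - 2 * z) N = -1 / 2 by linarith]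
  field_simp
  ring

/-- Zeros of `C` go to `0`, points with `3 ∤ j` go to `3/2`, and points with `3 ∣ j` are sent to the
default value `0`, the denominator being zero there. -/
theorem realR_notMem_of_weight_ne_zero {z : ℝ} (h : weight N z ≠ 0) :
    realR N z ∉ Set.Ioo (0 : ℝ) (3 / 2) := by
  rcases weight_cases h with h | h | h
  · simp [realR, mem_zeroFinset_iff.1 h]
  · simp [realR_of_chebT (cheb_of_mem_sinFinsetNotDvd h)]
  · simp [realR, (cheb_of_mem_sinFinsetDvd h).2]

theorem mem_Ioo_of_weight_iterate_ne_zero {m : ℕ} {z : ℝ} (h : weight N ((realR N)^[m] z) ≠ 0) :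
    z ∈ Set.Ioo (0 : ℝ) (3 / 2) := by
  induction m generalizing z with
  | zero => exact mem_Ioo_of_weight_ne_zero h
  | succ m ih => exact mem_Ioo_of_realR_mem (NeZero.ne N) (ih h)

/-- Preimages of the open interval stay in it, while an initial point is thrown out at the next
step. An orbit therefore meets the initial set at most once. -/
theorem iterate_unique {m m' : ℕ} {z : ℝ} (h : weight N ((realR N)^[m] z) ≠ 0)
    (h' : weight N ((realR N)^[m'] z) ≠ 0) : m = m' := by
  have key : ∀ {m m' : ℕ}, weight N ((realR N)^[m] z) ≠ 0 → weight N ((realR N)^[m'] z) ≠ 0 →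
      m' ≤ m := by
    intro m m' h h'
    by_contra! hlt
    obtain ⟨k, rfl⟩ := Nat.exists_eq_add_of_lt hlt
    rw [show m + k + 1 = (k + 1) + m by ring, Function.iterate_add_apply, Function.iterate_succ_apply] at h'
    exact realR_notMem_of_weight_ne_zero h (mem_Ioo_of_weight_iterate_ne_zero h')
  exact le_antisymm (key h' h) (key h h')

open scoped ENNReal

/-- The factor `3N - (⌊3N/2⌋ + 1)` is what the geometric series over iterated preimages must cancel
for the total mass to be one. -/
theorem tsum_weight : ∑' z, (weight N z : ℝ≥0∞) =
    ((3 * N - 1) * (3 * N - (3 * N / 2 + 1)) : ℕ) := by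
  have key : ∀ (s : Finset ℝ) (c : ℕ), ∑' z, (((if z ∈ s then c else 0 : ℕ)) : ℝ≥0∞) = (s.card * c : ℕ) := by
    intro s c
    rw [tsum_eq_sum (s := s) (fun z hz => by simp [hz])]
    rw [Finset.sum_congr rfl fun z hz => by rw [if_pos hz], Finset.sum_const]
    simp
  simp only [weight, Nat.cast_add]
  rw [ENNReal.tsum_add, ENNReal.tsum_add, key, key, key, card_zeroFinset, card_sinFinsetDvd,
    card_sinFinsetNotDvd, ← Nat.cast_add, ← Nat.cast_add]
  congr 1
  have hN := NeZero.pos N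
  rcases Nat.even_or_odd' N with ⟨k, rfl | rfl⟩
  · obtain ⟨k, rfl⟩ : ∃ l, k = l + 1 := ⟨k - 1, by omega⟩
    rw [show (3 * (2 * (k + 1)) - 1) / 2 = 3 * k + 2 by omega, show (3 * k + 2) / 3 = k by omega,
      show 3 * k + 2 - k = 2 * k + 2 by omega, show 3 * (2 * (k + 1)) - 2 = 6 * k + 4 by omega,
      show 3 * (2 * (k + 1)) - 1 = 6 * k + 5 by omega,
      show 3 * (2 * (k + 1)) - (3 * (2 * (k + 1)) / 2 + 1) = 3 * k + 2 by omega]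
    ring
  · rw [show (3 * (2 * k + 1) - 1) / 2 = 3 * k + 1 by omega, show (3 * k + 1) / 3 = k by omega,
      show 3 * k + 1 - k = 2 * k + 1 by omega, show 3 * (2 * k + 1) - 2 = 6 * k + 1 by omega,
      show 3 * (2 * k + 1) - 1 = 6 * k + 2 by omega,
      show 3 * (2 * k + 1) - (3 * (2 * k + 1) / 2 + 1) = 3 * k + 1 by omega]
    ring

/-- The sum is grouped by the fibres of `realR`, all of the same size over the support of `f`. -/
theorem tsum_comp_realR {f : ℝ → ℝ≥0∞} (hf : ∀ y, f y ≠ 0 → y ∈ Set.Ioo (0 : ℝ) (3 / 2)) :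
    ∑' z, f (realR N z) = (3 * N / 2 + 1 : ℕ) * ∑' y, f y := by
  rw [← (Equiv.sigmaFiberEquiv (realR N)).tsum_eq, ENNReal.tsum_sigma', ← ENNReal.tsum_mul_left]
  refine tsum_congr fun y => ?_
  have h1 : ∀ z : {z // realR N z = y}, f (realR N (Equiv.sigmaFiberEquiv (realR N) ⟨y, z⟩)) = f y := by
    rintro ⟨z, hz⟩
    exact congrArg f hz
  rw [tsum_congr h1]
  by_cases hy : f y = 0
  · simp [hy]
  · obtain ⟨s, hs1, -, hs2⟩ := exists_fiber_realR (NeZero.ne N) (hf y hy).1 (hf y hy).2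
    rw [← (Equiv.subtypeEquivRight hs2).symm.tsum_eq, Finset.tsum_subtype s (fun _ => f y),
      Finset.sum_const, hs1, nsmul_eq_mul]

theorem tsum_weight_iterate (m : ℕ) : ∑' z, (weight N ((realR N)^[m] z) : ℝ≥0∞) =
    (3 * N / 2 + 1 : ℕ) ^ m * ((3 * N - 1) * (3 * N - (3 * N / 2 + 1)) : ℕ) := by
  induction m with
  | zero => simpa using tsum_weight
  | succ m ih =>
    simp only [Function.iterate_succ_apply]
    rw [tsum_comp_realR (f := fun z => (weight N ((realR N)^[m] z) : ℝ≥0∞)), ih, pow_succ']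
    · ring
    · intro y hy
      exact mem_Ioo_of_weight_iterate_ne_zero (by exact_mod_cast hy)

end

end Gasket

/-! ### Asymptotic lower bounds for the point masses, and convergence in `ℓ¹` -/

namespace Gasket

open Filter Topology

section Multiplicity

variable {N : ℕ} [NeZero N]

omit [NeZero N] in
-- Otherwise `U_{N-1} = -3/2`, Pell forces `x² = 1`, hence `x = -1`, where `U_{N-1}` is `±N`. But
-- `3/2` is not an integer.
theorem chebT_ne_one {z : ℝ} (h0 : z ≠ 0)
    (hC : 1 + 2 * chebT (1 - 2 * z) N + 2 * chebU (1 - 2 * z) N = 0) :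
    chebT (1 - 2 * z) N ≠ 1 := by
  intro hT
  have hU : chebU (1 - 2 * z) N = -3 / 2 := by linarith
  have h1 := cheb_pell (1 - 2 * z) N
  rw [hT, hU] at h1
  have h2 : z * (1 - z) = 0 := by linarith
  obtain rfl : z = 1 := by
    have := (mul_eq_zero.1 h2).resolve_left h0
    linarith
  rw [show (1 - 2 * 1 : ℝ) = -1 by norm_num, (cheb_neg_arg (1 : ℝ) N).2] at hU
  have h3 : chebU (1 : ℝ) N = N := by simp [chebU, Polynomial.Chebyshev.U_eval_one]
  rw [h3] at hU
  rcases neg_one_pow_eq_or ℝ N with h | h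
  · rw [h] at hU
    have : (2 * N : ℝ) = (3 : ℕ) := by push_cast; linarith
    have : 2 * N = 3 := by exact_mod_cast this
    omega
  · rw [h] at hU
    have : (2 * N : ℝ) + (3 : ℕ) = 0 := by push_cast; linarith
    have : 2 * N + 3 = 0 := by exact_mod_cast this
    omega

theorem le_mult_three_halves (n : ℕ) :
    (3 * N - 2) * (3 * N : ℝ) ^ n + 3 * N ≤ (3 * N - 1) * mult N n (3 / 2) := by
  have h1 : (Fintype.card (V N n) : ℝ) ≤ mult N n (3 / 2) + (3 * N) ^ n := by
    exact_mod_cast card_V_le_mult_three_halves (N := N) (n := n)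
  have h2 := card_V (N := N) n
  have h3 : (1 : ℝ) ≤ N := by exact_mod_cast NeZero.one_le
  nlinarith [mul_le_mul_of_nonneg_left h1 (show (0 : ℝ) ≤ 3 * N - 1 by linarith)]

/-- The three dimension bounds are multiplied by `3N - 1` and `card_V` eliminates the number of
vertices. The loss `3N` does not depend on `n`, so it disappears in the limit. -/
theorem weight_mul_le_mult_succ {z : ℝ} (hz : weight N z ≠ 0) (n : ℕ) :
    weight N z * (3 * N : ℝ) ^ n - 3 * N ≤ (3 * N - 1) * mult N (n + 1) z := by
  have h2 := card_V (N := N) n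
  have h3 : (1 : ℝ) ≤ N := by exact_mod_cast NeZero.one_le
  have h3' : (0 : ℝ) ≤ 3 * N - 1 := by linarith
  obtain ⟨hz0, hz1⟩ := mem_Ioo_of_weight_ne_zero hz
  rcases weight_cases hz with h | h | h
  · have hC := mem_zeroFinset_iff.1 h
    have h1 : (2 * (3 * N) ^ n : ℝ) ≤ mult N (n + 1) z + Fintype.card (V N n) := by
      exact_mod_cast two_mul_card_word_le_mult_succ (n := n) rfl hz1.ne (chebT_ne_one hz0.ne' hC) hC
    rw [weight_of_mem_zeroFinset h]
    push_cast
    nlinarith [mul_le_mul_of_nonneg_left h1 h3']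
  · have h1 : (Fintype.card (V N n) : ℝ) ≤ mult N (n + 1) z + (3 * N) ^ n := by
      exact_mod_cast card_V_le_mult_succ_of_chebT (n := n) rfl (cheb_of_mem_sinFinsetNotDvd h)
    have hN := NeZero.pos N
    rw [weight_of_mem_sinFinsetNotDvd h, Nat.cast_sub (by omega)]
    push_cast
    nlinarith [mul_le_mul_of_nonneg_left h1 h3']
  · obtain ⟨hT, hU⟩ := cheb_of_mem_sinFinsetDvd h
    have h1 : ((3 * N) ^ n : ℝ) ≤ mult N (n + 1) z := by
      exact_mod_cast card_word_le_mult_succ (n := n) rfl hT hU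
    have hN := NeZero.pos N
    rw [weight_of_mem_sinFinsetDvd h, Nat.cast_sub (by omega)]
    push_cast
    nlinarith [mul_le_mul_of_nonneg_left h1 h3']

omit [NeZero N] in
theorem realR_mul_chebU {z : ℝ} (h : realR N z ≠ 0) :
    chebU (1 - 2 * z) N ≠ 0 ∧ 2 * realR N z * chebU (1 - 2 * z) N =
      (1 - chebT (1 - 2 * z) N) * (1 + 2 * chebT (1 - 2 * z) N + 2 * chebU (1 - 2 * z) N) := by
  have hU : chebU (1 - 2 * z) N ≠ 0 := by
    intro hU
    simp [realR, hU] at h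
  refine ⟨hU, ?_⟩
  rw [realR]
  field_simp

theorem mult_realR_le_mult_succ {z : ℝ} (h : realR N z ∈ Set.Ioo (0 : ℝ) (3 / 2)) (n : ℕ) :
    mult N n (realR N z) ≤ mult N (n + 1) z := by
  obtain ⟨hU, hR⟩ := realR_mul_chebU h.1.ne'
  exact mult_le_mult_succ rfl h.1.ne' h.2.ne hU (fun hT => h.2.ne (realR_of_chebT hT)) hR

/-- Eigenfunctions are born at level `n + 1` for the initial point and pulled back `m` times by
decimation; each intermediate point stays in `(0, 3/2)`, where decimation applies. -/
theorem weight_iterate_mul_le_mult {m : ℕ} {z : ℝ} (hz : weight N ((realR N)^[m] z) ≠ 0) (n : ℕ) :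
    weight N ((realR N)^[m] z) * (3 * N : ℝ) ^ n - 3 * N ≤ (3 * N - 1) * mult N (n + (m + 1)) z := by
  induction m generalizing z with
  | zero => exact weight_mul_le_mult_succ hz n
  | succ m ih =>
    have h3 : (1 : ℝ) ≤ N := by exact_mod_cast NeZero.one_le
    refine (ih (z := realR N z) hz).trans (mul_le_mul_of_nonneg_left ?_ (by linarith))
    exact_mod_cast mult_realR_le_mult_succ (mem_Ioo_of_weight_iterate_ne_zero (m := m) hz) _

/-- The mass which `kappaN N n` gives to a point. -/
noncomputable def massN (N : ℕ) [NeZero N] (n : ℕ) (z : ℝ) : ℝ :=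
  (mult N n z : ℝ) * (3 * N - 1) / (3 * N + (6 * N - 3) * (3 * N) ^ n)

theorem volume_pos (n : ℕ) : (0 : ℝ) < 3 * N + (6 * N - 3) * (3 * N) ^ n := by
  have h3 : (1 : ℝ) ≤ N := by exact_mod_cast NeZero.one_le
  have : (0 : ℝ) < 6 * N - 3 := by linarith
  positivity

theorem massN_nonneg (n : ℕ) (z : ℝ) : 0 ≤ massN N n z := by
  have h3 : (1 : ℝ) ≤ N := by exact_mod_cast NeZero.one_le
  exact div_nonneg (mul_nonneg (Nat.cast_nonneg _) (by linarith)) (volume_pos n).le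

theorem massN_eq_zero {n : ℕ} {z : ℝ}
    (hz : z ∉ (laplacian N n).finite_hasEigenvalue.toFinset) : massN N n z = 0 := by
  have : (laplacian N n).eigenspace z = ⊥ := by
    by_contra h
    exact hz ((Set.Finite.mem_toFinset _).2 (Module.End.hasEigenvalue_iff.2 h))
  simp [massN, mult, this]

theorem hasSum_massN (n : ℕ) : HasSum (massN N n) 1 := by
  have h : HasSum (massN N n) (∑ z ∈ (laplacian N n).finite_hasEigenvalue.toFinset, massN N n z) :=
    hasSum_sum_of_ne_finset_zero fun z hz => massN_eq_zero hz
  convert h using 1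
  have h1 : ∑ z ∈ (laplacian N n).finite_hasEigenvalue.toFinset, (mult N n z : ℝ) =
      Fintype.card (V N n) := by exact_mod_cast sum_mult (N := N) (n := n)
  simp only [massN]
  rw [← Finset.sum_div, ← Finset.sum_mul, h1, mul_comm, card_V, div_self (volume_pos n).ne']

theorem tendsto_ratio (a b : ℝ) (k : ℕ) :
    Tendsto (fun n : ℕ => (b * (3 * N : ℝ) ^ n + a) / (3 * N + (6 * N - 3) * (3 * N) ^ (n + k))) atTop
      (𝓝 (b / ((6 * N - 3) * (3 * N) ^ k))) := by
  have h3 : (1 : ℝ) ≤ N := by exact_mod_cast NeZero.one_le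
  have h6 : (6 * N - 3 : ℝ) ≠ 0 := by linarith
  have hN : (3 * N : ℝ) ≠ 0 := by linarith
  have hp : Tendsto (fun n : ℕ => ((3 * N : ℝ) ^ n)⁻¹) atTop (𝓝 0) :=
    (tendsto_pow_atTop_atTop_of_one_lt (by linarith)).inv_tendsto_atTop
  have h1 : Tendsto (fun n : ℕ => (b + a * ((3 * N : ℝ) ^ n)⁻¹) /
      (3 * N * ((3 * N : ℝ) ^ n)⁻¹ + (6 * N - 3) * (3 * N) ^ k)) atTop
      (𝓝 ((b + a * 0) / (3 * N * 0 + (6 * N - 3) * (3 * N) ^ k))) :=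
    (tendsto_const_nhds.add (hp.const_mul a)).div ((hp.const_mul _).add tendsto_const_nhds)
      (by simpa using ⟨h6, fun h => absurd h (NeZero.ne N)⟩)
  rw [mul_zero, mul_zero, add_zero, zero_add] at h1
  refine h1.congr fun n => ?_
  have hn : (3 * N : ℝ) ^ n ≠ 0 := pow_ne_zero _ hN
  rw [← mul_div_mul_right _ _ hn]
  congr 1
  · field_simp
  · rw [add_mul, mul_assoc (3 * (N : ℝ)), inv_mul_cancel₀ hn]; ring

end Multiplicity

/-- Nonnegative sequences of total mass one which pointwise are eventually bounded below by
sequences converging to `c`, also of total mass one, converge to `c` in `ℓ¹`. -/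
theorem tendsto_tsum_abs_sub {α : Type*} {a : ℕ → α → ℝ} {c : α → ℝ} (ha0 : ∀ n z, 0 ≤ a n z)
    (ha : ∀ n, HasSum (a n) 1) (hc0 : ∀ z, 0 ≤ c z) (hc : HasSum c 1)
    (h : ∀ z, ∃ b : ℕ → ℝ, ∃ k, Tendsto b atTop (𝓝 (c z)) ∧ ∀ n, b n ≤ a (n + k) z) :
    Tendsto (fun n => ∑' z, |c z - a n z|) atTop (𝓝 0) := by
  have h1 : ∀ n z, ‖max (c z - a n z) 0‖ ≤ c z := fun n z => by
    rw [Real.norm_of_nonneg (le_max_right _ _)]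
    exact max_le (by linarith [ha0 n z]) (hc0 z)
  have h2 : ∀ z, Tendsto (fun n => max (c z - a n z) 0) atTop (𝓝 0) := by
    intro z
    obtain ⟨b, k, hb, hba⟩ := h z
    rw [← tendsto_add_atTop_iff_nat k]
    have h3 : Tendsto (fun n => max (c z - b n) 0) atTop (𝓝 0) := by
      simpa using (hb.const_sub (c z)).max (tendsto_const_nhds (x := (0 : ℝ)))
    exact squeeze_zero (fun n => le_max_right _ _)
      (fun n => max_le_max (by linarith [hba n]) le_rfl) h3
  have h3 := tendsto_tsum_of_dominated_convergence hc.summable h2 (Eventually.of_forall h1)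
  rw [tsum_zero] at h3
  -- Equal total masses make the positive and negative parts of the difference equally large, and
  -- the positive part is dominated by `c`.
  have h4 : ∀ n, ∑' z, |c z - a n z| = 2 * ∑' z, max (c z - a n z) 0 := by
    intro n
    have hs : Summable fun z => max (c z - a n z) 0 :=
      Summable.of_norm_bounded hc.summable (h1 n)
    have h5 : ∀ z, |c z - a n z| = 2 * max (c z - a n z) 0 - (c z - a n z) := by
      intro z
      rcases le_total (c z - a n z) 0 with h | h
      · rw [abs_of_nonpos h, max_eq_right h]; ring
      · rw [abs_of_nonneg h, max_eq_left h]; ring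
    have h6 := (hs.hasSum.mul_left 2).sub (hc.sub (ha n))
    rw [tsum_congr h5, h6.tsum_eq]
    ring
  simpa [h4] using h3.const_mul 2

/-! ### From point masses to measures -/

section Measure

open MeasureTheory

variable {N : ℕ} [NeZero N]

theorem integral_kappaN (n : ℕ) (f : ℝ → ℝ) :
    ∫ x, f x ∂(kappaN N n : Measure ℝ) = ∑' z, massN N n z * f z := by
  rw [tsum_eq_sum (s := (laplacian N n).finite_hasEigenvalue.toFinset)
    (fun z hz => by rw [massN_eq_zero hz, zero_mul]), kappaN, FiniteMeasure.toMeasure_sum,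
    integral_finsetSum_measure]
  · refine Finset.sum_congr rfl fun z _ => ?_
    rw [FiniteMeasure.toMeasure_smul]
    change ∫ x, f x ∂(Real.toNNReal (massN N n z) • Measure.dirac z) = _
    rw [integral_smul_nnreal_measure, integral_dirac, NNReal.smul_def,
      Real.coe_toNNReal _ (massN_nonneg n z), smul_eq_mul]
  · intro z _
    rw [FiniteMeasure.toMeasure_smul]
    exact Integrable.smul_measure_nnreal (integrable_dirac (by simp))

theorem kappaN_real_singleton (n : ℕ) (x : ℝ) :
    (kappaN N n : Measure ℝ).real {x} = massN N n x := by
  rw [← integral_indicator_one (measurableSet_singleton x),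
    integral_kappaN,
    tsum_eq_single x (fun z hz => by simp [hz])]
  simp

theorem isProbabilityMeasure_kappaN (n : ℕ) :
    IsProbabilityMeasure (kappaN N n : Measure ℝ) := by
  have h := integral_kappaN (N := N) n fun _ => 1
  simp only [mul_one, (hasSum_massN n).tsum_eq, integral_const, smul_eq_mul] at h
  constructor
  rw [measureReal_def, ENNReal.toReal_eq_one_iff] at h
  exact h

/-- If the point masses of `kappaN` converge in `ℓ¹`, then `kappaN` converges weakly. -/
theorem tendsto_kappaN {p : PMF ℝ} {κ : ProbabilityMeasure ℝ} (hκ : (κ : Measure ℝ) = p.toMeasure)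
    (h : Tendsto (fun n => ∑' z, |(p z).toReal - massN N n z|) atTop (𝓝 0)) :
    Tendsto (fun n => kappaN N n) atTop (𝓝 κ.toFiniteMeasure) := by
  rw [FiniteMeasure.tendsto_iff_forall_integral_tendsto]
  intro f
  have hp : Summable fun z => (p z).toReal := ENNReal.summable_toReal p.tsum_coe_ne_top
  have h1 : ∫ x, f x ∂p.toMeasure = ∑' z, (p z).toReal * f z :=
    PMF.integral_eq_tsum p f (f.integrable _)
  change Tendsto _ _ (𝓝 (∫ x, f x ∂(κ : Measure ℝ)))
  rw [hκ]
  have hbd : ∀ {g : ℝ → ℝ}, Summable g → Summable fun z => g z * f z := fun hg =>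
    Summable.of_norm_bounded (hg.norm.mul_right ‖f‖) fun z => by
      rw [norm_mul]
      exact mul_le_mul_of_nonneg_left (f.norm_coe_le_norm z) (norm_nonneg _)
  rw [h1, tendsto_iff_dist_tendsto_zero]
  refine squeeze_zero (fun _ => dist_nonneg) (fun n => ?_) (by simpa using h.mul_const ‖f‖)
  have hd := hp.sub (hasSum_massN (N := N) n).summable
  rw [integral_kappaN, dist_comm, Real.dist_eq,
    ← (hbd hp).tsum_sub (hbd (hasSum_massN n).summable), ← tsum_mul_right]
  have hs := ((hbd hp).sub (hbd (hasSum_massN (N := N) n).summable)).norm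
  refine (norm_tsum_le_tsum_norm hs).trans
    (Summable.tsum_le_tsum (fun z => ?_) hs (hd.abs.mul_right _))
  rw [← sub_mul, norm_mul]
  exact mul_le_mul_of_nonneg_left (f.norm_coe_le_norm z) (norm_nonneg _)

theorem tendsto_massN_of_tsum {p : PMF ℝ}
    (h : Tendsto (fun n => ∑' z, |(p z).toReal - massN N n z|) atTop (𝓝 0)) (x : ℝ) :
    Tendsto (fun n => massN N n x) atTop (𝓝 (p x).toReal) := by
  have hp : Summable fun z => (p z).toReal := ENNReal.summable_toReal p.tsum_coe_ne_top
  rw [tendsto_iff_dist_tendsto_zero]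
  refine squeeze_zero (fun _ => dist_nonneg) (fun n => ?_) h
  rw [dist_comm, Real.dist_eq]
  exact (hp.sub (hasSum_massN n).summable).abs.le_tsum x fun _ _ => abs_nonneg _

end Measure

end Gasket

/-! ### The limit measure: total mass, values and atoms -/

namespace Gasket

open Filter Topology
open scoped ENNReal

section

variable {N : ℕ} [NeZero N]

/-- The point masses of the integrated density of states. -/
noncomputable def limitMass (N : ℕ) [NeZero N] (z : ℝ) : ℝ≥0∞ :=
  (if z = 3 / 2 then ENNReal.ofReal ((3 * N - 2) / (6 * N - 3)) else 0) +
    ∑' m : ℕ, (weight N ((realR N)^[m] z) : ℝ≥0∞) *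
      ENNReal.ofReal (((6 * N - 3) * (3 * N : ℝ) ^ (m + 1))⁻¹)

theorem tsum_weight_mul :
    ∑' m : ℕ, (∑' z, (weight N ((realR N)^[m] z) : ℝ≥0∞)) *
      ENNReal.ofReal (((6 * N - 3) * (3 * N : ℝ) ^ (m + 1))⁻¹) =
    ENNReal.ofReal ((3 * N - 1) / (6 * N - 3)) := by
  have h3 : (1 : ℝ) ≤ N := by exact_mod_cast NeZero.one_le
  have h6 : (0 : ℝ) < 6 * N - 3 := by linarith
  have hN : (0 : ℝ) < 3 * N := by linarith
  have hpos := NeZero.pos N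
  have hd : 3 * N / 2 + 1 < 3 * N := by omega
  set d := 3 * N / 2 + 1 with hd_def
  have hd' : (d : ℝ) < 3 * N := by exact_mod_cast hd
  have hr1 : (d : ℝ) / (3 * N) < 1 := (div_lt_one hN).2 hd'
  have hr0 : 0 ≤ (d : ℝ) / (3 * N) := by positivity
  have hW : (((3 * N - 1) * (3 * N - d) : ℕ) : ℝ) = (3 * N - 1) * (3 * N - d) := by
    rw [Nat.cast_mul, Nat.cast_sub (by omega), Nat.cast_sub hd.le]
    push_cast
    rfl
  have hc : (0 : ℝ) ≤ (3 * N - 1) * (3 * N - d) / ((6 * N - 3) * (3 * N)) :=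
    div_nonneg (mul_nonneg (by linarith) (by linarith)) (by positivity)
  have hterm : ∀ m : ℕ, (∑' z, (weight N ((realR N)^[m] z) : ℝ≥0∞)) *
      ENNReal.ofReal (((6 * N - 3) * (3 * N : ℝ) ^ (m + 1))⁻¹) =
      ENNReal.ofReal ((3 * N - 1) * (3 * N - d) / ((6 * N - 3) * (3 * N)) * (d / (3 * N)) ^ m) := by
    intro m
    rw [tsum_weight_iterate, ← hd_def, ← Nat.cast_pow, ← Nat.cast_mul, ← ENNReal.ofReal_natCast,
      ← ENNReal.ofReal_mul (Nat.cast_nonneg _), Nat.cast_mul, hW]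
    congr 1
    rw [Nat.cast_pow, div_pow, pow_succ]
    field_simp
  rw [tsum_congr hterm, ← ENNReal.ofReal_tsum_of_nonneg
    (fun m => mul_nonneg hc (pow_nonneg hr0 m))
    ((summable_geometric_of_lt_one hr0 hr1).mul_left _), tsum_mul_left,
    tsum_geometric_of_lt_one hr0 hr1]
  congr 1
  have h7 : (3 * N - d : ℝ) ≠ 0 := by linarith
  have h8 : 1 - (d : ℝ) / (3 * N) = (3 * N - d) / (3 * N) := by field_simp
  rw [h8, inv_div]
  field_simp

/-- This identity replaces all upper bounds for multiplicities: the masses `(3N-2)/(6N-3)` and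
`(3N-1)/(6N-3)` leave nothing for further eigenvalues. -/
theorem tsum_limitMass : ∑' z, limitMass N z = 1 := by
  have h3 : (1 : ℝ) ≤ N := by exact_mod_cast NeZero.one_le
  have h6 : (0 : ℝ) < 6 * N - 3 := by linarith
  simp only [limitMass]
  rw [ENNReal.tsum_add, tsum_ite_eq, ENNReal.tsum_comm]
  simp only [ENNReal.tsum_mul_right]
  rw [tsum_weight_mul, ← ENNReal.ofReal_add (div_nonneg (by linarith) h6.le)
    (div_nonneg (by linarith) h6.le), ← add_div, show (3 * N - 2 + (3 * N - 1) : ℝ) = 6 * N - 3 by ring,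
    div_self h6.ne', ENNReal.ofReal_one]

theorem limitMass_three_halves :
    limitMass N (3 / 2) = ENNReal.ofReal ((3 * N - 2) / (6 * N - 3)) := by
  have h : ∀ m : ℕ, weight N ((realR N)^[m] (3 / 2)) = 0 := fun m => by
    by_contra h
    exact (mem_Ioo_of_weight_iterate_ne_zero h).2.false
  simp [limitMass, h]

/-- By `iterate_unique` the series defining the mass has a single nonzero term. -/
theorem limitMass_of_weight {m : ℕ} {z : ℝ} (h : weight N ((realR N)^[m] z) ≠ 0) :
    limitMass N z =
      ENNReal.ofReal (weight N ((realR N)^[m] z) / ((6 * N - 3) * (3 * N : ℝ) ^ (m + 1))) := by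
  rw [limitMass, if_neg (mem_Ioo_of_weight_iterate_ne_zero h).2.ne, zero_add, tsum_eq_single m,
    ← ENNReal.ofReal_natCast, ← ENNReal.ofReal_mul (Nat.cast_nonneg _), div_eq_mul_inv]
  intro m' hm'
  by_contra hc
  refine hm' (iterate_unique (z := z) (fun h0 => hc ?_) h)
  simp [h0]

theorem limitMass_eq_zero {z : ℝ} (h : z ≠ 3 / 2) (h' : ∀ m, weight N ((realR N)^[m] z) = 0) :
    limitMass N z = 0 := by
  simp [limitMass, h, h']

theorem limitMass_ne_zero_iff {z : ℝ} :
    limitMass N z ≠ 0 ↔ z = 3 / 2 ∨ ∃ m, weight N ((realR N)^[m] z) ≠ 0 := by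
  have h3 : (1 : ℝ) ≤ N := by exact_mod_cast NeZero.one_le
  have h6 : (0 : ℝ) < 6 * N - 3 := by linarith
  have h2 : (0 : ℝ) < 3 * N - 2 := by linarith
  constructor
  · contrapose!
    exact fun h => limitMass_eq_zero h.1 h.2
  · rintro (rfl | ⟨m, hm⟩)
    · rw [limitMass_three_halves, ENNReal.ofReal_ne_zero_iff]
      positivity
    · have : (0 : ℝ) < weight N ((realR N)^[m] z) := by exact_mod_cast Nat.pos_of_ne_zero hm
      rw [limitMass_of_weight hm, ENNReal.ofReal_ne_zero_iff]
      positivity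

/-- The integrated density of states, as a probability mass function. -/
noncomputable def limitPMF (N : ℕ) [NeZero N] : PMF ℝ :=
  ⟨limitMass N, ENNReal.summable.hasSum_iff.2 tsum_limitMass⟩

theorem limitPMF_apply (z : ℝ) : limitPMF N z = limitMass N z := rfl

theorem limitPMF_three_halves : (limitPMF N (3 / 2)).toReal = (3 * N - 2) / (6 * N - 3) := by
  have h3 : (1 : ℝ) ≤ N := by exact_mod_cast NeZero.one_le
  rw [limitPMF_apply, limitMass_three_halves, ENNReal.toReal_ofReal
    (div_nonneg (by linarith) (by linarith))]

theorem limitPMF_of_weight {m : ℕ} {z : ℝ} (h : weight N ((realR N)^[m] z) ≠ 0) :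
    (limitPMF N z).toReal =
      weight N ((realR N)^[m] z) / ((6 * N - 3) * (3 * N : ℝ) ^ (m + 1)) := by
  have h3 : (1 : ℝ) ≤ N := by exact_mod_cast NeZero.one_le
  rw [limitPMF_apply, limitMass_of_weight h, ENNReal.toReal_ofReal]
  exact div_nonneg (Nat.cast_nonneg _) (mul_nonneg (by linarith) (by positivity))

/-- The shift `k` is `m + 1`, the level delay of an eigenvalue that reaches the initial set after
`m` steps. Points of zero limit mass need only the trivial bound. -/
theorem exists_tendsto_le_massN (z : ℝ) : ∃ b : ℕ → ℝ, ∃ k,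
    Tendsto b atTop (𝓝 (limitPMF N z).toReal) ∧ ∀ n, b n ≤ massN N (n + k) z := by
  by_cases h : z = 3 / 2
  · subst h
    refine ⟨fun n => ((3 * N - 2) * (3 * N : ℝ) ^ n + 3 * N) / (3 * N + (6 * N - 3) * (3 * N) ^ n),
      0, ?_, fun n => ?_⟩
    · simpa [limitPMF_three_halves] using tendsto_ratio (N := N) (3 * N) (3 * N - 2) 0
    · exact div_le_div_of_nonneg_right ((le_mult_three_halves n).trans_eq (mul_comm _ _))
        (volume_pos n).le
  by_cases h' : ∃ m, weight N ((realR N)^[m] z) ≠ 0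
  · obtain ⟨m, hm⟩ := h'
    refine ⟨fun n => (weight N ((realR N)^[m] z) * (3 * N : ℝ) ^ n - 3 * N) /
      (3 * N + (6 * N - 3) * (3 * N) ^ (n + (m + 1))), m + 1, ?_, fun n => ?_⟩
    · rw [limitPMF_of_weight hm]
      exact tendsto_ratio (-(3 * N)) _ (m + 1)
    · exact div_le_div_of_nonneg_right ((weight_iterate_mul_le_mult hm n).trans_eq (mul_comm _ _))
        (volume_pos _).le
  · push Not at h'
    refine ⟨fun _ => 0, 0, ?_, fun n => massN_nonneg _ _⟩
    rw [limitPMF_apply, limitMass_eq_zero h h', ENNReal.toReal_zero]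
    exact tendsto_const_nhds

theorem tendsto_tsum_limitPMF_sub_massN :
    Tendsto (fun n => ∑' z, |(limitPMF N z).toReal - massN N n z|) atTop (𝓝 0) := by
  refine tendsto_tsum_abs_sub massN_nonneg hasSum_massN (fun _ => ENNReal.toReal_nonneg) ?_
    exists_tendsto_le_massN
  rw [← ENNReal.toReal_one, ← (limitPMF N).tsum_coe]
  exact ENNReal.tsum_toReal_eq (limitPMF N).apply_ne_top ▸
    ENNReal.hasSum_toReal (limitPMF N).tsum_coe_ne_top

theorem weight_of_mem_setA {y : ℝ} (h : (y : ℂ) ∈ setA N) : weight N y = 1 := by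
  obtain ⟨z, hz, hzy⟩ := chebFactor_eq_zero_iff.1 h
  rw [Complex.ofReal_inj] at hzy
  rw [← hzy, weight_of_mem_zeroFinset hz]

theorem weight_realSinSq {j : ℕ} (hj : j ∈ indexSet N) :
    (weight N (realSinSq N j) : ℝ) = if 3 ∣ j then (3 * N - 1 : ℝ) else 3 * N - 2 := by
  have hN := NeZero.pos N
  split_ifs with h
  · rw [weight_of_mem_sinFinsetDvd (mem_sinFinsetDvd_iff.2 ⟨j, hj, h, rfl⟩),
      Nat.cast_sub (by omega)]
    push_cast
    rfl
  · rw [weight_of_mem_sinFinsetNotDvd (mem_sinFinsetNotDvd_iff.2 ⟨j, hj, h, rfl⟩),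
      Nat.cast_sub (by omega)]
    push_cast
    rfl

theorem weight_realSinSq_ne_zero {j : ℕ} (hj : j ∈ indexSet N) : weight N (realSinSq N j) ≠ 0 := by
  have h3 : (1 : ℝ) ≤ N := by exact_mod_cast NeZero.one_le
  have h := weight_realSinSq hj
  intro h0
  rw [h0, Nat.cast_zero] at h
  split_ifs at h <;> linarith

theorem mem_initial_iff {w : ℂ} :
    w ∈ setA N ∪ sinSq N '' indexSet N ↔ ∃ y : ℝ, weight N y ≠ 0 ∧ (y : ℂ) = w := by
  constructor
  · rintro (h | ⟨j, hj, rfl⟩)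
    · obtain ⟨z, hz, hzw⟩ := chebFactor_eq_zero_iff.1 h
      exact ⟨z, by simp [weight_of_mem_zeroFinset hz], hzw⟩
    · exact ⟨realSinSq N j, weight_realSinSq_ne_zero hj, rfl⟩
  · rintro ⟨y, hy, rfl⟩
    rcases weight_cases hy with h | h | h
    · exact Or.inl (chebFactor_eq_zero_iff.2 ⟨y, h, rfl⟩)
    · obtain ⟨j, hj, -, rfl⟩ := mem_sinFinsetNotDvd_iff.1 h
      exact Or.inr ⟨j, hj, rfl⟩
    · obtain ⟨j, hj, -, rfl⟩ := mem_sinFinsetDvd_iff.1 h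
      exact Or.inr ⟨j, hj, rfl⟩

/-- Complex fibres over `(0, 3/2)` consist of real points of the same interval, so reality passes
back through every iterate. -/
theorem exists_real_of_iterate_R_eq {k : ℕ} {w : ℂ} {y : ℝ} (hy : y ∈ Set.Ioo (0 : ℝ) (3 / 2))
    (h : (R N)^[k] w = y) : ∃ x ∈ Set.Ioo (0 : ℝ) (3 / 2), (x : ℂ) = w := by
  induction k generalizing w with
  | zero => exact ⟨y, hy, h.symm⟩
  | succ k ih =>
    obtain ⟨x, hx, hxw⟩ := ih (w := R N w) h
    obtain ⟨z, rfl⟩ := exists_real_of_R_eq (NeZero.ne N) hx.1 hx.2 hxw.symm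
    rw [R_ofReal, Complex.ofReal_inj] at hxw
    exact ⟨z, mem_Ioo_of_realR_mem (NeZero.ne N) (hxw ▸ hx), rfl⟩

theorem atomSet_eq : atomSet N = Complex.ofReal '' {x : ℝ | limitMass N x ≠ 0} := by
  ext w
  simp only [atomSet, Set.mem_union, Set.mem_singleton_iff, Set.mem_iUnion, Set.mem_preimage,
    Set.mem_image, Set.mem_ofPred_eq, limitMass_ne_zero_iff]
  constructor
  · rintro (rfl | ⟨k, hk⟩)
    · exact ⟨3 / 2, Or.inl rfl, by push_cast; rfl⟩
    · obtain ⟨y, hy, hyw⟩ := mem_initial_iff.1 hk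
      obtain ⟨x, -, rfl⟩ := exists_real_of_iterate_R_eq (mem_Ioo_of_weight_ne_zero hy) hyw.symm
      rw [iterate_R_ofReal, Complex.ofReal_inj] at hyw
      exact ⟨x, Or.inr ⟨k, hyw ▸ hy⟩, rfl⟩
  · rintro ⟨x, rfl | ⟨k, hk⟩, rfl⟩
    · left; push_cast; rfl
    · right
      exact ⟨k, mem_initial_iff.2 ⟨_, hk, (iterate_R_ofReal N k x).symm⟩⟩

end

end Gasket

/-! ### Assembly of the theorem -/

theorem corollary7 (N : ℕ) [NeZero N] :
    (∀ n : ℕ, MeasureTheory.IsProbabilityMeasure (Gasket.kappaN N n : MeasureTheory.Measure ℝ)) ∧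
    ∃ κ : MeasureTheory.ProbabilityMeasure ℝ,
      -- `κ` is the weak limit of the `κ_n`, and the masses of points converge as well
      Filter.Tendsto (fun n : ℕ => Gasket.kappaN N n) Filter.atTop (nhds κ.toFiniteMeasure) ∧
      (∀ x : ℝ, Filter.Tendsto
        (fun n : ℕ => (Gasket.kappaN N n : MeasureTheory.Measure ℝ).real {x})
        Filter.atTop (nhds ((κ : MeasureTheory.Measure ℝ).real {x}))) ∧
      -- `κ` is pure point
      (∃ S : Set ℝ, S.Countable ∧ (κ : MeasureTheory.Measure ℝ) Sᶜ = 0) ∧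
      -- its set of atoms
      Complex.ofReal '' {x : ℝ | (κ : MeasureTheory.Measure ℝ) {x} ≠ 0} = Gasket.atomSet N ∧
      -- its values at the atoms
      (κ : MeasureTheory.Measure ℝ).real {3 / 2} = (3 * N - 2) / (6 * N - 3) ∧
      (∀ (m j : ℕ) (x : ℝ), j ∈ Gasket.indexSet N →
        (Gasket.R N)^[m] (x : ℂ) = Gasket.sinSq N j →
        (κ : MeasureTheory.Measure ℝ).real {x} =
          if 3 ∣ j then (3 * N - 1) / (6 * N - 3) * ((3 * N : ℝ) ^ (m + 1))⁻¹
          else (3 * N - 2) / (6 * N - 3) * ((3 * N : ℝ) ^ (m + 1))⁻¹) ∧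
      (∀ (m : ℕ) (x : ℝ), (Gasket.R N)^[m] (x : ℂ) ∈ Gasket.setA N →
        (κ : MeasureTheory.Measure ℝ).real {x} =
          ((3 * N : ℝ) ^ (m + 1))⁻¹ * (6 * (N : ℝ) - 3)⁻¹) := by
  open Gasket in
  have hs : ∀ x : ℝ, (limitPMF N).toMeasure {x} = limitPMF N x := fun x =>
    (limitPMF N).toMeasure_apply_singleton x (measurableSet_singleton x)
  have hsr : ∀ x : ℝ, (limitPMF N).toMeasure.real {x} = (limitPMF N x).toReal := fun x => by
    rw [MeasureTheory.measureReal_def, hs]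
  refine ⟨isProbabilityMeasure_kappaN, ⟨(limitPMF N).toMeasure, inferInstance⟩, ?_, ?_,
    ⟨(limitPMF N).support, (limitPMF N).support_countable, ?_⟩, ?_, ?_, ?_, ?_⟩
  · exact tendsto_kappaN rfl tendsto_tsum_limitPMF_sub_massN
  · intro x
    simp only [kappaN_real_singleton]
    change Filter.Tendsto _ _ (nhds ((limitPMF N).toMeasure.real {x}))
    rw [hsr]
    exact tendsto_massN_of_tsum tendsto_tsum_limitPMF_sub_massN x
  · exact ((limitPMF N).toMeasure_apply_eq_zero_iff
      (limitPMF N).support_countable.measurableSet.compl).2 disjoint_compl_right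
  · rw [atomSet_eq]
    congr 1
    ext x
    change (limitPMF N).toMeasure {x} ≠ 0 ↔ _
    rw [hs]
    rfl
  · change (limitPMF N).toMeasure.real {3 / 2} = _
    rw [hsr, limitPMF_three_halves]
  · intro m j x hj hx
    change (limitPMF N).toMeasure.real {x} = _
    rw [iterate_R_ofReal, sinSq_eq, Complex.ofReal_inj] at hx
    rw [hsr, limitPMF_of_weight (m := m) (hx ▸ weight_realSinSq_ne_zero hj), hx,
      weight_realSinSq hj]
    split_ifs <;> rw [← div_div, div_eq_mul_inv _ ((3 * N : ℝ) ^ (m + 1))]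
  · intro m x hx
    change (limitPMF N).toMeasure.real {x} = _
    rw [iterate_R_ofReal] at hx
    have hw := weight_of_mem_setA hx
    rw [hsr, limitPMF_of_weight (m := m) (by simp [hw]), hw, Nat.cast_one, one_div, mul_inv, mul_comm]
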